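/- **Definitions.** Regular expressions over a finite alphabet $\Sigma$ are built from $\epsilon$ and the symbols of $\Sigma$ with concatenation, $|$, $^*$, $^?$, $^+$ and the operator $\#$, where $(e_1,\ldots,e_m)\#(f_1,\ldots,f_l)$ denotes $e_1\cdots e_m f_1^?\cdots f_l^? \mid e_1^?\cdots e_m^? f_1\cdots f_l$. Such an expression is *DC$^{?+\#}$* if it is a concatenation in which every factor is a symbol, of the form $(e')^*$ or $(e')^+$ with $e'$ arbitrary, of the form $(e')^?$ with $e'$ DC$^{?+\#}$, or $\#$ applied to DC$^{?+\#}$ expressions ($\epsilon$ counts as the empty concatenation). It is *RW* if it is a concatenation $e=e_1\cdots e_n$ in which every $e_i$ is DC$^{?+\#}$ or consists only of symbols appearing once in $e$. It is *MRW* if it is RW and every symbol with an occurrence outside the scope of all $^*$ and $^+$ appears only once in $e$. A *DTD* is a triple $D=(\Sigma,r,P)$ with a finite set $\Sigma$ of labels, a root label $r\in\Sigma$, and a regular expression $P(a)$ over $\Sigma$ for every $a\in\Sigma$. A finite ordered labeled tree conforms to $D$ if its root has label $r$ and, for every node with label $a$, the sequence of the labels of its children belongs to the language of $P(a)$. It is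 assumed that $D$ has no useless symbols: every label occurs in some tree conforming to $D$. $D$ is an *MRW-DTD* if every $P(a)$ is MRW. The class $\mathcal{X}(\downarrow,\uparrow,\rightarrow^+,\leftarrow^+)$ consists of the XPath expressions $p::=\chi{::}l \mid p/p$ with $\chi\in\{\downarrow,\uparrow,\rightarrow^+,\leftarrow^+\}$ and $l\in\Sigma$. Here $\chi{::}l$ relates a node to its children, its parent, its following siblings or its preceding siblings, respectively, that have label $l$, and $p/p'$ is the composition of relations. The expression $p$ is satisfiable under $D$ if in some tree conforming to $D$ it relates the root to some node. **Theorem.** Satisfiability for $\mathcal{X}(\downarrow,\uparrow,\rightarrow^+,\leftarrow^+)$ under MRW-DTDs is decidable in polynomial time: there is a deterministic Turing machine which, given an MRW-DTD $D$ without useless symbols and an expression $p\in\mathcal{X}(\downarrow,\uparrow,\rightarrow^+,\leftarrow^+)$ over its labels, encoded as a string, decides in time polynomial in the length of the input whether $p$ is satisfiable under $D$. -/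

import Mathlib

namespace XPathSat

/-! ### Regular expressions -/

/-- Regular expressions over `α` with the constants `ε` and the symbols, and the operators
concatenation, `|`, `*`, `?`, `+` and the `(m + l)`-ary operator `#`. There is no constant for the
empty language. -/
inductive Regex (α : Type) : Type where
  | eps : Regex α
  | sym : α → Regex α
  | cat : Regex α → Regex α → Regex α
  | alt : Regex α → Regex α → Regex α
  | star : Regex α → Regex α
  | opt : Regex α → Regex α
  | plus : Regex α → Regex α
  | sharp : List (Regex α) → List (Regex α) → Regex α

namespace Regex

variable {α : Type}

mutual
/-- The string language of a regular expression; `(e₁, …, eₘ) # (f₁, …, fₗ)` denotes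
`e₁ ⋯ eₘ f₁? ⋯ fₗ? | e₁? ⋯ eₘ? f₁ ⋯ fₗ`. -/
def lang : Regex α → Language α
  | eps => 1
  | sym a => {[a]}
  | cat e f => e.lang * f.lang
  | alt e f => e.lang + f.lang
  | star e => KStar.kstar e.lang
  | opt e => e.lang + 1
  | plus e => e.lang * KStar.kstar e.lang
  | sharp es fs => langCat es * langOptCat fs + langOptCat es * langCat fs
/-- The language of `e₁ ⋯ eₘ`. -/
def langCat : List (Regex α) → Language α
  | [] => 1
  | e :: es => e.lang * langCat es
/-- The language of `e₁? ⋯ eₘ?`. -/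
def langOptCat : List (Regex α) → Language α
  | [] => 1
  | e :: es => (e.lang + 1) * langOptCat es
end

mutual
/-- The list of all occurrences of symbols in a regular expression. -/
def syms : Regex α → List α
  | eps => []
  | sym a => [a]
  | cat e f => e.syms ++ f.syms
  | alt e f => e.syms ++ f.syms
  | star e => e.syms
  | opt e => e.syms
  | plus e => e.syms
  | sharp es fs => symsList es ++ symsList fs
def symsList : List (Regex α) → List α
  | [] => []
  | e :: es => e.syms ++ symsList es
end

mutual
/-- The list of all occurrences of symbols outside the scope of any `*` and `+`. -/
def outerSyms : Regex α → List α
  | eps => []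
  | sym a => [a]
  | cat e f => e.outerSyms ++ f.outerSyms
  | alt e f => e.outerSyms ++ f.outerSyms
  | star _ => []
  | opt e => e.outerSyms
  | plus _ => []
  | sharp es fs => outerSymsList es ++ outerSymsList fs
def outerSymsList : List (Regex α) → List α
  | [] => []
  | e :: es => e.outerSyms ++ outerSymsList es
end

mutual
/-- Being DC^{?+#}: a concatenation `e₁ ⋯ eₙ` in which every `eᵢ` is a symbol, `(e')*` or `(e')+`
for an arbitrary `e'`, `(e')?` for a DC^{?+#} expression `e'`, or `#` applied to DC^{?+#}
expressions. The constant `ε` counts as the empty concatenation. -/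
def IsDC : Regex α → Prop
  | eps => True
  | sym _ => True
  | cat e f => e.IsDC ∧ f.IsDC
  | alt _ _ => False
  | star _ => True
  | opt e => e.IsDC
  | plus _ => True
  | sharp es fs => IsDCList es ∧ IsDCList fs
def IsDCList : List (Regex α) → Prop
  | [] => True
  | e :: es => e.IsDC ∧ IsDCList es
end

/-- The factors `e₁, …, eₙ` of the top-level concatenation, `e = e₁ ⋯ eₙ` with no `eᵢ` a
concatenation. -/
def factors : Regex α → List (Regex α)
  | cat e f => e.factors ++ f.factors
  | e => [e]

/-- Being RW: `e = e₁ ⋯ eₙ` where every `eᵢ` is DC^{?+#} or consists only of symbols appearing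
once in `e`. Both properties of an `eᵢ` pass to its own top-level factors, so it suffices to look
at the finest decomposition. -/
def IsRW [DecidableEq α] (e : Regex α) : Prop :=
  ∀ f ∈ e.factors, f.IsDC ∨ ∀ a ∈ f.syms, e.syms.count a = 1

/-- The condition on the content models of MRW-DTDs: `e` is RW, and every symbol that appears
outside the scope of any `*` and `+` appears only once in `e`. -/
def IsMRW [DecidableEq α] (e : Regex α) : Prop :=
  e.IsRW ∧ ∀ a ∈ e.outerSyms, e.syms.count a = 1

mutual
/-- The number of constants and operators in a regular expression. -/
def size : Regex α → ℕ
  | eps => 1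
  | sym _ => 1
  | cat e f => 1 + e.size + f.size
  | alt e f => 1 + e.size + f.size
  | star e => 1 + e.size
  | opt e => 1 + e.size
  | plus e => 1 + e.size
  | sharp es fs => 1 + sizeList es + sizeList fs
def sizeList : List (Regex α) → ℕ
  | [] => 0
  | e :: es => e.size + sizeList es
end

end Regex

/-! ### Trees and DTDs -/

/-- Unranked labeled ordered trees. -/
inductive Tree (α : Type) : Type where
  | node : α → List (Tree α) → Tree α

namespace Tree

variable {α : Type}

/-- The label of the root. -/
def label : Tree α → α
  | node a _ => a

/-- The subtrees at the children of the root, from left to right. -/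
def children : Tree α → List (Tree α)
  | node _ ts => ts

/-- The subtree at a node. A node of a tree is given by the path that leads to it from the root,
written as the list of the (zero-based) child indices along it; the root is `[]`. -/
def subtree : Tree α → List ℕ → Option (Tree α)
  | t, [] => some t
  | t, i :: w => (t.children[i]?).bind fun t' => t'.subtree w

/-- `w` is a node of the tree, and its label is `a`. -/
def HasLabel (t : Tree α) (w : List ℕ) (a : α) : Prop :=
  ∃ s, t.subtree w = some s ∧ s.label = a

/-- `w` is a node of the tree. -/
def IsNode (t : Tree α) (w : List ℕ) : Prop :=
  ∃ s, t.subtree w = some s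

end Tree

/-- A DTD with `n` labels, which are called `0, …, n - 1`. -/
structure DTD (n : ℕ) where
  root : Fin n
  content : Fin n → Regex (Fin n)

namespace DTD

variable {n : ℕ}

/-- The tree `T` conforms to the DTD `D`. -/
def Conforms (D : DTD n) (T : Tree (Fin n)) : Prop :=
  T.label = D.root ∧
    ∀ w s, T.subtree w = some s → s.children.map Tree.label ∈ (D.content s.label).lang

/-- Every label occurs in some tree that conforms to `D`. -/
def NoUselessSymbols (D : DTD n) : Prop :=
  ∀ a, ∃ T, D.Conforms T ∧ ∃ w, T.HasLabel w a

/-- `D` is an MRW-DTD. -/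
def IsMRW (D : DTD n) : Prop :=
  ∀ a, (D.content a).IsMRW

/-- The sum of the sizes of all content models. -/
def size (D : DTD n) : ℕ :=
  ∑ a, (D.content a).size

end DTD

/-! ### XPath expressions with child, parent, following-sibling and preceding-sibling axes -/

/-- The axes `↓`, `↑`, `→⁺`, `←⁺`. -/
inductive Axis : Type where
  | child
  | parent
  | following
  | preceding

/-- The expressions of the class `X(↓, ↑, →⁺, ←⁺)`: `p ::= χ::l | p/p`. -/
inductive XPath (α : Type) : Type where
  | atom : Axis → α → XPath α
  | comp : XPath α → XPath α → XPath α

namespace XPath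

variable {α : Type}

/-- `T ⊨ p(w, w')`. -/
def Holds (T : Tree α) : XPath α → List ℕ → List ℕ → Prop
  | atom .child l, w, w' => (∃ i, w' = w ++ [i]) ∧ T.HasLabel w' l
  | atom .parent l, w, w' => (∃ i, w = w' ++ [i]) ∧ T.IsNode w ∧ T.HasLabel w' l
  | atom .following l, w, w' =>
      (∃ u i j, w = u ++ [i] ∧ w' = u ++ [j] ∧ i < j) ∧ T.IsNode w ∧ T.HasLabel w' l
  | atom .preceding l, w, w' =>
      (∃ u i j, w = u ++ [i] ∧ w' = u ++ [j] ∧ j < i) ∧ T.IsNode w ∧ T.HasLabel w' l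
  | comp p q, w, w' => ∃ w'', p.Holds T w w'' ∧ q.Holds T w'' w'

/-- The tree `T` satisfies `p`: some node is reached from the root. -/
def Satisfies (T : Tree α) (p : XPath α) : Prop :=
  ∃ w, p.Holds T [] w

/-- `p` is satisfiable under the DTD `D`. -/
def Satisfiable {n : ℕ} (D : DTD n) (p : XPath (Fin n)) : Prop :=
  ∃ T, D.Conforms T ∧ p.Satisfies T

/-- The number of atomic subexpressions. -/
def size : XPath α → ℕ
  | atom _ _ => 1
  | comp p q => p.size + q.size

end XPath

/-- The inputs of the satisfiability problem for `X(↓, ↑, →⁺, ←⁺)` under MRW-DTDs: an MRW-DTD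
without useless symbols and an expression over its labels. -/
structure Input where
  n : ℕ
  dtd : DTD n
  expr : XPath (Fin n)
  mrw : dtd.IsMRW
  noUseless : dtd.NoUselessSymbols

/-! ### Inputs as strings over a finite alphabet

Everything is written in prefix notation. Labels are written in unary. Every one of the `n` labels
of a DTD has a content model of size at least one, so the length of the string is polynomial in the
sizes of the DTD and the expression (`Input.length_encode_le` below). -/

/-- The input alphabet. -/
inductive Tok : Type where
  | tick | done
  | eps | sym | cat | alt | star | opt | plus | sharp | nil | cons
  | axis (χ : Axis)
  | slash

/-- A natural number in unary, with an end marker. -/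
def encodeNat (k : ℕ) : List Tok :=
  List.replicate k Tok.tick ++ [Tok.done]

mutual
def Regex.encode {n : ℕ} : Regex (Fin n) → List Tok
  | .eps => [.eps]
  | .sym a => .sym :: encodeNat a
  | .cat e f => .cat :: (e.encode ++ f.encode)
  | .alt e f => .alt :: (e.encode ++ f.encode)
  | .star e => .star :: e.encode
  | .opt e => .opt :: e.encode
  | .plus e => .plus :: e.encode
  | .sharp es fs => .sharp :: (Regex.encodeList es ++ Regex.encodeList fs)
def Regex.encodeList {n : ℕ} : List (Regex (Fin n)) → List Tok
  | [] => [.nil]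
  | e :: es => .cons :: (e.encode ++ Regex.encodeList es)
end

/-- The number of labels, the root label, and the content models of `0, …, n - 1`. -/
def DTD.encode {n : ℕ} (D : DTD n) : List Tok :=
  encodeNat n ++ encodeNat D.root ++
    (List.ofFn fun a => (D.content a).encode).flatten

def XPath.encode {n : ℕ} : XPath (Fin n) → List Tok
  | .atom χ l => .axis χ :: encodeNat l
  | .comp p q => .slash :: (p.encode ++ q.encode)

/-- The string that represents an input. -/
def Input.encode (I : Input) : List Tok :=
  I.dtd.encode ++ I.expr.encode

/-! ### The encoding is injective -/

theorem encodeNat_inj {k l : ℕ} {r s : List Tok} (h : encodeNat k ++ r = encodeNat l ++ s) :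
    k = l ∧ r = s := by
  induction k generalizing l with
  | zero =>
    cases l with
    | zero => simpa [encodeNat] using h
    | succ l => simp [encodeNat, List.replicate_succ] at h
  | succ k ih =>
    cases l with
    | zero => simp [encodeNat, List.replicate_succ] at h
    | succ l =>
      have h' : encodeNat k ++ r = encodeNat l ++ s := by
        simpa [encodeNat, List.replicate_succ] using h
      simpa using ih h'

mutual
theorem Regex.encode_inj {n : ℕ} : ∀ (e f : Regex (Fin n)) {r s : List Tok},
    e.encode ++ r = f.encode ++ s → e = f ∧ r = s
  | .eps, f, r, s, h => by
    cases f <;> simp_all [Regex.encode]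
  | .sym a, f, r, s, h => by
    cases f <;> simp [Regex.encode] at h
    have := encodeNat_inj h
    exact ⟨by rw [Fin.ext this.1], this.2⟩
  | .cat e₁ e₂, f, r, s, h => by
    cases f <;> simp [Regex.encode] at h
    obtain ⟨rfl, h1⟩ := Regex.encode_inj e₁ _ h
    obtain ⟨rfl, h2⟩ := Regex.encode_inj e₂ _ h1
    exact ⟨rfl, h2⟩
  | .alt e₁ e₂, f, r, s, h => by
    cases f <;> simp [Regex.encode] at h
    obtain ⟨rfl, h1⟩ := Regex.encode_inj e₁ _ h
    obtain ⟨rfl, h2⟩ := Regex.encode_inj e₂ _ h1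
    exact ⟨rfl, h2⟩
  | .star e, f, r, s, h => by
    cases f <;> simp [Regex.encode] at h
    obtain ⟨rfl, h1⟩ := Regex.encode_inj e _ h
    exact ⟨rfl, h1⟩
  | .opt e, f, r, s, h => by
    cases f <;> simp [Regex.encode] at h
    obtain ⟨rfl, h1⟩ := Regex.encode_inj e _ h
    exact ⟨rfl, h1⟩
  | .plus e, f, r, s, h => by
    cases f <;> simp [Regex.encode] at h
    obtain ⟨rfl, h1⟩ := Regex.encode_inj e _ h
    exact ⟨rfl, h1⟩
  | .sharp es fs, f, r, s, h => by
    cases f <;> simp [Regex.encode] at h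
    obtain ⟨rfl, h1⟩ := Regex.encodeList_inj es _ h
    obtain ⟨rfl, h2⟩ := Regex.encodeList_inj fs _ h1
    exact ⟨rfl, h2⟩
theorem Regex.encodeList_inj {n : ℕ} : ∀ (es fs : List (Regex (Fin n))) {r s : List Tok},
    Regex.encodeList es ++ r = Regex.encodeList fs ++ s → es = fs ∧ r = s
  | [], fs, r, s, h => by
    cases fs <;> simp_all [Regex.encodeList]
  | e :: es, fs, r, s, h => by
    cases fs <;> simp [Regex.encodeList] at h
    obtain ⟨rfl, h1⟩ := Regex.encode_inj e _ h
    obtain ⟨rfl, h2⟩ := Regex.encodeList_inj es _ h1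
    exact ⟨rfl, h2⟩
end

theorem contents_inj {n m : ℕ} (c d : Fin m → Regex (Fin n)) {r s : List Tok}
    (h : (List.ofFn fun a => (c a).encode).flatten ++ r =
      (List.ofFn fun a => (d a).encode).flatten ++ s) : c = d ∧ r = s := by
  induction m with
  | zero => exact ⟨Subsingleton.elim _ _, by simpa using h⟩
  | succ m ih =>
    simp only [List.ofFn_succ, List.flatten_cons, List.append_assoc] at h
    obtain ⟨h0, h1⟩ := Regex.encode_inj _ _ h
    obtain ⟨h2, h3⟩ := ih _ _ h1
    exact ⟨funext fun i => Fin.cases h0 (fun j => congrFun h2 j) i, h3⟩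

theorem XPath.encode_inj {n : ℕ} (p q : XPath (Fin n)) {r s : List Tok}
    (h : p.encode ++ r = q.encode ++ s) : p = q ∧ r = s := by
  induction p generalizing q r s with
  | atom χ l =>
    cases q <;> simp [XPath.encode] at h
    obtain ⟨rfl, h1⟩ := h
    have := encodeNat_inj h1
    exact ⟨by rw [Fin.ext this.1], this.2⟩
  | comp p₁ p₂ ih₁ ih₂ =>
    cases q <;> simp [XPath.encode] at h
    obtain ⟨rfl, h1⟩ := ih₁ _ h
    obtain ⟨rfl, h2⟩ := ih₂ _ h1
    exact ⟨rfl, h2⟩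

theorem Input.encode_injective : Function.Injective Input.encode := by
  rintro ⟨n, ⟨r, c⟩, p, _, _⟩ ⟨m, ⟨r', c'⟩, p', _, _⟩ h
  simp only [Input.encode, DTD.encode, List.append_assoc] at h
  obtain ⟨rfl, h1⟩ := encodeNat_inj h
  obtain ⟨hr, h2⟩ := encodeNat_inj h1
  obtain rfl := Fin.ext hr
  obtain ⟨rfl, h3⟩ := contents_inj _ _ h2
  obtain ⟨rfl, _⟩ := XPath.encode_inj p p' (r := []) (s := []) (by simpa using h3)
  rfl

/-! ### The length of the encoding is polynomial in the size of the input -/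

theorem length_encodeNat (k : ℕ) : (encodeNat k).length = k + 1 := by
  simp [encodeNat]

mutual
theorem Regex.length_encode_le {n : ℕ} : ∀ e : Regex (Fin n),
    e.encode.length + 1 ≤ (n + 4) * e.size
  | .eps => by simp [Regex.encode, Regex.size]
  | .sym a => by
    have := a.isLt
    simp [Regex.encode, Regex.size, length_encodeNat]; omega
  | .cat e f => by
    have := Regex.length_encode_le e
    have := Regex.length_encode_le f
    simp [Regex.encode, Regex.size]; nlinarith
  | .alt e f => by
    have := Regex.length_encode_le e
    have := Regex.length_encode_le f
    simp [Regex.encode, Regex.size]; nlinarith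
  | .star e => by
    have := Regex.length_encode_le e
    simp [Regex.encode, Regex.size]; nlinarith
  | .opt e => by
    have := Regex.length_encode_le e
    simp [Regex.encode, Regex.size]; nlinarith
  | .plus e => by
    have := Regex.length_encode_le e
    simp [Regex.encode, Regex.size]; nlinarith
  | .sharp es fs => by
    have := Regex.length_encodeList_le es
    have := Regex.length_encodeList_le fs
    simp [Regex.encode, Regex.size]; nlinarith
theorem Regex.length_encodeList_le {n : ℕ} : ∀ es : List (Regex (Fin n)),
    (Regex.encodeList es).length ≤ (n + 4) * Regex.sizeList es + 1
  | [] => by simp [Regex.encodeList]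
  | e :: es => by
    have := Regex.length_encode_le e
    have := Regex.length_encodeList_le es
    simp [Regex.encodeList, Regex.sizeList]; nlinarith
end

theorem Regex.size_pos {α : Type} (e : Regex α) : 1 ≤ e.size := by
  cases e <;> simp [Regex.size] <;> omega

theorem XPath.length_encode_le {n : ℕ} (p : XPath (Fin n)) :
    p.encode.length + 1 ≤ (n + 4) * p.size := by
  induction p with
  | atom χ l =>
    have := l.isLt
    simp [XPath.encode, XPath.size, length_encodeNat]; omega
  | comp p q ih₁ ih₂ =>
    simp [XPath.encode, XPath.size]; nlinarith

theorem DTD.card_le_size {n : ℕ} (D : DTD n) : n ≤ D.size := by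
  have := Finset.sum_le_sum (s := Finset.univ) fun (a : Fin n) _ => (D.content a).size_pos
  simpa [DTD.size] using this

theorem Input.length_encode_le (I : Input) :
    I.encode.length ≤ (I.dtd.size + 6) * (I.dtd.size + I.expr.size) := by
  have h1 := I.dtd.card_le_size
  have h2 := I.expr.length_encode_le
  have h3 := I.dtd.root.isLt
  have h4 : (List.ofFn fun a => (I.dtd.content a).encode).flatten.length ≤
      (I.n + 4) * I.dtd.size := by
    rw [List.length_flatten, List.map_ofFn, List.sum_ofFn, DTD.size, Finset.mul_sum]
    refine Finset.sum_le_sum fun a _ => ?_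
    have := (I.dtd.content a).length_encode_le
    simp only [Function.comp]
    omega
  have h5 : (I.n + 4) * (I.dtd.size + I.expr.size) ≤
      (I.dtd.size + 4) * (I.dtd.size + I.expr.size) := Nat.mul_le_mul_right _ (by omega)
  simp only [Input.encode, DTD.encode, List.length_append, length_encodeNat]
  nlinarith

end XPathSat

/-!
Satisfiability is reduced to a criterion about pairs of positions in the input string
(`Input.satisfiable_iff`), which is then evaluated by a Turing machine that computes least fixed
points of binary relations on positions (`Input.run_satQ`, `Cmd.computableInPolyTime`).

*The criterion.* An expression is a sequence of steps. Without knowing the tree, the path from the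
current node to the root can be tracked if every node is named by the time at which it was entered
(`Problem.stack`). What the tree decides is which names belong to the same node, and how siblings
are ordered. For the order, only subsequences of the words of a content model matter, so `+` may be
read as `*` and `#` as concatenation (`Core`). A list of occurrences of symbols is realized by a
word as soon as any two of them are in an admissible order (`Core.exists_lift`,
`Core.Lift.mem_sub`). Two restrictions on MRW expressions make local choices sufficient. A symbol
with an occurrence outside all stars has no other occurrence (`Regex.IsMRW.occ_unique`), so names
with such a label and the same parent must be merged (`Problem.Same`), while all other names can be
given separate nodes. And whether two labels can occur together does not depend on the occurrences
chosen for them (`Regex.IsRW.seq_total`), so it suffices that every chain of sibling steps can be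
placed in its content model (`Problem.Pos`) and that any two labels required below one node are
compatible. `Problem.Good` states these conditions; it is necessary by `Problem.good_of_walks` and
sufficient by `Problem.exists_walks_of_good`, where siblings are sorted first by the outermost star
around their occurrences and then by the time and direction in which they were reached.

*The machine.* `Prog` is a language of structured programs over stacks that compiles to Mathlib's
multi-stack Turing machines step by step (`Prog.Exec.simulate`). On top of it, `Cmd` is a language
of queries about a string: quantifiers over positions, and tables for binary relations that can be
read and extended. Every fixed query runs in polynomial time. Repeating a pass over all pairs of
positions as often as there are pairs computes a least fixed point (`Cmd.run_fix_spec`). All notions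
in the criterion, including the parsing of the input, are least fixed points of first-order formulas
over earlier ones (`Input.Defines`).
-/

namespace XPathSat

/-! ### Structured stack programs -/

/-- Structured programs over finitely many stacks of symbols from `α`, with one register holding
the symbol popped last (if any) and one Boolean flag. -/
inductive Prog (S α : Type) : Type where
  /-- Push a symbol that is a function of the register. -/
  | push : S → (Option α → α) → Prog S α
  /-- Pop a stack into the register. -/
  | pop : S → Prog S α
  | setFlag : (Option α → Bool → Bool) → Prog S α
  | seq : Prog S α → Prog S α → Prog S α
  /-- Branch on the flag. -/
  | ite : Prog S α → Prog S α → Prog S α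
  /-- Pop a stack into the register and run the body, until the stack is found empty. -/
  | forPop : S → Prog S α → Prog S α

namespace Prog

variable {S α : Type}

/-- The store of a program: register, flag and stacks. -/
structure Store (S α : Type) where
  reg : Option α
  flag : Bool
  stk : S → List α

/-- `Exec p s s' t`: started in `s`, the program `p` stops in `s'` after `t` machine steps. -/
inductive Exec [DecidableEq S] : Prog S α → Store S α → Store S α → ℕ → Prop
  | push (k : S) (f : Option α → α) (s : Store S α) :
      Exec (.push k f) s ⟨s.reg, s.flag, Function.update s.stk k (f s.reg :: s.stk k)⟩ 1
  | pop (k : S) (s : Store S α) :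
      Exec (.pop k) s ⟨(s.stk k).head?, s.flag, Function.update s.stk k (s.stk k).tail⟩ 1
  | setFlag (f : Option α → Bool → Bool) (s : Store S α) :
      Exec (.setFlag f) s ⟨s.reg, f s.reg s.flag, s.stk⟩ 1
  | seq {p q : Prog S α} {s s' s'' : Store S α} {t t' : ℕ} :
      Exec p s s' t → Exec q s' s'' t' → Exec (.seq p q) s s'' (t + t')
  | iteTrue {p q : Prog S α} {s s' : Store S α} {t : ℕ} :
      s.flag = true → Exec p s s' t → Exec (.ite p q) s s' (t + 1)
  | iteFalse {p q : Prog S α} {s s' : Store S α} {t : ℕ} :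
      s.flag = false → Exec q s s' t → Exec (.ite p q) s s' (t + 1)
  | forNil {k : S} {p : Prog S α} {s : Store S α} :
      s.stk k = [] → Exec (.forPop k p) s ⟨none, s.flag, s.stk⟩ 1
  | forCons {k : S} {p : Prog S α} {s s' s'' : Store S α} {a : α} {l : List α} {t t' : ℕ} :
      s.stk k = a :: l → Exec p ⟨some a, s.flag, Function.update s.stk k l⟩ s' t →
      Exec (.forPop k p) s' s'' t' → Exec (.forPop k p) s s'' (t + t' + 1)

/-! ### Compiling structured programs to multi-stack Turing machines -/

/-- The stack alphabets of the compiled machine: the stacks of the program, and one more stack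
`none` for the Boolean output. -/
abbrev Alph (S α : Type) : Option S → Type
  | none => Bool
  | some _ => α

/-- The control points of a program. -/
@[reducible] def Lab : Prog S α → Type
  | .push _ _ => Unit
  | .pop _ => Unit
  | .setFlag _ => Unit
  | .seq p q => Lab p ⊕ Lab q
  | .ite p q => Option (Lab p ⊕ Lab q)
  | .forPop _ p => Option (Lab p)

theorem finite_lab : ∀ p : Prog S α, Finite (Lab p)
  | .push _ _ => inferInstanceAs (Finite Unit)
  | .pop _ => inferInstanceAs (Finite Unit)
  | .setFlag _ => inferInstanceAs (Finite Unit)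
  | .seq p q => by
    have := finite_lab p
    have := finite_lab q
    exact inferInstanceAs (Finite (Lab p ⊕ Lab q))
  | .ite p q => by
    have := finite_lab p
    have := finite_lab q
    exact inferInstanceAs (Finite (Option (Lab p ⊕ Lab q)))
  | .forPop _ p => by
    have := finite_lab p
    exact inferInstanceAs (Finite (Option (Lab p)))

/-- The control point at which a program starts. -/
def entry : (p : Prog S α) → Lab p
  | .push _ _ => ()
  | .pop _ => ()
  | .setFlag _ => ()
  | .seq p _ => Sum.inl (entry p)
  | .ite _ _ => none
  | .forPop _ _ => none

/-- The statement at a control point, for a machine whose labels contain those of the program via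
`e`; on termination control passes to the label `x`. -/
def code {Λ : Type} : (p : Prog S α) → (e : Lab p → Λ) → (x : Λ) → Lab p →
    Turing.TM2.Stmt (Alph S α) Λ (Option α × Bool)
  | .push k f, _, x, _ => .push (some k) (fun v => f v.1) (.goto fun _ => x)
  | .pop k, _, x, _ => .pop (some k) (fun v a => (a, v.2)) (.goto fun _ => x)
  | .setFlag f, _, x, _ => .load (fun v => (v.1, f v.1 v.2)) (.goto fun _ => x)
  | .seq p q, e, _, .inl l => code p (fun l => e (.inl l)) (e (.inr (entry q))) l
  | .seq _ q, e, x, .inr l => code q (fun l => e (.inr l)) x l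
  | .ite p q, e, _, none =>
    .branch (fun v => v.2) (.goto fun _ => e (some (.inl (entry p))))
      (.goto fun _ => e (some (.inr (entry q))))
  | .ite p _, e, x, some (.inl l) => code p (fun l => e (some (.inl l))) x l
  | .ite _ q, e, x, some (.inr l) => code q (fun l => e (some (.inr l))) x l
  | .forPop k p, e, x, none =>
    .pop (some k) (fun v a => (a, v.2))
      (.branch (fun v => v.1.isSome) (.goto fun _ => e (some (entry p))) (.goto fun _ => x))
  | .forPop _ p, e, _, some l => code p (fun l => e (some l)) (e none) l

/-- The stacks of the machine in a given store, with an output stack. -/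
def fullStk (s : S → List α) (o : List Bool) : ∀ k : Option S, List (Alph S α k)
  | none => o
  | some k => s k

theorem update_fullStk [DecidableEq S] (s : S → List α) (o : List Bool) (k : S) (l : List α) :
    Function.update (fullStk s o) (some k) l = fullStk (Function.update s k l) o := by
  funext j
  cases j with
  | none => simp [fullStk]
  | some j =>
    by_cases h : j = k
    · subst h; simp [fullStk]
    · rw [Function.update_of_ne (by simpa using h)]
      simp [fullStk, Function.update_of_ne h]

/-- The configuration of the machine that corresponds to a store. -/
def cfg {Λ : Type} (l : Λ) (s : Store S α) :
    Turing.TM2.Cfg (Alph S α) Λ (Option α × Bool) :=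
  ⟨some l, (s.reg, s.flag), fullStk s.stk []⟩

theorem iterate_bind_add {β : Type} (f : β → Option β) (m n : ℕ) (a b c : Option β)
    (h₁ : (flip bind f)^[m] a = b) (h₂ : (flip bind f)^[n] b = c) :
    (flip bind f)^[m + n] a = c := by
  rw [add_comm, Function.iterate_add_apply, h₁, h₂]

/-- The compiled code simulates the program step by step. -/
theorem Exec.simulate [DecidableEq S] {p : Prog S α} {s s' : Store S α} {t : ℕ}
    (h : Exec p s s' t) : ∀ {Λ : Type} (m : Λ → Turing.TM2.Stmt (Alph S α) Λ (Option α × Bool))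
      (e : Lab p → Λ) (x : Λ), (∀ l, m (e l) = code p e x l) →
      (flip bind (Turing.TM2.step m))^[t] (some (cfg (e (entry p)) s)) = some (cfg x s') := by
  induction h with
  | push k f s =>
    intro Λ m e x hm
    simp [flip, cfg, hm, code, entry, fullStk, update_fullStk]
  | pop k s =>
    intro Λ m e x hm
    simp [flip, cfg, hm, code, entry, fullStk, update_fullStk]
  | setFlag f s =>
    intro Λ m e x hm
    simp [flip, cfg, hm, code, entry]
  | @seq p q s s' s'' t t' _ _ ih₁ ih₂ =>
    intro Λ m e x hm
    exact iterate_bind_add _ _ _ _ _ _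
      (ih₁ m (fun l => e (.inl l)) (e (.inr (entry q))) fun l => hm (.inl l))
      (ih₂ m (fun l => e (.inr l)) x fun l => hm (.inr l))
  | @iteTrue p q s s' t hf _ ih =>
    intro Λ m e x hm
    rw [add_comm]
    refine iterate_bind_add _ _ _ _ _ _ ?_
      (ih m (fun l => e (some (.inl l))) x fun l => hm (some (.inl l)))
    simp [flip, cfg, hm, code, entry, hf]
  | @iteFalse p q s s' t hf _ ih =>
    intro Λ m e x hm
    rw [add_comm]
    refine iterate_bind_add _ _ _ _ _ _ ?_
      (ih m (fun l => e (some (.inr l))) x fun l => hm (some (.inr l)))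
    simp [flip, cfg, hm, code, entry, hf]
  | @forNil k p s hk =>
    intro Λ m e x hm
    simp [flip, cfg, hm, code, entry, fullStk, hk, update_fullStk]
    rw [← hk, Function.update_eq_self]
  | @forCons k p s s' s'' a l t t' hk _ _ ih₁ ih₂ =>
    intro Λ m e x hm
    rw [show t + t' + 1 = 1 + (t + t') by omega]
    refine iterate_bind_add _ _ _ _ _ _ ?_ (iterate_bind_add _ _ _ _ _ _
      (ih₁ m (fun l => e (some l)) (e none) fun l => hm (some l)) (ih₂ m e x hm))
    simp [flip, cfg, hm, code, entry, fullStk, hk, update_fullStk]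

/-- Functions bounded by a polynomial. -/
def PolyBdd (f : ℕ → ℕ) : Prop :=
  ∃ p : Polynomial ℕ, ∀ n, f n ≤ p.eval n

theorem PolyBdd.const (c : ℕ) : PolyBdd fun _ => c :=
  ⟨Polynomial.C c, fun n => by simp⟩

theorem PolyBdd.id : PolyBdd fun n => n :=
  ⟨Polynomial.X, fun n => by simp⟩

theorem PolyBdd.add {f g : ℕ → ℕ} (hf : PolyBdd f) (hg : PolyBdd g) :
    PolyBdd fun n => f n + g n := by
  obtain ⟨p, hp⟩ := hf
  obtain ⟨q, hq⟩ := hg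
  exact ⟨p + q, fun n => by simpa using add_le_add (hp n) (hq n)⟩

theorem PolyBdd.mul {f g : ℕ → ℕ} (hf : PolyBdd f) (hg : PolyBdd g) :
    PolyBdd fun n => f n * g n := by
  obtain ⟨p, hp⟩ := hf
  obtain ⟨q, hq⟩ := hg
  exact ⟨p * q, fun n => by simpa using Nat.mul_le_mul (hp n) (hq n)⟩

/-- The machine that runs `p`, then puts the flag on the output stack and halts. -/
noncomputable def machine [DecidableEq S] [Finite S] [Finite α] (k : S) (p : Prog S α) :
    Turing.FinTM2 :=
  have : Fintype S := Fintype.ofFinite S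
  have : Finite (Lab p) := finite_lab p
  { K := Option S
    k₀ := some k
    k₁ := none
    Γ := Alph S α
    Λ := Option (Lab p)
    main := some (entry p)
    ΛFin := Fintype.ofFinite _
    σ := Option α × Bool
    initialState := (none, false)
    σFin := Fintype.ofFinite _
    Γk₀Fin := Fintype.ofFinite α
    m := fun l => match l with
      | some l => code p some none l
      | none => .push none (fun v => v.2) (.load (fun _ => (none, false)) .halt) }

theorem initList_machine [DecidableEq S] [Finite S] [Finite α] (k : S) (p : Prog S α)
    (w : List α) : Turing.initList (machine k p) w =
      cfg (some (entry p)) ⟨none, false, Function.update (fun _ => []) k w⟩ := by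
  refine congrArg (fun b => (⟨some (some (entry p)), (none, false), b⟩ :
    Turing.TM2.Cfg (Alph S α) (Option (Lab p)) (Option α × Bool))) ?_
  funext j
  cases j with
  | none => exact dif_neg (by simp [machine])
  | some j =>
    by_cases h : j = k
    · subst h
      simp only [fullStk, Function.update_self]
      exact dif_pos rfl
    · simp only [fullStk, Function.update_of_ne h]
      exact dif_neg (by simpa [machine] using h)

theorem haltList_machine [DecidableEq S] [Finite S] [Finite α] (k : S) (p : Prog S α)
    (o : List Bool) : Turing.haltList (machine k p) o =
      (⟨none, (none, false), fullStk (fun _ => []) o⟩ :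
        Turing.TM2.Cfg (Alph S α) (Option (Lab p)) (Option α × Bool)) := by
  refine congrArg (fun b => (⟨none, (none, false), b⟩ :
    Turing.TM2.Cfg (Alph S α) (Option (Lab p)) (Option α × Bool))) ?_
  funext j
  cases j with
  | none => exact dif_pos rfl
  | some j => exact dif_neg (by simp [machine])

theorem step_machine_halt [DecidableEq S] [Finite S] [Finite α] (k : S) (p : Prog S α)
    (s : Store S α) : (machine k p).step (cfg none s) =
      some (⟨none, (none, false), fullStk s.stk [s.flag]⟩ :
        Turing.TM2.Cfg (Alph S α) (Option (Lab p)) (Option α × Bool)) := by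
  refine congrArg some (congrArg (fun b => (⟨none, (none, false), b⟩ :
    Turing.TM2.Cfg (Alph S α) (Option (Lab p)) (Option α × Bool))) ?_)
  funext j
  cases j with
  | none => exact Function.update_self ..
  | some j => exact Function.update_of_ne (Option.some_ne_none j) _ _

/-- A structured program that reads its input from the stack `k`, clears all its stacks, leaves
the answer in the flag and takes polynomial time yields a polynomial-time machine. -/
theorem computableInPolyTime [DecidableEq S] [Finite S] [Finite α] {β : Type} (enc : β → List α)
    (f : β → Bool) (k : S) (p : Prog S α) (T : ℕ → ℕ) (hT : PolyBdd T)
    (hp : ∀ b, ∃ t ≤ T (enc b).length, ∃ r,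
      Exec p ⟨none, false, Function.update (fun _ => []) k (enc b)⟩ ⟨r, f b, fun _ => []⟩ t) :
    Nonempty (Turing.TM2ComputableInPolyTime enc Computability.encodeBool f) := by
  choose q hq using hT
  choose t ht r hr using hp
  refine ⟨{ tm := machine k p, inputAlphabet := Equiv.refl _, outputAlphabet := Equiv.refl _,
            time := q + 1, outputsFun := fun b => ⟨⟨t b + 1, ?_⟩, ?_⟩ }⟩
  · have h₁ : List.map (Equiv.refl α).invFun (enc b) = enc b := List.map_id _
    refine iterate_bind_add (machine k p).step _ _ _ (some (cfg none ⟨r b, f b, fun _ => []⟩)) _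
      ?_ ?_
    · have h₂ := initList_machine k p (enc b)
      rw [← h₁] at h₂
      refine (congrArg (fun c => (flip bind (machine k p).step)^[t b] (some c)) h₂).trans ?_
      rw [h₁]
      exact (hr b).simulate (machine k p).m some none (fun l => rfl)
    · exact (step_machine_halt k p _).trans (congrArg some (haltList_machine k p [f b]).symm)
  · have h₁ := ht b
    have h₂ := hq (enc b).length
    simp only [Polynomial.eval_add, Polynomial.eval_one]
    show t b + 1 ≤ _
    omega

end Prog

end XPathSat

namespace XPathSat

/-! ### Reasoning about structured programs -/

namespace Prog

variable {S α : Type} [DecidableEq S]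

/-- Started in `s`, the program stops with flag `f` and stacks `k` after at most `T` steps. The
final content of the register is left open. -/
def Ends (p : Prog S α) (s : Store S α) (f : Bool) (k : S → List α) (T : ℕ) : Prop :=
  ∃ t ≤ T, ∃ y, Exec p s ⟨y, f, k⟩ t

theorem Ends.mono {p : Prog S α} {s : Store S α} {f : Bool} {k : S → List α} {T T' : ℕ}
    (h : Ends p s f k T) (hT : T ≤ T') : Ends p s f k T' := by
  obtain ⟨t, ht, y, hy⟩ := h
  exact ⟨t, ht.trans hT, y, hy⟩

theorem Ends.seq {p q : Prog S α} {s : Store S α} {f f' : Bool} {k k' : S → List α} {T T' : ℕ}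
    (h : Ends p s f k T) (h' : ∀ y, Ends q ⟨y, f, k⟩ f' k' T') :
    Ends (.seq p q) s f' k' (T + T') := by
  obtain ⟨t, ht, y, hy⟩ := h
  obtain ⟨t', ht', y', hy'⟩ := h' y
  exact ⟨t + t', by omega, y', hy.seq hy'⟩

theorem ends_push {j : S} {g : Option α → α} {y : Option α} {f : Bool} {k k' : S → List α}
    (h : Function.update k j (g y :: k j) = k') : Ends (.push j g) ⟨y, f, k⟩ f k' 1 :=
  h ▸ ⟨1, le_rfl, y, .push j g _⟩

theorem ends_setFlag {g : Option α → Bool → Bool} {y : Option α} {f f' : Bool} {k : S → List α}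
    (h : g y f = f') : Ends (.setFlag g) ⟨y, f, k⟩ f' k 1 :=
  h ▸ ⟨1, le_rfl, y, .setFlag g _⟩

theorem Ends.push_seq {q : Prog S α} {j : S} {g : Option α → α} {y : Option α} {f f' : Bool}
    {k k' : S → List α} {T : ℕ}
    (h : Ends q ⟨y, f, Function.update k j (g y :: k j)⟩ f' k' T) :
    Ends (.seq (.push j g) q) ⟨y, f, k⟩ f' k' (T + 1) := by
  obtain ⟨t, ht, y', hy⟩ := h
  exact ⟨1 + t, by omega, y', .seq (.push j g _) hy⟩

theorem Ends.pop_seq {q : Prog S α} {j : S} {y : Option α} {f f' : Bool} {k k' : S → List α}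
    {T : ℕ} (h : Ends q ⟨(k j).head?, f, Function.update k j (k j).tail⟩ f' k' T) :
    Ends (.seq (.pop j) q) ⟨y, f, k⟩ f' k' (T + 1) := by
  obtain ⟨t, ht, y', hy⟩ := h
  exact ⟨1 + t, by omega, y', .seq (.pop j _) hy⟩

theorem Ends.setFlag_seq {q : Prog S α} {g : Option α → Bool → Bool} {y : Option α}
    {f f' : Bool} {k k' : S → List α} {T : ℕ} (h : Ends q ⟨y, g y f, k⟩ f' k' T) :
    Ends (.seq (.setFlag g) q) ⟨y, f, k⟩ f' k' (T + 1) := by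
  obtain ⟨t, ht, y', hy⟩ := h
  exact ⟨1 + t, by omega, y', .seq (.setFlag g _) hy⟩

theorem Ends.ite {p q : Prog S α} {y : Option α} {f f' : Bool} {k k' : S → List α} {T : ℕ}
    (hp : f = true → Ends p ⟨y, f, k⟩ f' k' T) (hq : f = false → Ends q ⟨y, f, k⟩ f' k' T) :
    Ends (.ite p q) ⟨y, f, k⟩ f' k' (T + 1) := by
  cases f with
  | true =>
    obtain ⟨t, ht, y', hy⟩ := hp rfl
    exact ⟨t + 1, by omega, y', .iteTrue rfl hy⟩
  | false =>
    obtain ⟨t, ht, y', hy⟩ := hq rfl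
    exact ⟨t + 1, by omega, y', .iteFalse rfl hy⟩

/-- The loop rule: `g m` are the stacks before the `m`-th iteration. -/
theorem ends_forPop {p : Prog S α} {j : S} (g : ℕ → S → List α) (l : List α) (f : Bool) {T : ℕ}
    (hg : ∀ m ≤ l.length, g m j = l.drop m)
    (hp : ∀ m (h : m < l.length),
      Ends p ⟨some l[m], f, Function.update (g m) j (l.drop (m + 1))⟩ f (g (m + 1)) T)
    (y : Option α) :
    Ends (.forPop j p) ⟨y, f, g 0⟩ f (g l.length) ((T + 1) * l.length + 1) := by
  suffices h : ∀ n ≤ l.length, ∀ y,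
      Ends (.forPop j p) ⟨y, f, g (l.length - n)⟩ f (g l.length) ((T + 1) * n + 1) by
    simpa using h l.length le_rfl y
  intro n
  induction n with
  | zero =>
    intro _ y
    exact ⟨1, by omega, none, .forNil (s := ⟨y, f, g l.length⟩) (by simp [hg])⟩
  | succ n ih =>
    intro hn y
    have hm : l.length - (n + 1) < l.length := by omega
    obtain ⟨t, ht, y', hy⟩ := hp _ hm
    rw [show l.length - (n + 1) + 1 = l.length - n by omega] at hy
    obtain ⟨t', ht', y'', hy'⟩ := ih (by omega) y'
    refine ⟨t + t' + 1, by nlinarith, y'', .forCons (a := l[l.length - (n + 1)]) ?_ hy hy'⟩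
    show g _ j = _
    rw [hg _ (by omega), ← show l.length - (n + 1) + 1 = l.length - n by omega]
    exact List.drop_eq_getElem_cons hm

end Prog

/-! ### Stack programs over the input alphabet -/

open Prog

/-- The stacks used for evaluating queries. A variable `v` with value `x` is represented by a copy
of the input that is split at position `x` into the stacks `left v` and `right v`; a table is
stored as a stack of bits. The other stacks are scratch space. -/
inductive Stk (V R : Type) : Type where
  | left (v : V)
  | right (v : V)
  | tab (r : R)
  | tmp
  | acc
  | aux
deriving DecidableEq

instance {V R : Type} [Finite V] [Finite R] : Finite (Stk V R) :=
  Finite.of_injective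
    (fun s : Stk V R => match s with
      | .left v => (Sum.inl v : V ⊕ V ⊕ R ⊕ Fin 3)
      | .right v => .inr (.inl v)
      | .tab r => .inr (.inr (.inl r))
      | .tmp => .inr (.inr (.inr 0))
      | .acc => .inr (.inr (.inr 1))
      | .aux => .inr (.inr (.inr 2)))
    (by intro a b h; cases a <;> cases b <;> simp_all)

namespace Stk

variable {V R : Type}

/-- Stack contents given by their components. -/
def mk (l r : V → List Tok) (t : R → List Tok) (a b c : List Tok) : Stk V R → List Tok
  | left v => l v
  | right v => r v
  | tab q => t q
  | tmp => a
  | acc => b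
  | aux => c

variable (l r : V → List Tok) (t : R → List Tok) (a b c x : List Tok) (v : V) (q : R)

@[simp] theorem mk_left : mk l r t a b c (left v) = l v := rfl
@[simp] theorem mk_right : mk l r t a b c (right v) = r v := rfl
@[simp] theorem mk_tab : mk l r t a b c (tab q) = t q := rfl
@[simp] theorem mk_tmp : mk l r t a b c tmp = a := rfl
@[simp] theorem mk_acc : mk l r t a b c acc = b := rfl
@[simp] theorem mk_aux : mk l r t a b c aux = c := rfl

variable [DecidableEq V] [DecidableEq R]

@[simp] theorem update_left :
    Function.update (mk l r t a b c) (left v) x = mk (Function.update l v x) r t a b c := by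
  funext k; cases k <;> simp [Function.update_apply]

@[simp] theorem update_right :
    Function.update (mk l r t a b c) (right v) x = mk l (Function.update r v x) t a b c := by
  funext k; cases k <;> simp [Function.update_apply]

@[simp] theorem update_tab :
    Function.update (mk l r t a b c) (tab q) x = mk l r (Function.update t q x) a b c := by
  funext k; cases k <;> simp [Function.update_apply]

@[simp] theorem update_tmp : Function.update (mk l r t a b c) tmp x = mk l r t x b c := by
  funext k; cases k <;> simp

@[simp] theorem update_acc : Function.update (mk l r t a b c) acc x = mk l r t a x c := by
  funext k; cases k <;> simp

@[simp] theorem update_aux : Function.update (mk l r t a b c) aux x = mk l r t a b x := by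
  funext k; cases k <;> simp

end Stk

section Basic

variable {S : Type} [DecidableEq S]

theorem reverse_take_succ {α : Type} {l : List α} {m : ℕ} (h : m < l.length) :
    (l.take (m + 1)).reverse = l[m] :: (l.take m).reverse := by
  rw [List.take_succ_eq_append_getElem h, List.reverse_append]; rfl

/-- Push the symbol in the register. -/
def put (k : S) : Prog S Tok := .push k fun y => y.getD .eps

/-- Move the content of one stack to another one, reversing it. -/
def move (j k : S) : Prog S Tok := .forPop j (put k)

theorem ends_move {j k : S} (hjk : j ≠ k) (s : S → List Tok) (y : Option Tok) (f : Bool) :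
    Ends (move j k) ⟨y, f, s⟩ f
      (Function.update (Function.update s j []) k ((s j).reverse ++ s k))
      (2 * (s j).length + 1) := by
  have h := ends_forPop (p := put k) (j := j)
    (fun m => Function.update (Function.update s j ((s j).drop m)) k
      (((s j).take m).reverse ++ s k)) (s j) f (T := 1)
    (fun m _ => by simp [Function.update_of_ne hjk]) (fun m hm => ?_) y
  · simpa [move] using h
  · refine ends_push ?_
    funext i
    by_cases h₁ : i = k
    · subst h₁
      simp [reverse_take_succ hm, Function.update_of_ne hjk.symm]
    · by_cases h₂ : i = j
      · subst h₂; simp [h₁]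
      · simp [h₁, h₂]

/-- Move `j` to `k`, and move as many symbols from `t` to `x`. -/
def moveBoth (j k t x : S) : Prog S Tok :=
  .forPop j (.seq (put k) (.seq (.pop t) (put x)))

theorem ends_moveBoth {j k t x : S} (hjk : j ≠ k) (hjt : j ≠ t) (hjx : j ≠ x) (hkt : k ≠ t)
    (hkx : k ≠ x) (htx : t ≠ x) (s : S → List Tok) (hl : (s j).length ≤ (s t).length)
    (y : Option Tok) (f : Bool) :
    Ends (moveBoth j k t x) ⟨y, f, s⟩ f
      (Function.update (Function.update (Function.update (Function.update s j [])
        k ((s j).reverse ++ s k)) t ((s t).drop (s j).length))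
        x (((s t).take (s j).length).reverse ++ s x))
      (4 * (s j).length + 1) := by
  have h := ends_forPop (p := .seq (put k) (.seq (.pop t) (put x))) (j := j)
    (fun m => Function.update (Function.update (Function.update (Function.update s
      j ((s j).drop m)) k (((s j).take m).reverse ++ s k)) t ((s t).drop m))
      x (((s t).take m).reverse ++ s x)) (s j) f (T := 3)
    (fun m _ => by
      simp [Function.update_of_ne hjk, Function.update_of_ne hjt, Function.update_of_ne hjx])
    (fun m hm => ?_) y
  · simpa [moveBoth] using h
  · have hm' : m < (s t).length := by omega
    refine Ends.push_seq (Ends.pop_seq (ends_push ?_))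
    funext i
    by_cases h₁ : i = x
    · subst h₁
      simp [reverse_take_succ hm', hjt.symm, hkt.symm, hkx.symm, htx.symm, hjx.symm, htx,
        List.getElem?_eq_getElem hm']
    · by_cases h₂ : i = t
      · subst h₂; simp [h₁, hkt.symm, hjt.symm]
      · by_cases h₃ : i = k
        · subst h₃
          simp [reverse_take_succ hm, h₁, h₂, hjk.symm]
        · by_cases h₄ : i = j
          · subst h₄; simp [h₁, h₂, h₃]
          · simp [h₁, h₂, h₃, h₄]

end Basic

end XPathSat

namespace XPathSat

open Prog Stk

/-! ### Queries -/

section Cmd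

variable {V R : Type}

/-- Queries about an input string, with variables `V` that range over the positions of the string
and binary relations `R` on positions ("tables") that can be read and extended. -/
inductive Cmd (V R : Type) : Type where
  /-- Does the symbol at position `i` satisfy the test? -/
  | tok : V → (Tok → Bool) → Cmd V R
  /-- Is the pair of positions in the table? -/
  | get : R → V → V → Cmd V R
  /-- Put a pair of positions into the table; the answer is `false`. -/
  | set : R → V → V → Cmd V R
  | not : Cmd V R → Cmd V R
  | and : Cmd V R → Cmd V R → Cmd V R
  | or : Cmd V R → Cmd V R → Cmd V R
  /-- The answer of the first query is ignored. -/
  | seq : Cmd V R → Cmd V R → Cmd V R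
  /-- Evaluate the query for all positions, from left to right. -/
  | ex : V → Cmd V R → Cmd V R

/-- The content of the tables. -/
abbrev Tabs (R : Type) := R → ℕ → ℕ → Bool

variable [DecidableEq V] [DecidableEq R]

namespace Cmd

/-- The answer of a query and the tables after its evaluation. -/
def run (w : List Tok) : Cmd V R → (V → ℕ) → Tabs R → Bool × Tabs R
  | tok i f, ρ, τ => ((w[ρ i]?.map f).getD false, τ)
  | get r i j, ρ, τ => (τ r (ρ i) (ρ j), τ)
  | set r i j, ρ, τ =>
    (false, Function.update τ r fun x y => if x = ρ i ∧ y = ρ j then true else τ r x y)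
  | not c, ρ, τ => (!(run w c ρ τ).1, (run w c ρ τ).2)
  | and c d, ρ, τ =>
    if (run w c ρ τ).1 then run w d ρ (run w c ρ τ).2 else (false, (run w c ρ τ).2)
  | or c d, ρ, τ =>
    if (run w c ρ τ).1 then (true, (run w c ρ τ).2) else run w d ρ (run w c ρ τ).2
  | seq c d, ρ, τ => run w d ρ (run w c ρ τ).2
  | ex i c, ρ, τ => (List.range w.length).foldl
      (fun s x => (s.1 || (run w c (Function.update ρ i x) s.2).1,
        (run w c (Function.update ρ i x) s.2).2)) (false, τ)

/-- No quantifier occurs in the scope of a quantifier over the same variable. The list contains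
the variables in use. -/
def Scoped : Cmd V R → List V → Prop
  | tok _ _, _ => True
  | get _ _ _, _ => True
  | set _ _ _, _ => True
  | not c, l => Scoped c l
  | and c d, l => Scoped c l ∧ Scoped d l
  | or c d, l => Scoped c l ∧ Scoped d l
  | seq c d, l => Scoped c l ∧ Scoped d l
  | ex i c, l => i ∉ l ∧ Scoped c (i :: l)

instance decidableScoped : ∀ (c : Cmd V R) (l : List V), Decidable (c.Scoped l)
  | tok _ _, _ => .isTrue trivial
  | get _ _ _, _ => .isTrue trivial
  | set _ _ _, _ => .isTrue trivial
  | not c, l => decidableScoped c l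
  | and c d, l => @instDecidableAnd _ _ (decidableScoped c l) (decidableScoped d l)
  | or c d, l => @instDecidableAnd _ _ (decidableScoped c l) (decidableScoped d l)
  | seq c d, l => @instDecidableAnd _ _ (decidableScoped c l) (decidableScoped d l)
  | ex i c, l => @instDecidableAnd _ _ inferInstance (decidableScoped c (i :: l))

/-! ### Evaluating queries by structured programs -/

/-- The representation of a bit in a table. -/
def bit (b : Bool) : Tok := if b then .tick else .done

/-- The test for the representation of the bit `true`. -/
def isTick : Option Tok → Bool
  | some .tick => true
  | _ => false

@[simp] theorem isTick_bit (b : Bool) : isTick (some (bit b)) = b := by cases b <;> rfl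

/-- The representation of an `N × N` table, row by row. -/
def bits (N : ℕ) (f : ℕ → ℕ → Bool) : List Tok :=
  (List.range (N * N)).map fun k => bit (f (k / N) (k % N))

theorem length_bits (N : ℕ) (f : ℕ → ℕ → Bool) : (bits N f).length = N * N := by simp [bits]

theorem index_lt {N x y : ℕ} (hx : x < N) (hy : y < N) : x * N + y < N * N := by nlinarith

theorem getElem?_bits {N x y : ℕ} (f : ℕ → ℕ → Bool) (hx : x < N) (hy : y < N) :
    (bits N f)[x * N + y]? = some (bit (f x y)) := by
  have h₁ : (x * N + y) / N = x := by
    rw [mul_comm, Nat.mul_add_div (by omega), Nat.div_eq_of_lt hy, add_zero]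
  have h₂ : (x * N + y) % N = y := by
    rw [mul_comm, Nat.mul_add_mod, Nat.mod_eq_of_lt hy]
  simp [bits, index_lt hx hy, h₁, h₂]

theorem bits_set {N x y : ℕ} (f : ℕ → ℕ → Bool) (hx : x < N) (hy : y < N) :
    bits N (fun x' y' => if x' = x ∧ y' = y then true else f x' y') =
      (bits N f).take (x * N + y) ++ Tok.tick :: (bits N f).drop (x * N + y + 1) := by
  have h₁ : (x * N + y) / N = x := by
    rw [mul_comm, Nat.mul_add_div (by omega), Nat.div_eq_of_lt hy, add_zero]
  have h₂ : (x * N + y) % N = y := by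
    rw [mul_comm, Nat.mul_add_mod, Nat.mod_eq_of_lt hy]
  have h₃ : x * N + y < (bits N f).length := by rw [length_bits]; exact index_lt hx hy
  have h₄ := List.set_eq_take_append_cons_drop (l := bits N f) (i := x * N + y) (a := Tok.tick)
  rw [if_pos h₃] at h₄
  rw [← h₄]
  refine List.ext_getElem (by simp [length_bits]) fun k hk _ => ?_
  rw [List.getElem_set]
  split_ifs with h
  · subst h; simp [bits, h₁, h₂, bit]
  · have : ¬(k / N = x ∧ k % N = y) := fun ⟨h₃, h₄⟩ => h (by
      rw [← h₃, ← h₄]; exact Nat.div_add_mod' k N)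
    simp only [bits, List.getElem_map, List.getElem_range, if_neg this]

/-- Skip one row of the table `r`, using the variable `z` as a counter. -/
def skipRow (z : V) (r : R) : Prog (Stk V R) Tok :=
  .seq (moveBoth (right z) (left z) (tab r) aux) (move (left z) (right z))

theorem ends_skipRow {z : V} {r : R} {l rr : V → List Tok} {t : R → List Tok}
    (a b c : List Tok) (hlz : l z = []) (ht : (rr z).length ≤ (t r).length)
    (y : Option Tok) (f : Bool) :
    Ends (skipRow z r) ⟨y, f, mk l rr t a b c⟩ f
      (mk l rr (Function.update t r ((t r).drop (rr z).length)) a b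
        (((t r).take (rr z).length).reverse ++ c))
      (6 * (rr z).length + 2) := by
  have h₁ := ends_moveBoth (j := right z) (k := left z) (t := tab r) (x := aux) (by simp) (by simp)
    (by simp) (by simp) (by simp) (by simp) (mk l rr t a b c) (by simpa using ht) y f
  simp only [mk_right, mk_left, mk_tab, mk_aux, update_right, update_left, update_tab,
    update_aux, hlz, List.append_nil] at h₁
  refine Ends.mono (h₁.seq fun y => ?_) (T := 4 * (rr z).length + 1 + (2 * (rr z).length + 1))
    (by omega)
  have h₂ := ends_move (j := left z) (k := right z) (by simp)
    (mk (Function.update l z (rr z).reverse) (Function.update rr z [])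
      (Function.update t r ((t r).drop (rr z).length)) a b
      (((t r).take (rr z).length).reverse ++ c)) y f
  have h₃ : Function.update l z [] = l := by rw [← hlz, Function.update_eq_self]
  simpa [h₃] using h₂

/-- Move to the entry of the table `r` at the values of `i` and `j`: the first row by row, the
second within the row. -/
def seek (z i j : V) (r : R) : Prog (Stk V R) Tok :=
  .seq (.forPop (left i) (.seq (put tmp) (skipRow z r)))
    (.seq (move tmp (left i)) (moveBoth (left j) tmp (tab r) aux))

/-- Undo `seek`. -/
def unseek (j : V) (r : R) : Prog (Stk V R) Tok :=
  .seq (move tmp (left j)) (move aux (tab r))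

theorem ends_seek {z i j : V} {r : R} {w : List Tok} {l rr : V → List Tok} {t : R → List Tok}
    (b : List Tok) (hlz : l z = []) (hrz : rr z = w) (ht : (t r).length = w.length * w.length)
    (hi : (l i).length < w.length) (hj : (l j).length < w.length) (y : Option Tok) (f : Bool) :
    Ends (seek z i j r) ⟨y, f, mk l rr t [] b []⟩ f
      (mk (Function.update l j []) rr
        (Function.update t r ((t r).drop ((l i).length * w.length + (l j).length)))
        (l j).reverse b ((t r).take ((l i).length * w.length + (l j).length)).reverse)
      ((6 * w.length + 4) * w.length + 1 + (2 * w.length + 1 + (4 * w.length + 1))) := by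
  set N := w.length with hN
  have h₁ : Ends (.forPop (left i) (.seq (put tmp) (skipRow z r))) ⟨y, f, mk l rr t [] b []⟩ f
      (mk (Function.update l i []) rr (Function.update t r ((t r).drop ((l i).length * N)))
        (l i).reverse b ((t r).take ((l i).length * N)).reverse)
      ((6 * N + 3 + 1) * (l i).length + 1) := by
    have h := ends_forPop (p := .seq (put tmp) (skipRow z r)) (j := left i)
      (fun m => mk (Function.update l i ((l i).drop m)) rr
        (Function.update t r ((t r).drop (m * N))) ((l i).take m).reverse b
        ((t r).take (m * N)).reverse) (l i) f (T := 6 * N + 3) (fun m _ => by simp)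
      (fun m hm => ?_) y
    · simpa using h
    · have hiz : z ≠ i := by rintro rfl; simp [hlz] at hm
      have hmN : m * N + N ≤ N * N := by nlinarith
      have h := ends_skipRow (z := z) (r := r) (l := Function.update l i ((l i).drop (m + 1)))
        (rr := rr) (t := Function.update t r ((t r).drop (m * N))) ((l i).take (m + 1)).reverse b
        ((t r).take (m * N)).reverse (by simp [hiz, hlz]) (by simp [hrz, ht]; omega) (some (l i)[m]) f
      rw [hrz, ← hN] at h
      have h₅ : (t r).take ((m + 1) * N) = (t r).take (m * N) ++ ((t r).drop (m * N)).take N := by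
        rw [add_mul, one_mul, List.take_add]
      rw [← List.reverse_append, Function.update_self, ← h₅] at h
      refine Ends.push_seq ?_
      simpa [reverse_take_succ hm, add_mul] using h
  have h₂ : (6 * N + 3 + 1) * (l i).length ≤ (6 * N + 4) * N :=
    Nat.mul_le_mul_left _ hi.le
  refine (h₁.mono (by omega)).seq fun y => ?_
  have h₃ := ends_move (j := tmp) (k := left i) (by simp) (mk (Function.update l i []) rr
    (Function.update t r ((t r).drop ((l i).length * N))) (l i).reverse b
    ((t r).take ((l i).length * N)).reverse) y f
  simp only [mk_tmp, mk_left, update_tmp, update_left, List.reverse_reverse, List.append_nil,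
    Function.update_self, Function.update_idem, Function.update_eq_self, List.length_reverse] at h₃
  refine (h₃.mono (by omega)).seq fun y => ?_
  have h₆ : (l i).length * N + N ≤ N * N := by nlinarith
  have h₄ := ends_moveBoth (j := left j) (k := tmp) (t := tab r) (x := aux) (by simp) (by simp)
    (by simp) (by simp) (by simp) (by simp) (mk l rr
      (Function.update t r ((t r).drop ((l i).length * N))) [] b
      ((t r).take ((l i).length * N)).reverse) (by simp [ht]; omega) y f
  refine Ends.mono ?_ (T := 4 * (l j).length + 1) (by omega)
  simpa [List.take_add] using h₄

theorem ends_unseek {j : V} {r : R} {l rr : V → List Tok} {t : R → List Tok}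
    (a b c : List Tok) (y : Option Tok) (f : Bool) :
    Ends (unseek j r) ⟨y, f, mk l rr t a b c⟩ f
      (mk (Function.update l j (a.reverse ++ l j)) rr (Function.update t r (c.reverse ++ t r))
        [] b []) (2 * a.length + 1 + (2 * c.length + 1)) := by
  have h₁ := ends_move (j := tmp) (k := left j) (by simp) (mk l rr t a b c) y f
  simp only [mk_tmp, mk_left, update_tmp, update_left] at h₁
  refine h₁.seq fun y => ?_
  have h₂ := ends_move (j := aux) (k := tab r) (by simp)
    (mk (Function.update l j (a.reverse ++ l j)) rr t [] b c) y f
  simpa using h₂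

/-- The program that evaluates a query; the answer is left in the flag. The variable `z` has the
value `0` throughout. A quantifier keeps the disjunction of the answers obtained so far on top of
the stack `acc`. -/
def prog (z : V) : Cmd V R → Prog (Stk V R) Tok
  | tok i f => .seq (.pop (right i)) (.seq (.setFlag fun y _ => (y.map f).getD false)
      (put (right i)))
  | get r i j => .seq (seek z i j r) (.seq (.pop (tab r)) (.seq (.setFlag fun y _ => isTick y)
      (.seq (put (tab r)) (unseek j r))))
  | set r i j => .seq (seek z i j r) (.seq (.pop (tab r)) (.seq (.setFlag fun _ _ => false)
      (.seq (.push (tab r) fun _ => .tick) (unseek j r))))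
  | not c => .seq (prog z c) (.setFlag fun _ b => !b)
  | and c d => .seq (prog z c) (.ite (prog z d) (.setFlag fun _ _ => false))
  | or c d => .seq (prog z c) (.ite (.setFlag fun _ _ => true) (prog z d))
  | seq c d => .seq (prog z c) (prog z d)
  | ex i c => .seq (.push acc fun _ => .done) (.seq (.setFlag fun _ _ => false)
      (.seq (.forPop (right i) (.seq (put (right i)) (.seq (prog z c)
        (.seq (.ite (.seq (.pop acc) (.seq (.push acc fun _ => .tick) (.setFlag fun _ _ => false)))
          (.setFlag fun _ _ => false))
        (.seq (.pop (right i)) (put (left i)))))))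
      (.seq (move (left i) (right i)) (.seq (.pop acc) (.setFlag fun y _ => isTick y)))))

/-- A bound for the number of machine steps of `prog` on an input of length `N`. -/
def cost : Cmd V R → ℕ → ℕ
  | tok _ _, _ => 3
  | get _ _ _, N => (6 * N + 4) * N + 1 + (2 * N + 1 + (4 * N + 1)) + (2 * N + 2 * (N * N) + 5)
  | set _ _ _, N => (6 * N + 4) * N + 1 + (2 * N + 1 + (4 * N + 1)) + (2 * N + 2 * (N * N) + 5)
  | not c, N => cost c N + 1
  | and c d, N => cost c N + (cost d N + 1 + 1)
  | or c d, N => cost c N + (cost d N + 1 + 1)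
  | seq c d, N => cost c N + cost d N
  | ex _ c, N => (cost c N + 7 + 1) * N + 1 + (2 * N + 1 + 2) + 2

omit [DecidableEq V] [DecidableEq R] in
theorem polyBdd_cost : ∀ c : Cmd V R, PolyBdd c.cost
  | tok _ _ => .const 3
  | get _ _ _ =>
    have hN := PolyBdd.id
    have hc := PolyBdd.const
    (((((((hc 6).mul hN).add (hc 4)).mul hN).add (hc 1)).add
      ((((hc 2).mul hN).add (hc 1)).add (((hc 4).mul hN).add (hc 1)))).add
      ((((hc 2).mul hN).add ((hc 2).mul (hN.mul hN))).add (hc 5)))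
  | set _ _ _ =>
    have hN := PolyBdd.id
    have hc := PolyBdd.const
    (((((((hc 6).mul hN).add (hc 4)).mul hN).add (hc 1)).add
      ((((hc 2).mul hN).add (hc 1)).add (((hc 4).mul hN).add (hc 1)))).add
      ((((hc 2).mul hN).add ((hc 2).mul (hN.mul hN))).add (hc 5)))
  | not c => (polyBdd_cost c).add (.const 1)
  | and c d => (polyBdd_cost c).add (((polyBdd_cost d).add (.const 1)).add (.const 1))
  | or c d => (polyBdd_cost c).add (((polyBdd_cost d).add (.const 1)).add (.const 1))
  | seq c d => (polyBdd_cost c).add (polyBdd_cost d)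
  | ex _ c =>
    have hN := PolyBdd.id
    have hc := PolyBdd.const
    ((((((polyBdd_cost c).add (hc 7)).add (hc 1)).mul hN).add (hc 1)).add
      ((((hc 2).mul hN).add (hc 1)).add (hc 2))).add (hc 2)

/-- The stacks that represent an assignment `ρ` and tables `τ`. -/
def repr (w : List Tok) (ρ : V → ℕ) (τ : Tabs R) (b : List Tok) : Stk V R → List Tok :=
  mk (fun v => (w.take (ρ v)).reverse) (fun v => w.drop (ρ v)) (fun r => bits w.length (τ r)) [] b []

omit [DecidableEq R] in
theorem repr_update (w : List Tok) (ρ : V → ℕ) (τ : Tabs R) (b : List Tok) (i : V) (x : ℕ) :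
    repr w (Function.update ρ i x) τ b =
      mk (Function.update (fun v => (w.take (ρ v)).reverse) i (w.take x).reverse)
        (Function.update (fun v => w.drop (ρ v)) i (w.drop x))
        (fun r => bits w.length (τ r)) [] b [] := by
  unfold repr
  congr 1
  · funext v
    by_cases h : v = i
    · subst h; simp
    · simp [h]
  · funext v
    by_cases h : v = i
    · subst h; simp
    · simp [h]

theorem ends_prog {z : V} {w : List Tok} : ∀ (c : Cmd V R) (l : List V), c.Scoped l → z ∈ l →
    ∀ (ρ : V → ℕ), (∀ v, ρ v < w.length) → (∀ v ∉ l, ρ v = 0) → ρ z = 0 →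
    ∀ (τ : Tabs R) (b : List Tok) (y : Option Tok) (f : Bool),
      Ends (prog z c) ⟨y, f, repr w ρ τ b⟩ (run w c ρ τ).1 (repr w ρ (run w c ρ τ).2 b)
        (cost c w.length)
  | tok i g, l, _, _, ρ, hρ, _, _, τ, b, y, f => by
    refine Ends.pop_seq (Ends.setFlag_seq (T := 1) ?_)
    have h := List.drop_eq_getElem_cons (hρ i)
    simp only [run, List.getElem?_eq_getElem (hρ i)]
    simp only [repr, mk_right, update_right, h]
    refine ends_push ?_
    simp [List.getElem?_eq_getElem (hρ i), ← h]
  | get r i j, l, _, hz, ρ, hρ, _, hz', τ, b, y, f => by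
    have h₁ := ends_seek (z := z) (i := i) (j := j) (r := r) (w := w)
      (l := fun v => (w.take (ρ v)).reverse) (rr := fun v => w.drop (ρ v))
      (t := fun r => bits w.length (τ r)) b (by simp [hz']) (by simp [hz']) (length_bits _ _)
      (by simpa using hρ i) (by simpa using hρ j) y f
    have h₂ : ρ i * w.length + ρ j < w.length * w.length := index_lt (hρ i) (hρ j)
    simp only [List.length_reverse, List.length_take, Nat.min_eq_left (hρ i).le,
      Nat.min_eq_left (hρ j).le, List.reverse_reverse] at h₁
    refine h₁.seq fun y => Ends.mono (Ends.pop_seq (Ends.setFlag_seq (Ends.push_seq (T :=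
      2 * w.length + 1 + (2 * (w.length * w.length) + 1)) ?_))) (by omega)
    have h₃ := getElem?_bits (τ r) (hρ i) (hρ j)
    have h₄ : ρ i * w.length + ρ j < (bits w.length (τ r)).length := by rwa [length_bits]
    have h₅ := ends_unseek (j := j) (r := r)
      (l := Function.update (fun v => (w.take (ρ v)).reverse) j [])
      (rr := fun v => w.drop (ρ v)) (t := Function.update (fun r => bits w.length (τ r)) r
        ((bits w.length (τ r)).drop (ρ i * w.length + ρ j))) (w.take (ρ j)) b
      ((bits w.length (τ r)).take (ρ i * w.length + ρ j)).reverse (some (bit (τ r (ρ i) (ρ j))))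
      (τ r (ρ i) (ρ j))
    simp only [mk_tab, update_tab, Function.update_self, List.head?_drop, h₃, List.tail_drop,
      isTick_bit, Option.getD_some, Function.update_idem]
    have h₆ := List.drop_eq_getElem_cons h₄
    rw [List.getElem?_eq_getElem h₄, Option.some_inj] at h₃
    rw [h₃] at h₆
    rw [← h₆]
    refine Ends.mono ?_ (T := 2 * (w.take (ρ j)).length + 1 + (2 *
      ((bits w.length (τ r)).take (ρ i * w.length + ρ j)).reverse.length + 1)) (by
        simp only [List.length_take, List.length_reverse, length_bits]; omega)
    simpa [run, repr] using h₅
  | set r i j, l, _, hz, ρ, hρ, _, hz', τ, b, y, f => by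
    have h₁ := ends_seek (z := z) (i := i) (j := j) (r := r) (w := w)
      (l := fun v => (w.take (ρ v)).reverse) (rr := fun v => w.drop (ρ v))
      (t := fun r => bits w.length (τ r)) b (by simp [hz']) (by simp [hz']) (length_bits _ _)
      (by simpa using hρ i) (by simpa using hρ j) y f
    have h₂ : ρ i * w.length + ρ j < w.length * w.length := index_lt (hρ i) (hρ j)
    simp only [List.length_reverse, List.length_take, Nat.min_eq_left (hρ i).le,
      Nat.min_eq_left (hρ j).le, List.reverse_reverse] at h₁
    refine h₁.seq fun y => Ends.mono (Ends.pop_seq (Ends.setFlag_seq (Ends.push_seq (T :=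
      2 * w.length + 1 + (2 * (w.length * w.length) + 1)) ?_))) (by omega)
    have h₃ := getElem?_bits (τ r) (hρ i) (hρ j)
    have h₅ := ends_unseek (j := j) (r := r)
      (l := Function.update (fun v => (w.take (ρ v)).reverse) j [])
      (rr := fun v => w.drop (ρ v)) (t := Function.update (fun r => bits w.length (τ r)) r
        (Tok.tick :: (bits w.length (τ r)).drop (ρ i * w.length + ρ j + 1))) (w.take (ρ j)) b
      ((bits w.length (τ r)).take (ρ i * w.length + ρ j)).reverse (some (bit (τ r (ρ i) (ρ j))))
      false
    simp only [mk_tab, update_tab, Function.update_self, List.head?_drop, h₃, List.tail_drop,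
      Function.update_idem]
    refine Ends.mono ?_ (T := 2 * (w.take (ρ j)).length + 1 + (2 *
      ((bits w.length (τ r)).take (ρ i * w.length + ρ j)).reverse.length + 1)) (by
        simp only [List.length_take, List.length_reverse, length_bits]; omega)
    have h₆ : (fun r' => bits w.length (Function.update τ r
        (fun x y => if x = ρ i ∧ y = ρ j then true else τ r x y) r')) =
        Function.update (fun r => bits w.length (τ r)) r
          ((bits w.length (τ r)).take (ρ i * w.length + ρ j) ++
            Tok.tick :: (bits w.length (τ r)).drop (ρ i * w.length + ρ j + 1)) := by
      rw [← bits_set (τ r) (hρ i) (hρ j)]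
      funext r'
      by_cases h : r' = r
      · subst h; simp
      · simp [h]
    simp only [run, repr, h₆]
    simpa using h₅
  | not c, l, hl, hz, ρ, hρ, hρl, hz', τ, b, y, f => by
    exact (ends_prog c l hl hz ρ hρ hρl hz' τ b y f).seq fun y => ends_setFlag rfl
  | and c d, l, hl, hz, ρ, hρ, hρl, hz', τ, b, y, f => by
    refine (ends_prog c l hl.1 hz ρ hρ hρl hz' τ b y f).seq fun y => Ends.ite (fun h => ?_) fun h => ?_
    · simp only [run, h, if_true]
      exact (ends_prog d l hl.2 hz ρ hρ hρl hz' _ b y _).mono (by omega)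
    · simp only [run, h]
      exact (ends_setFlag rfl).mono (by omega)
  | or c d, l, hl, hz, ρ, hρ, hρl, hz', τ, b, y, f => by
    refine (ends_prog c l hl.1 hz ρ hρ hρl hz' τ b y f).seq fun y => Ends.ite (fun h => ?_) fun h => ?_
    · simp only [run, h, if_true]
      exact (ends_setFlag rfl).mono (by omega)
    · simp only [run, h]
      exact (ends_prog d l hl.2 hz ρ hρ hρl hz' _ b y _).mono (by omega)
  | seq c d, l, hl, hz, ρ, hρ, hρl, hz', τ, b, y, f => by
    exact (ends_prog c l hl.1 hz ρ hρ hρl hz' τ b y f).seq fun y =>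
      ends_prog d l hl.2 hz ρ hρ hρl hz' _ b y _
  | ex i c, l, hl, hz, ρ, hρ, hρl, hz', τ, b, y, f => by
    have hi : ρ i = 0 := hρl i hl.1
    set st : ℕ → Bool × Tabs R := fun m => (List.range m).foldl
      (fun s x => (s.1 || (run w c (Function.update ρ i x) s.2).1,
        (run w c (Function.update ρ i x) s.2).2)) (false, τ) with hst
    have hst' : ∀ m, st (m + 1) = ((st m).1 || (run w c (Function.update ρ i m) (st m).2).1,
        (run w c (Function.update ρ i m) (st m).2).2) := fun m => by
      simp [hst, List.range_succ]
    have h₁ := ends_forPop (j := right i)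
      (p := .seq (put (right i)) (.seq (prog z c)
        (.seq (.ite (.seq (.pop acc) (.seq (.push acc fun _ => .tick) (.setFlag fun _ _ => false)))
          (.setFlag fun _ _ => false))
        (.seq (.pop (right i)) (put (left i))))))
      (fun m => repr w (Function.update ρ i m) (st m).2 (bit (st m).1 :: b)) w false
      (T := cost c w.length + 7) (fun m _ => by simp [repr]) (fun m hm => ?_) y
    · have h₂ := ends_move (j := left i) (k := right i) (by simp)
        (repr w (Function.update ρ i w.length) (st w.length).2 (bit (st w.length).1 :: b)) 
      refine Ends.mono (Ends.push_seq (Ends.setFlag_seq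
        (T := (cost c w.length + 7 + 1) * w.length + 1 + (2 * w.length + 1 + 2)) ?_))
        (by simp only [cost]; omega)
      have h₃ : Function.update (repr w ρ τ b) acc (Tok.done :: repr w ρ τ b acc) =
          repr w (Function.update ρ i 0) (st 0).2 (bit (st 0).1 :: b) := by
        rw [show Function.update ρ i 0 = ρ by rw [← hi, Function.update_eq_self]]
        simp [repr, hst, bit]
      rw [h₃]
      refine h₁.seq fun y => ?_
      have h₄ := h₂ y false
      have h₅ : run w (ex i c) ρ τ = st w.length := rfl
      have h₆ := repr_update w ρ (st w.length).2 b i 0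
      rw [show Function.update ρ i 0 = ρ by rw [← hi, Function.update_eq_self]] at h₆
      rw [h₅, h₆]
      simp only [repr_update, mk_left, mk_right, update_left, update_right,
        Function.update_self, List.take_length, List.reverse_reverse, List.length_reverse,
        List.drop_length, List.append_nil, Function.update_idem] at h₄ ⊢
      refine h₄.seq fun y => Ends.pop_seq ?_
      simp only [mk_acc, update_acc, List.tail_cons, List.head?_cons, List.take_zero,
        List.reverse_nil, List.drop_zero]
      exact ends_setFlag (isTick_bit _)
    · have hzi : z ≠ i := fun h => hl.1 (h ▸ hz)
      have h₂ := List.drop_eq_getElem_cons hm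
      have h₃ : Function.update (Function.update (repr w (Function.update ρ i m) (st m).2
          (bit (st m).1 :: b)) (right i) (w.drop (m + 1))) (right i) (w[m] :: w.drop (m + 1)) =
          repr w (Function.update ρ i m) (st m).2 (bit (st m).1 :: b) := by
        rw [← h₂, Function.update_idem]
        conv_lhs => rw [show w.drop m = repr w (Function.update ρ i m) (st m).2
          (bit (st m).1 :: b) (right i) by simp [repr]]
        exact Function.update_eq_self _ _
      refine Ends.mono (Ends.push_seq (T := cost c w.length + (3 + 1 + (1 + 1))) ?_) (by omega)
      simp only [Option.getD_some, Function.update_self]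
      rw [h₃]
      refine (ends_prog (z := z) c (i :: l) hl.2 (List.mem_cons_of_mem _ hz) _ (fun v => ?_)
        (fun v hv => ?_) (by simp [hzi, hz']) _ _ _ _).seq fun y => ?_
      · by_cases h : v = i
        · subst h; simpa using hm
        · simpa [h] using hρ v
      · rw [List.mem_cons, not_or] at hv
        simp [hv.1, hρl v hv.2]
      · refine Ends.seq (f := false) (k := repr w (Function.update ρ i m)
          (run w c (Function.update ρ i m) (st m).2).2 (bit (st (m + 1)).1 :: b))
          (Ends.ite (fun h => ?_) fun h => ?_) fun y => ?_
        · refine Ends.pop_seq (Ends.push_seq ?_)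
          simp only [repr, mk_acc, update_acc, List.tail_cons, hst', h, Bool.or_true]
          exact ends_setFlag rfl
        · simp only [hst', h, Bool.or_false]
          exact (ends_setFlag rfl).mono (by omega)
        · refine Ends.pop_seq (ends_push ?_)
          rw [repr_update, repr_update, hst']
          simp only [mk_right, mk_left, update_right, update_left, Function.update_self, h₂,
            List.head?_cons, List.tail_cons, Option.getD_some, Function.update_idem,
            reverse_take_succ hm]

end Cmd

end Cmd

end XPathSat

namespace XPathSat

open Prog Stk

section Whole

variable {V R : Type} [DecidableEq V] [DecidableEq R]

namespace Cmd

/-! ### Setting up and clearing the stacks -/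

/-- The program that does nothing. -/
def skip : Prog (Stk V R) Tok := .setFlag fun _ b => b

/-- Push the symbol in the register on the right-hand stacks of some variables. -/
def putAll : List V → Prog (Stk V R) Tok
  | [] => skip
  | v :: vs => .seq (put (right v)) (putAll vs)

theorem ends_putAll (vs : List V) (hvs : vs.Nodup) (l r : V → List Tok) (t : R → List Tok)
    (a b c : List Tok) (x : Tok) (f : Bool) :
    Ends (putAll vs) ⟨some x, f, mk l r t a b c⟩ f
      (mk l (fun v => if v ∈ vs then x :: r v else r v) t a b c) (vs.length + 1) := by
  induction vs generalizing r with
  | nil =>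
    simp only [List.not_mem_nil, if_false]
    exact (ends_setFlag rfl).mono (by simp)
  | cons v vs ih =>
    rw [List.nodup_cons] at hvs
    have h := ih hvs.2 (Function.update r v (x :: r v))
    refine Ends.push_seq ?_
    simp only [Option.getD_some, mk_right, update_right]
    convert! h using 2
    funext u
    by_cases hu : u = v
    · subst hu; simp [hvs.1]
    · simp [hu]

/-- Append a row of zeros to a table, using the variable `o` as a counter. -/
def addRow (o : V) (r : R) : Prog (Stk V R) Tok :=
  .seq (.forPop (right o) (.seq (put (left o)) (.push (tab r) fun _ => .done)))
    (move (left o) (right o))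

theorem ends_addRow {o : V} {r : R} {l rr : V → List Tok} {t : R → List Tok} (a b c : List Tok)
    (hlo : l o = []) (y : Option Tok) (f : Bool) :
    Ends (addRow o r) ⟨y, f, mk l rr t a b c⟩ f
      (mk l rr (Function.update t r (List.replicate (rr o).length .done ++ t r)) a b c)
      ((2 + 1) * (rr o).length + 1 + (2 * (rr o).length + 1)) := by
  have h := ends_forPop (j := right o) (p := .seq (put (left o)) (.push (tab r) fun _ => .done))
    (fun m => mk (Function.update l o ((rr o).take m).reverse) (Function.update rr o ((rr o).drop m))
      (Function.update t r (List.replicate m .done ++ t r)) a b c) (rr o) f (T := 2)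
    (fun m _ => by simp) (fun m hm => ?_) y
  · have h₃ : Function.update l o [] = l := by rw [← hlo, Function.update_eq_self]
    simp only [List.take_zero, List.reverse_nil, List.drop_zero, List.replicate_zero,
      List.nil_append, h₃, Function.update_eq_self, List.take_length, List.drop_length] at h
    refine h.seq fun y => ?_
    have h₂ := ends_move (j := left o) (k := right o) (by simp)
      (mk (Function.update l o (rr o).reverse) (Function.update rr o [])
        (Function.update t r (List.replicate (rr o).length .done ++ t r)) a b c) y f
    simpa [hlo, h₃] using h₂
  · refine Ends.push_seq (ends_push ?_)
    simp [reverse_take_succ hm, List.replicate_succ]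

/-- Set up an empty table. -/
def initTab (z o : V) (r : R) : Prog (Stk V R) Tok :=
  .seq (.forPop (right z) (.seq (put (left z)) (addRow o r))) (move (left z) (right z))

theorem ends_initTab {z o : V} (hzo : z ≠ o) {r : R} {w : List Tok} {l rr : V → List Tok}
    {t : R → List Tok} (a b c : List Tok) (hlz : l z = []) (hlo : l o = []) (hrz : rr z = w)
    (hro : rr o = w) (htr : t r = []) (y : Option Tok) (f : Bool) :
    Ends (initTab z o r) ⟨y, f, mk l rr t a b c⟩ f
      (mk l rr (Function.update t r (bits w.length fun _ _ => false)) a b c)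
      ((5 * w.length + 3 + 1) * w.length + 1 + (2 * w.length + 1)) := by
  have h := ends_forPop (j := right z) (p := .seq (put (left z)) (addRow o r))
    (fun m => mk (Function.update l z (w.take m).reverse) (Function.update rr z (w.drop m))
      (Function.update t r (List.replicate (m * w.length) .done)) a b c) w f
      (T := 5 * w.length + 3)
    (fun m _ => by simp) (fun m hm => ?_) y
  · have h₀ : Function.update t r [] = t := by rw [← htr, Function.update_eq_self]
    have h₁ : Function.update l z [] = l := by rw [← hlz, Function.update_eq_self]
    have h₂ : Function.update rr z w = rr := by rw [← hrz, Function.update_eq_self]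
    simp only [List.take_zero, List.reverse_nil, List.drop_zero, List.replicate_zero, zero_mul,
      List.take_length, List.drop_length, h₀, h₁, h₂] at h
    refine h.seq fun y => ?_
    have h₄ := ends_move (j := left z) (k := right z) (by simp)
      (mk (Function.update l z w.reverse) (Function.update rr z [])
        (Function.update t r (List.replicate (w.length * w.length) .done)) a b c) y f
    simpa [h₁, h₂, bits, bit] using h₄
  · refine Ends.mono (Ends.push_seq ?_)
      (T := (2 + 1) * (Function.update rr z (w.drop (m + 1)) o).length + 1 +
        (2 * (Function.update rr z (w.drop (m + 1)) o).length + 1) + 1)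
      (by simp [hzo.symm, hro]; omega)
    have h₂ := ends_addRow (o := o) (r := r) (l := Function.update l z (w.take (m + 1)).reverse)
      (rr := Function.update rr z (w.drop (m + 1)))
      (t := Function.update t r (List.replicate (m * w.length) .done)) a b c (by simp [hzo.symm, hlo])
      (some w[m]) f
    have h₃ : List.replicate ((m + 1) * w.length) Tok.done =
        List.replicate w.length .done ++ List.replicate (m * w.length) .done := by
      rw [List.replicate_append_replicate]; congr 1; ring
    rw [h₃]
    simpa [hzo.symm, hro, reverse_take_succ hm] using h₂

/-- Set up empty tables one after the other. -/
def initTabs (z o : V) : List R → Prog (Stk V R) Tok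
  | [] => skip
  | r :: rs => .seq (initTab z o r) (initTabs z o rs)

theorem ends_initTabs {z o : V} (hzo : z ≠ o) {w : List Tok} {l rr : V → List Tok}
    (a b c : List Tok) (hlz : l z = []) (hlo : l o = []) (hrz : rr z = w) (hro : rr o = w)
    (f : Bool) (rs : List R) :
    ∀ (t : R → List Tok) (y : Option Tok), rs.Nodup → (∀ r ∈ rs, t r = []) →
    Ends (initTabs z o rs) ⟨y, f, mk l rr t a b c⟩ f
      (mk l rr (fun r => if r ∈ rs then bits w.length fun _ _ => false else t r) a b c)
      (((5 * w.length + 3 + 1) * w.length + 1 + (2 * w.length + 1)) * rs.length + 1) := by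
  induction rs with
  | nil =>
    intro t y _ _
    simp only [List.not_mem_nil, if_false]
    exact (ends_setFlag rfl).mono (by simp)
  | cons r rs ih =>
    intro t y hn ht
    rw [List.nodup_cons] at hn
    refine Ends.mono ((ends_initTab hzo a b c hlz hlo hrz hro (ht r (by simp)) y f).seq fun y =>
      ?_) (T := ((5 * w.length + 3 + 1) * w.length + 1 + (2 * w.length + 1)) +
        (((5 * w.length + 3 + 1) * w.length + 1 + (2 * w.length + 1)) * rs.length + 1))
      (by rw [List.length_cons]; apply le_of_eq; ring)
    convert! ih (Function.update t r (bits w.length fun _ _ => false)) y hn.2 (fun r' hr' => ?_)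
      using 2
    · funext u
      by_cases hu : u = r
      · subst hu; simp [hn.1]
      · simp [hu]
    · rw [Function.update_of_ne (by rintro rfl; exact hn.1 hr')]
      exact ht r' (by simp [hr'])

/-- Empty some stacks one after the other. -/
def clear : List (Stk V R) → Prog (Stk V R) Tok
  | [] => skip
  | k :: ks => .seq (.forPop k skip) (clear ks)

theorem ends_clear (B : ℕ) (f : Bool) (ks : List (Stk V R)) :
    ∀ (s : Stk V R → List Tok) (y : Option Tok), (∀ k, (s k).length ≤ B) →
    Ends (clear ks) ⟨y, f, s⟩ f (fun k => if k ∈ ks then [] else s k)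
      ((2 * B + 1) * ks.length + 1) := by
  induction ks with
  | nil =>
    intro s y _
    simp only [List.not_mem_nil, if_false]
    exact (ends_setFlag rfl).mono (by simp)
  | cons k ks ih =>
    intro s y hs
    have h := ends_forPop (j := k) (p := skip) (fun m => Function.update s k ((s k).drop m)) (s k) f
      (T := 1) (fun m _ => by simp) (fun m hm => by
        simp only [Function.update_idem]; exact ends_setFlag rfl) y
    simp only [List.drop_zero, Function.update_eq_self, List.drop_length] at h
    have hk := hs k
    refine Ends.mono (h.seq fun y => ?_) (T := (1 + 1) * (s k).length + 1 + ((2 * B + 1) * ks.length + 1))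
      (by rw [List.length_cons]; nlinarith)
    convert! ih (Function.update s k []) y (fun k' => ?_) using 2
    · rename_i u
      by_cases hu : u = k
      · subst hu; simp
      · simp [hu]
    · by_cases hu : k' = k
      · subst hu; simp
      · simpa [hu] using hs k'

/-- The whole program: copy the input to all variables, set up the tables, evaluate the query and
clear all stacks. -/
def whole (z o : V) (vs : List V) (rs : List R) (ks : List (Stk V R)) (c : Cmd V R) :
    Prog (Stk V R) Tok :=
  .seq (move (right z) tmp) (.seq (.forPop tmp (putAll vs))
    (.seq (initTabs z o rs) (.seq (prog z c) (clear ks))))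

theorem ends_whole {z o : V} (hzo : z ≠ o) {vs : List V} {rs : List R} {ks : List (Stk V R)}
    (hvs : vs.Nodup) (hrs : rs.Nodup) (hv : ∀ v, v ∈ vs) (hr : ∀ r, r ∈ rs) (hk : ∀ k, k ∈ ks)
    {c : Cmd V R} (hc : c.Scoped [z]) {w : List Tok} (hw : w ≠ []) :
    Ends (whole z o vs rs ks c) ⟨none, false, Function.update (fun _ => []) (right z) w⟩
      (run w c (fun _ => 0) fun _ _ _ => false).1 (fun _ => [])
      (2 * w.length + 1 + ((vs.length + 1 + 1) * w.length + 1 +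
        (((5 * w.length + 3 + 1) * w.length + 1 + (2 * w.length + 1)) * rs.length + 1 +
          (c.cost w.length + ((2 * (w.length + w.length * w.length) + 1) * ks.length + 1))))) := by
  have h₀ : (Function.update (fun _ => []) (right z) w : Stk V R → List Tok) =
      mk (fun _ => []) (Function.update (fun _ => []) z w) (fun _ => []) [] [] [] := by
    rw [← update_right]
    congr 1
    funext k
    cases k <;> rfl
  have h₀' : Function.update (Function.update (fun _ => []) z w) z [] =
      (fun _ => [] : V → List Tok) := by
    rw [Function.update_idem]; exact Function.update_eq_self z _
  have h₁ := ends_move (j := right z) (k := tmp) (by simp)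
    (mk (fun _ => []) (Function.update (fun _ => []) z w) (fun _ => ([] : List Tok)) [] [] [] :
      Stk V R → List Tok) none false
  simp only [mk_right, Function.update_self, update_right, h₀', mk_tmp, update_tmp,
    List.append_nil] at h₁
  rw [h₀]
  refine h₁.seq fun y => ?_
  have h₂ := ends_forPop (j := tmp) (p := putAll vs)
    (fun m => (mk (fun _ => []) (fun _ => (w.reverse.take m).reverse) (fun _ => ([] : List Tok))
      (w.reverse.drop m) [] [] : Stk V R → List Tok)) w.reverse false (T := vs.length + 1)
    (fun m _ => by simp) (fun m hm => by
      have h := ends_putAll vs hvs (fun _ => []) (fun _ => (w.reverse.take m).reverse)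
        (fun _ => ([] : List Tok) : R → List Tok) (w.reverse.drop (m + 1)) [] [] w.reverse[m] false
      simp only [update_tmp, reverse_take_succ hm]
      simpa only [hv, if_true] using h) y
  have h₆ : w.reverse.take w.length = w.reverse := List.take_of_length_le (by simp)
  have h₇ : w.reverse.drop w.length = [] := List.drop_of_length_le (by simp)
  simp only [List.take_zero, List.reverse_nil, List.drop_zero, List.length_reverse, h₆, h₇,
    List.reverse_reverse] at h₂
  refine h₂.seq fun y => ?_
  have h₃ := ends_initTabs hzo (w := w) (l := fun _ => []) (rr := fun _ => w) [] [] [] rfl rfl rfl rfl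
    false rs (fun _ => []) y hrs fun _ _ => rfl
  simp only [hr, if_true] at h₃
  refine h₃.seq fun y => ?_
  have h₄ := ends_prog (z := z) (w := w) c [z] hc (by simp) (fun _ => 0)
    (fun _ => List.length_pos_of_ne_nil hw) (fun _ _ => rfl) rfl (fun _ _ _ => false) [] y false
  refine Ends.seq h₄ fun y => ?_
  have h₅ := ends_clear (w.length + w.length * w.length)
    (run w c (fun _ => 0) fun _ _ _ => false).1 ks
    (repr w (fun _ => 0) (run w c (fun _ => 0) fun _ _ _ => false).2 []) y
    (fun k => by cases k <;> simp [repr, length_bits])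
  simpa only [hk, if_true] using h₅

instance : Finite Axis :=
  Finite.of_injective (fun χ : Axis => match χ with
    | .child => (0 : Fin 4) | .parent => 1 | .following => 2 | .preceding => 3)
    (by intro a b h; cases a <;> cases b <;> simp_all)

instance : Finite Tok :=
  Finite.of_injective (fun x : Tok => match x with
    | .tick => (.inl 0 : Fin 13 ⊕ Axis) | .done => .inl 1 | .eps => .inl 2 | .sym => .inl 3
    | .cat => .inl 4 | .alt => .inl 5 | .star => .inl 6 | .opt => .inl 7 | .plus => .inl 8
    | .sharp => .inl 9 | .nil => .inl 10 | .cons => .inl 11 | .slash => .inl 12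
    | .axis χ => .inr χ)
    (by intro a b h; cases a <;> cases b <;> simp_all)

/-- Every query can be evaluated in polynomial time. -/
theorem computableInPolyTime [Finite V] [Finite R] {β : Type} (enc : β → List Tok)
    (henc : ∀ b, enc b ≠ []) {z o : V} (hzo : z ≠ o) {c : Cmd V R} (hc : c.Scoped [z]) :
    Nonempty (Turing.TM2ComputableInPolyTime enc Computability.encodeBool
      fun b => (run (enc b) c (fun _ => 0) fun _ _ _ => false).1) := by
  have := Fintype.ofFinite V
  have := Fintype.ofFinite R
  have := Fintype.ofFinite (Stk V R)
  set vs := (Finset.univ : Finset V).toList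
  set rs := (Finset.univ : Finset R).toList
  set ks := (Finset.univ : Finset (Stk V R)).toList
  have hN := PolyBdd.id
  have hC := PolyBdd.const
  refine Prog.computableInPolyTime enc _ (right z) (whole z o vs rs ks c) (fun N =>
    2 * N + 1 + ((vs.length + 1 + 1) * N + 1 + (((5 * N + 3 + 1) * N + 1 + (2 * N + 1)) *
      rs.length + 1 + (c.cost N + ((2 * (N + N * N) + 1) * ks.length + 1))))) ?_ fun b =>
    ends_whole hzo (Finset.nodup_toList _) (Finset.nodup_toList _) (by simp) (by simp)
      (by simp [ks]) hc (henc b)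
  exact (((hC 2).mul hN).add (hC 1)).add ((((hC (vs.length + 1 + 1)).mul hN).add (hC 1)).add
    ((((((((((hC 5).mul hN).add (hC 3)).add (hC 1)).mul hN).add (hC 1)).add
      (((hC 2).mul hN).add (hC 1))).mul (hC _)).add (hC 1)).add
    ((polyBdd_cost c).add (((((hC 2).mul (hN.add (hN.mul hN))).add (hC 1)).mul (hC _)).add (hC 1)))))

end Cmd

end Whole

end XPathSat

namespace XPathSat

section Semantics

variable {V R : Type} [DecidableEq V] [DecidableEq R]

namespace Cmd

/-! ### First-order formulas and least fixed points -/

/-- The truth of a query that does not write to the tables, read as a first-order formula. -/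
def Sat (w : List Tok) : Cmd V R → (V → ℕ) → Tabs R → Prop
  | tok i f, ρ, _ => ∃ a, w[ρ i]? = some a ∧ f a = true
  | get r i j, ρ, τ => τ r (ρ i) (ρ j) = true
  | set _ _ _, _, _ => False
  | not c, ρ, τ => ¬Sat w c ρ τ
  | and c d, ρ, τ => Sat w c ρ τ ∧ Sat w d ρ τ
  | or c d, ρ, τ => Sat w c ρ τ ∨ Sat w d ρ τ
  | seq _ d, ρ, τ => Sat w d ρ τ
  | ex i c, ρ, τ => ∃ x < w.length, Sat w c (Function.update ρ i x) τ

/-- The query does not write to the tables. -/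
def Pure : Cmd V R → Prop
  | tok _ _ => True
  | get _ _ _ => True
  | set _ _ _ => False
  | not c => Pure c
  | and c d => Pure c ∧ Pure d
  | or c d => Pure c ∧ Pure d
  | seq c d => Pure c ∧ Pure d
  | ex _ c => Pure c

theorem run_pure (w : List Tok) : ∀ (c : Cmd V R), c.Pure → ∀ (ρ : V → ℕ) (τ : Tabs R),
    ((run w c ρ τ).1 = true ↔ Sat w c ρ τ) ∧ (run w c ρ τ).2 = τ
  | tok i f, _, ρ, τ => by
    cases h : w[ρ i]? <;> simp [run, Sat, h]
  | get r i j, _, ρ, τ => by simp [run, Sat]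
  | not c, hc, ρ, τ => by
    have h := run_pure w c hc ρ τ
    simp only [run, Sat, ← h.1, h.2]
    simp
  | and c d, hc, ρ, τ => by
    have h := run_pure w c hc.1 ρ τ
    have h' := run_pure w d hc.2 ρ τ
    simp only [run, Sat, ← h.1, h.2]
    split_ifs with h₀
    · simp [h₀, h']
    · simp [h₀]
  | or c d, hc, ρ, τ => by
    have h := run_pure w c hc.1 ρ τ
    have h' := run_pure w d hc.2 ρ τ
    simp only [run, Sat, ← h.1, h.2]
    split_ifs with h₀
    · simp [h₀]
    · simp [h₀, h']
  | seq c d, hc, ρ, τ => by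
    have h := run_pure w c hc.1 ρ τ
    have h' := run_pure w d hc.2 ρ τ
    simp only [run, Sat, h.2]
    exact h'
  | ex i c, hc, ρ, τ => by
    have h : ∀ (l : List ℕ) (b : Bool), l.foldl (fun s x =>
        (s.1 || (run w c (Function.update ρ i x) s.2).1, (run w c (Function.update ρ i x) s.2).2))
        (b, τ) = (b || l.any fun x => (run w c (Function.update ρ i x) τ).1, τ) := by
      intro l
      induction l with
      | nil => simp
      | cons x l ih =>
        intro b
        simp [(run_pure w c hc (Function.update ρ i x) τ).2, ih, Bool.or_assoc]
    simp only [run, h, Sat]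
    simp [(run_pure w c hc _ τ).1]

/-- A loop whose body always answers `false`. -/
theorem run_ex_of_false (w : List Tok) (c : Cmd V R) (i : V) (ρ : V → ℕ)
    (f : Tabs R → ℕ → Tabs R)
    (hc : ∀ x τ, run w c (Function.update ρ i x) τ = (false, f τ x)) (τ : Tabs R) :
    run w (ex i c) ρ τ = (false, (List.range w.length).foldl f τ) := by
  simp only [run, hc, Bool.or_false]
  generalize List.range w.length = l
  induction l generalizing τ with
  | nil => rfl
  | cons x l ih => simpa using ih (f τ x)

omit [DecidableEq R] in
theorem le_foldl {β : Type} {f : Tabs R → β → Tabs R} (hf : ∀ τ x, τ ≤ f τ x) (l : List β)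
    (τ : Tabs R) : τ ≤ l.foldl f τ := by
  induction l generalizing τ with
  | nil => exact le_rfl
  | cons x l ih => exact (hf τ x).trans (ih _)

omit [DecidableEq R] in
theorem eq_of_foldl_eq {β : Type} {f : Tabs R → β → Tabs R} (hf : ∀ τ x, τ ≤ f τ x) {l : List β}
    {τ : Tabs R} (h : l.foldl f τ = τ) : ∀ x ∈ l, f τ x = τ := by
  induction l with
  | nil => simp
  | cons a l ih =>
    have h₁ : f τ a = τ := le_antisymm ((le_foldl hf l _).trans h.le) (hf τ a)
    simp only [List.foldl_cons, h₁] at h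
    simpa [h₁] using ih h

theorem foldl_induction {β σ : Type} {f : σ → β → σ} (Q : σ → Prop) {l : List β}
    (hf : ∀ x ∈ l, ∀ s, Q s → Q (f s x)) {s : σ} (hs : Q s) : Q (l.foldl f s) := by
  induction l generalizing s with
  | nil => exact hs
  | cons a l ih => exact ih (fun x hx => hf x (by simp [hx])) (hf a (by simp) s hs)

theorem foldl_const {β σ : Type} (f : σ → σ) (l : List β) (s : σ) :
    l.foldl (fun s _ => f s) s = f^[l.length] s := by
  induction l generalizing s with
  | nil => rfl
  | cons a l ih => simp [ih]

/-- The table `r` with one more entry. -/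
def insertTab (r : R) (τ : Tabs R) (x y : ℕ) : Tabs R :=
  Function.update τ r fun x' y' => if x' = x ∧ y' = y then true else τ r x' y'

theorem le_insertTab (r : R) (τ : Tabs R) (x y : ℕ) : τ ≤ insertTab r τ x y := by
  intro r' x' y'
  unfold insertTab
  by_cases h : r' = r
  · subst h
    simp only [Function.update_self]
    split_ifs
    · exact Bool.le_true _
    · exact le_rfl
  · simp [h]

open scoped Classical in
/-- Go through all pairs of positions once, adding those that satisfy `P` to the table `r`. -/
noncomputable def pass (N : ℕ) (r : R) (P : Tabs R → ℕ → ℕ → Prop) (τ : Tabs R) : Tabs R :=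
  (List.range N).foldl (fun τ x => (List.range N).foldl
    (fun τ y => if P τ x y then insertTab r τ x y else τ) τ) τ

section Pass

variable {N : ℕ} {r : R} {P : Tabs R → ℕ → ℕ → Prop}

theorem pass_induction (Q : Tabs R → Prop)
    (hQ : ∀ τ, ∀ x < N, ∀ y < N, Q τ → P τ x y → Q (insertTab r τ x y)) {τ : Tabs R} (hτ : Q τ) :
    Q (pass N r P τ) := by
  refine foldl_induction Q (fun x hx s hs => foldl_induction Q (fun y hy s hs => ?_) hs) hτ
  split_ifs with h
  · exact hQ s x (by simpa using hx) y (by simpa using hy) hs h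
  · exact hs

theorem le_pass (τ : Tabs R) : τ ≤ pass N r P τ := by
  unfold pass
  refine le_foldl (R := R) (fun τ x => le_foldl (fun τ y => ?_) _ τ) _ τ
  split_ifs
  · exact le_insertTab r _ _ _
  · exact le_rfl

theorem of_pass_eq {τ : Tabs R} (h : pass N r P τ = τ) {x y : ℕ} (hx : x < N) (hy : y < N)
    (hP : P τ x y) : τ r x y = true := by
  classical
  have h₀ : ∀ (x : ℕ) (τ : Tabs R) (y : ℕ), τ ≤ if P τ x y then insertTab r τ x y else τ := by
    intro x τ y
    split_ifs
    · exact le_insertTab r _ _ _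
    · exact le_rfl
  have h₁ := eq_of_foldl_eq (fun τ x => le_foldl (h₀ x) _ τ) h x (by simpa using hx)
  have h₂ := eq_of_foldl_eq (h₀ x) h₁ y (by simpa using hy)
  rw [if_pos hP] at h₂
  rw [← h₂]
  simp [insertTab]

open scoped Classical in
/-- The number of entries of the table `r`. -/
noncomputable def card (N : ℕ) (r : R) (τ : Tabs R) : ℕ :=
  ((Finset.range N ×ˢ Finset.range N).filter fun e => τ r e.1 e.2 = true).card

omit [DecidableEq R] in
theorem card_le (τ : Tabs R) : card N r τ ≤ N * N :=
  (Finset.card_filter_le _ _).trans (by simp)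

theorem card_lt {τ : Tabs R} (h : pass N r P τ ≠ τ) : card N r τ < card N r (pass N r P τ) := by
  classical
  have hle := le_pass (N := N) (r := r) (P := P) τ
  refine Finset.card_lt_card ⟨fun e he => ?_, fun hss => h ?_⟩
  · simp only [Finset.mem_filter] at he ⊢
    refine ⟨he.1, ?_⟩
    have := hle r e.1 e.2
    rw [he.2] at this
    exact Bool.eq_true_of_true_le this
  · have hout : ∀ r' x y, ¬(r' = r ∧ x < N ∧ y < N) → pass N r P τ r' x y = τ r' x y := by
      intro r' x y hn
      refine pass_induction (fun s => s r' x y = τ r' x y) (fun s x' hx' y' hy' hs _ => ?_) rfl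
      rw [← hs, insertTab]
      by_cases h : r' = r
      · subst h
        simp only [Function.update_self]
        rw [if_neg]
        rintro ⟨rfl, rfl⟩
        exact hn ⟨rfl, hx', hy'⟩
      · simp [h]
    funext r' x y
    by_cases hn : r' = r ∧ x < N ∧ y < N
    · obtain ⟨rfl, hx, hy⟩ := hn
      cases hc : pass N r' P τ r' x y with
      | false =>
        have := hle r' x y
        rw [hc] at this
        exact (Bool.eq_false_of_le_false this).symm
      | true =>
        have := @hss (x, y) (by simp [hx, hy, hc])
        simp only [Finset.mem_filter] at this
        exact this.2.symm
    · exact hout r' x y hn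

theorem pass_iterate_stable (τ : Tabs R) :
    pass N r P ((pass N r P)^[N * N] τ) = (pass N r P)^[N * N] τ := by
  have h : ∀ k, pass N r P ((pass N r P)^[k] τ) = (pass N r P)^[k] τ ∨
      k ≤ card N r ((pass N r P)^[k] τ) := by
    intro k
    induction k with
    | zero => exact .inr (Nat.zero_le _)
    | succ k ih =>
      rw [Function.iterate_succ_apply']
      by_cases hs : pass N r P ((pass N r P)^[k] τ) = (pass N r P)^[k] τ
      · rw [hs]; exact .inl hs
      · have := card_lt hs
        exact .inr (by rcases ih with ih | ih <;> [exact absurd ih hs; omega])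
  by_contra hne
  have h₁ := card_lt hne
  have h₂ := (h (N * N)).resolve_left hne
  have h₃ := card_le (N := N) (r := r) (pass N r P ((pass N r P)^[N * N] τ))
  omega

end Pass

/-- Replace the table `r` by the least fixed point of the formula `φ`, in which the variables `i`
and `j` stand for the two arguments; the loops over `a` and `b` only serve to repeat this often
enough. -/
def fix (r : R) (a b i j : V) (φ : Cmd V R) : Cmd V R :=
  ex a (ex b (ex i (ex j (and φ (set r i j)))))

theorem run_fix {w : List Tok} {r : R} {z a b i j : V} {φ : Cmd V R} (hφ : φ.Pure)
    {P : Tabs R → ℕ → ℕ → Prop} (hza : z ≠ a) (hzb : z ≠ b) (hij : i ≠ j)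
    (hP : ∀ ρ τ x y, ρ z = 0 → x < w.length → y < w.length →
      (Sat w φ (Function.update (Function.update ρ i x) j y) τ ↔ P τ x y))
    {ρ : V → ℕ} (hρ : ρ z = 0) (τ : Tabs R) :
    run w (fix r a b i j φ) ρ τ =
      (false, (pass w.length r P)^[w.length * w.length] τ) := by
  classical
  have h₁ : ∀ ρ : V → ℕ, ρ z = 0 → ∀ τ, run w (ex i (ex j (and φ (set r i j)))) ρ τ =
      (false, pass w.length r P τ) := by
    intro ρ hρ τ
    -- Outside the range of the loops, the values of the loop bodies are irrelevant.
    have hr : ∀ (f g : Tabs R → ℕ → Tabs R) (τ : Tabs R), (∀ x < w.length, ∀ τ, f τ x = g τ x) →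
        (List.range w.length).foldl f τ = (List.range w.length).foldl g τ := by
      intro f g τ h
      exact List.foldl_ext _ _ _ fun τ x hx => h x (by simpa using hx) τ
    rw [run_ex_of_false w _ i ρ (fun τ x => (run w (ex j (and φ (set r i j)))
      (Function.update ρ i x) τ).2)]
    · refine congrArg (Prod.mk false) (hr _ _ _ fun x hx τ => ?_)
      rw [run_ex_of_false w _ j _ (fun τ y => (run w (and φ (set r i j))
        (Function.update (Function.update ρ i x) j y) τ).2)]
      · refine hr _ _ _ fun y hy τ => ?_
        have h := run_pure w φ hφ (Function.update (Function.update ρ i x) j y) τ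
        rw [hP ρ τ x y hρ hx hy] at h
        by_cases hp : P τ x y
        · simp [run, h.1.2 hp, h.2, hp, insertTab, hij]
        · have : (run w φ (Function.update (Function.update ρ i x) j y) τ).1 = false := by
            simpa using mt h.1.1 hp
          simp [run, this, h.2, hp]
      · intro y τ
        simp only [run]
        split_ifs <;> rfl
    · intro x τ
      rw [run_ex_of_false w _ j _ (fun τ y => (run w (and φ (set r i j))
        (Function.update (Function.update ρ i x) j y) τ).2)]
      intro y τ
      simp only [run]
      split_ifs <;> rfl
  unfold fix
  rw [run_ex_of_false w _ a ρ (fun τ _ => (pass w.length r P)^[w.length] τ)]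
  · rw [foldl_const, List.length_range, ← Function.iterate_mul]
  · intro x τ
    rw [run_ex_of_false w _ b _ (fun τ _ => pass w.length r P τ)]
    · rw [foldl_const, List.length_range]
    · intro y τ
      exact h₁ _ (by simp [hza, hzb, hρ]) τ

/-- The effect of `fix`: if the table `r` is empty before and `Q` is the least relation that is
closed under the formula, then the table contains `Q` afterwards; the other tables do not change. -/
theorem run_fix_spec {w : List Tok} {r : R} {z a b i j : V} {φ : Cmd V R} (hφ : φ.Pure)
    {P : Tabs R → ℕ → ℕ → Prop} (hza : z ≠ a) (hzb : z ≠ b) (hij : i ≠ j)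
    (hP : ∀ ρ τ x y, ρ z = 0 → x < w.length → y < w.length →
      (Sat w φ (Function.update (Function.update ρ i x) j y) τ ↔ P τ x y))
    {ρ : V → ℕ} (hρ : ρ z = 0) (τ : Tabs R) (hτ : ∀ x y, τ r x y = false) (Q : ℕ → ℕ → Prop)
    (hs : ∀ τ' : Tabs R, (∀ r' ≠ r, τ' r' = τ r') →
      (∀ x y, τ' r x y = true → x < w.length ∧ y < w.length ∧ Q x y) →
      ∀ x < w.length, ∀ y < w.length, P τ' x y → Q x y)
    (hc : ∀ τ' : Tabs R, (∀ r' ≠ r, τ' r' = τ r') →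
      (∀ x < w.length, ∀ y < w.length, P τ' x y → τ' r x y = true) →
      ∀ x < w.length, ∀ y < w.length, Q x y → τ' r x y = true) :
    ∃ τ', run w (fix r a b i j φ) ρ τ = (false, τ') ∧ (∀ r' ≠ r, τ' r' = τ r') ∧
      ∀ x y, τ' r x y = true ↔ x < w.length ∧ y < w.length ∧ Q x y := by
  refine ⟨_, run_fix hφ hza hzb hij hP hρ τ, ?_⟩
  set τ' := (pass w.length r P)^[w.length * w.length] τ with hτ'
  have h₁ : (∀ r' ≠ r, τ' r' = τ r') ∧
      ∀ x y, τ' r x y = true → x < w.length ∧ y < w.length ∧ Q x y := by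
    rw [hτ']
    generalize w.length * w.length = k
    induction k with
    | zero => exact ⟨fun _ _ => rfl, fun x y h => by simp [hτ] at h⟩
    | succ k ih =>
      rw [Function.iterate_succ_apply']
      refine pass_induction (fun s => (∀ r' ≠ r, s r' = τ r') ∧
          ∀ x y, s r x y = true → x < w.length ∧ y < w.length ∧ Q x y)
        (fun s x hx y hy hs' hp => ⟨fun r' hr' => ?_, fun x' y' h => ?_⟩) ih
      · simp [insertTab, hr', hs'.1 r' hr']
      · simp only [insertTab, Function.update_self] at h
        split_ifs at h with h'
        · rw [h'.1, h'.2]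
          exact ⟨hx, hy, hs s hs'.1 hs'.2 x hx y hy hp⟩
        · exact hs'.2 x' y' h
  exact ⟨h₁.1, fun x y => ⟨h₁.2 x y, fun ⟨hx, hy, hQ⟩ => hc τ' h₁.1 (fun x hx y hy =>
    of_pass_eq (pass_iterate_stable τ) hx hy) x hx y hy hQ⟩⟩

/-- Fill the table `r` with the order on positions. -/
def order (r : R) (i j : V) : Cmd V R :=
  ex i (seq (set r i i) (ex j (and (get r j j) (set r j i))))

theorem run_order {w : List Tok} {r : R} {i j : V} (hij : i ≠ j) (ρ : V → ℕ) (τ : Tabs R)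
    (hτ : ∀ x y, τ r x y = false) :
    run w (order r i j) ρ τ =
      (false, Function.update τ r fun x y => decide (x ≤ y ∧ y < w.length)) := by
  have hbody : ∀ m y (τ : Tabs R), run w (and (get r j j) (set r j i))
      (Function.update (Function.update ρ i m) j y) τ =
      (false, if τ r y y = true then insertTab r τ y m else τ) := by
    intro m y τ
    simp only [run, Function.update_self, Function.update_of_ne hij, insertTab]
    split_ifs <;> rfl
  have hloop : ∀ m (τ : Tabs R), run w (ex j (and (get r j j) (set r j i)))
      (Function.update ρ i m) τ = (false, (List.range w.length).foldl
        (fun τ y => if τ r y y = true then insertTab r τ y m else τ) τ) := fun m τ =>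
    run_ex_of_false w _ j _ _ (fun y τ => hbody m y τ) τ
  have hins : ∀ (g : ℕ → ℕ → Bool) (x y : ℕ), insertTab r (Function.update τ r g) x y =
      Function.update τ r fun x' y' => if x' = x ∧ y' = y then true else g x' y' := by
    intro g x y
    simp [insertTab]
  have hcongr : ∀ g g' : ℕ → ℕ → Bool, (∀ x y, g x y = true ↔ g' x y = true) →
      Function.update τ r g = Function.update τ r g' := fun g g' h =>
    congrArg (Function.update τ r) (funext₂ fun x y => Bool.eq_iff_iff.2 (h x y))
  have hin : ∀ m < w.length, ∀ k ≤ w.length, (List.range k).foldl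
      (fun τ y => if τ r y y = true then insertTab r τ y m else τ)
      (Function.update τ r fun x y => decide ((x ≤ y ∧ y < m) ∨ (x = m ∧ y = m))) =
      Function.update τ r fun x y => decide
        ((x ≤ y ∧ y < m) ∨ (y = m ∧ x ≤ m ∧ (x < k ∨ x = m))) := by
    intro m hm k hk
    induction k with
    | zero =>
      refine hcongr _ _ fun x y => ?_
      simp only [decide_eq_true_eq]
      omega
    | succ k ih =>
      rw [List.range_succ, List.foldl_append, ih (by omega)]
      simp only [List.foldl_cons, List.foldl_nil, Function.update_self]
      split_ifs with h
      · rw [hins]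
        simp only [decide_eq_true_eq] at h
        refine hcongr _ _ fun x y => ?_
        split_ifs with h' <;> simp only [decide_eq_true_eq, true_iff] <;> omega
      · simp only [decide_eq_true_eq] at h
        refine hcongr _ _ fun x y => ?_
        simp only [decide_eq_true_eq]
        omega
  unfold order
  rw [run_ex_of_false w _ i ρ (fun τ x => (List.range w.length).foldl
    (fun τ y => if τ r y y = true then insertTab r τ y x else τ) (insertTab r τ x x))]
  · refine congrArg (Prod.mk false) ?_
    suffices h : ∀ k ≤ w.length, (List.range k).foldl (fun τ x => (List.range w.length).foldl
        (fun τ y => if τ r y y = true then insertTab r τ y x else τ) (insertTab r τ x x)) τ =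
        Function.update τ r fun x y => decide (x ≤ y ∧ y < k) from h _ le_rfl
    intro k hk
    induction k with
    | zero =>
      have h : τ = Function.update τ r (τ r) := (Function.update_eq_self r τ).symm
      conv_lhs => rw [List.range_zero, List.foldl_nil, h]
      refine hcongr _ _ fun x y => ?_
      simp [hτ]
    | succ k ih =>
      rw [List.range_succ, List.foldl_append, ih (by omega)]
      simp only [List.foldl_cons, List.foldl_nil]
      rw [hins, hcongr _ (fun x y => decide ((x ≤ y ∧ y < k) ∨ (x = k ∧ y = k))),
        hin k (by omega) w.length le_rfl]
      · refine hcongr _ _ fun x y => ?_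
        simp only [decide_eq_true_eq]
        omega
      · intro x y
        split_ifs with h' <;> simp only [decide_eq_true_eq, true_iff] <;> omega
  · intro x τ
    rw [run, hloop]
    simp [run, insertTab]

end Cmd

end Semantics

end XPathSat

namespace XPathSat

/-! ### Occurrences of symbols in content models -/

/-- Content models up to taking subsequences of words: `+` is the same as `*`, all operands of `#`
can be present at the same time, and `?` makes no difference. -/
inductive Core (n : ℕ) : Type where
  | leaf : Core n
  | sym : Fin n → Core n
  | cat : Core n → Core n → Core n
  | alt : Core n → Core n → Core n
  | opt : Core n → Core n
  | star : Core n → Core n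

mutual
/-- The core of a regular expression. It has the shape of the encoding, so that an occurrence of a
symbol has the same position in both. -/
def Regex.core {n : ℕ} : Regex (Fin n) → Core n
  | .eps => .leaf
  | .sym a => .sym a
  | .cat e f => .cat e.core f.core
  | .alt e f => .alt e.core f.core
  | .star e => .star e.core
  | .opt e => .opt e.core
  | .plus e => .star e.core
  | .sharp es fs => .cat (Regex.coreList es) (Regex.coreList fs)
/-- The core of the concatenation of a list of expressions. -/
def Regex.coreList {n : ℕ} : List (Regex (Fin n)) → Core n
  | [] => .leaf
  | e :: es => .cat e.core (Regex.coreList es)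
end

namespace Core

variable {n : ℕ}

/-- The length of the encoding. -/
def len : Core n → ℕ
  | leaf => 1
  | sym a => a + 2
  | cat c d => 1 + c.len + d.len
  | alt c d => 1 + c.len + d.len
  | opt c => 1 + c.len
  | star c => 1 + c.len

/-- The subsequences of the words of a content model. -/
def sub : Core n → Language (Fin n)
  | leaf => 1
  | sym a => {[], [a]}
  | cat c d => c.sub * d.sub
  | alt c d => c.sub + d.sub
  | opt c => c.sub
  | star c => KStar.kstar c.sub

/-- If the encoding of the content model begins at position `o` of a string, then `q` is the
position of an occurrence of the symbol `a`. -/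
def Occ : Core n → ℕ → ℕ → Fin n → Prop
  | leaf, _, _, _ => False
  | sym b, o, q, a => q = o ∧ a = b
  | cat c d, o, q, a => c.Occ (o + 1) q a ∨ d.Occ (o + 1 + c.len) q a
  | alt c d, o, q, a => c.Occ (o + 1) q a ∨ d.Occ (o + 1 + c.len) q a
  | opt c, o, q, a => c.Occ (o + 1) q a
  | star c, o, q, a => c.Occ (o + 1) q a

/-- The occurrence `q` can be used before the occurrence `q'` in the same word. -/
def Seq : Core n → ℕ → ℕ → ℕ → Prop
  | leaf, _, _, _ => False
  | sym _, _, _, _ => False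
  | cat c d, o, q, q' => c.Seq (o + 1) q q' ∨ d.Seq (o + 1 + c.len) q q' ∨
      (∃ a, c.Occ (o + 1) q a) ∧ ∃ a, d.Occ (o + 1 + c.len) q' a
  | alt c d, o, q, q' => c.Seq (o + 1) q q' ∨ d.Seq (o + 1 + c.len) q q'
  | opt c, o, q, q' => c.Seq (o + 1) q q'
  | star c, o, q, q' => (∃ a, c.Occ (o + 1) q a) ∧ ∃ a, c.Occ (o + 1) q' a

/-- The position of the outermost star around an occurrence, or the occurrence itself if it is not
in the scope of a star. -/
def root : Core n → ℕ → ℕ → ℕ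
  | leaf, o, _ => o
  | sym _, o, _ => o
  | cat c d, o, q => if q < o + 1 + c.len then c.root (o + 1) q else d.root (o + 1 + c.len) q
  | alt c d, o, q => if q < o + 1 + c.len then c.root (o + 1) q else d.root (o + 1 + c.len) q
  | opt c, o, q => c.root (o + 1) q
  | star _, o, _ => o

/-- All occurrences of symbols. -/
def syms : Core n → List (Fin n)
  | leaf => []
  | sym a => [a]
  | cat c d => c.syms ++ d.syms
  | alt c d => c.syms ++ d.syms
  | opt c => c.syms
  | star c => c.syms

/-- The occurrences of symbols outside the scope of any star. -/
def outer : Core n → List (Fin n)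
  | leaf => []
  | sym a => [a]
  | cat c d => c.outer ++ d.outer
  | alt c d => c.outer ++ d.outer
  | opt c => c.outer
  | star _ => []

/-- No alternative occurs outside the scope of any star. -/
def NoAlt : Core n → Prop
  | leaf => True
  | sym _ => True
  | cat c d => c.NoAlt ∧ d.NoAlt
  | alt _ _ => False
  | opt c => c.NoAlt
  | star _ => True

theorem Occ.range {c : Core n} {o q : ℕ} {a : Fin n} (h : c.Occ o q a) :
    o ≤ q ∧ q < o + c.len := by
  induction c generalizing o with
  | leaf => exact h.elim
  | sym b => simp only [len]; exact ⟨h.1.ge, by have := h.1; omega⟩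
  | cat c d ihc ihd | alt c d ihc ihd =>
    simp only [len]
    rcases h with h | h
    · have := ihc h; omega
    · have := ihd h; omega
  | opt c ih | star c ih =>
    simp only [len]
    have := ih (o := o + 1) h; omega

theorem Occ.unique {c : Core n} {o q : ℕ} {a b : Fin n} (h : c.Occ o q a) (h' : c.Occ o q b) :
    a = b := by
  induction c generalizing o with
  | leaf => exact h.elim
  | sym b => exact h.2.trans h'.2.symm
  | cat c d ihc ihd | alt c d ihc ihd =>
    rcases h with h | h <;> rcases h' with h' | h'
    · exact ihc h h'
    · have := h.range; have := h'.range; omega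
    · have := h.range; have := h'.range; omega
    · exact ihd h h'
  | opt c ih | star c ih => exact ih (o := o + 1) h h'

theorem Seq.occ {c : Core n} {o q q' : ℕ} (h : c.Seq o q q') :
    (∃ a, c.Occ o q a) ∧ ∃ a, c.Occ o q' a := by
  induction c generalizing o with
  | leaf => exact h.elim
  | sym b => exact h.elim
  | cat c d ihc ihd =>
    rcases h with h | h | ⟨⟨a, ha⟩, ⟨b, hb⟩⟩
    · obtain ⟨⟨a, ha⟩, ⟨b, hb⟩⟩ := ihc h; exact ⟨⟨a, .inl ha⟩, ⟨b, .inl hb⟩⟩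
    · obtain ⟨⟨a, ha⟩, ⟨b, hb⟩⟩ := ihd h; exact ⟨⟨a, .inr ha⟩, ⟨b, .inr hb⟩⟩
    · exact ⟨⟨a, .inl ha⟩, ⟨b, .inr hb⟩⟩
  | alt c d ihc ihd =>
    rcases h with h | h
    · obtain ⟨⟨a, ha⟩, ⟨b, hb⟩⟩ := ihc h; exact ⟨⟨a, .inl ha⟩, ⟨b, .inl hb⟩⟩
    · obtain ⟨⟨a, ha⟩, ⟨b, hb⟩⟩ := ihd h; exact ⟨⟨a, .inr ha⟩, ⟨b, .inr hb⟩⟩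
  | opt c ih => exact ih (o := o + 1) h
  | star c ih => exact h

/-- A labelled list of occurrences that can be used in this order in one word. -/
def Lift (c : Core n) (o : ℕ) (ls : List (ℕ × Fin n)) : Prop :=
  (∀ p ∈ ls, c.Occ o p.1 p.2) ∧ ls.Pairwise fun p p' => c.Seq o p.1 p'.1

/-- Every subsequence of a word of the content model arises from a list of occurrences. -/
theorem exists_lift {c : Core n} {s : List (Fin n)} (h : s ∈ c.sub) (o : ℕ) :
    ∃ ls, c.Lift o ls ∧ ls.map Prod.snd = s := by
  induction c generalizing o s with
  | leaf =>
    obtain rfl : s = [] := h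
    exact ⟨[], by simp [Lift], rfl⟩
  | sym a =>
    rcases h with h | h
    · exact ⟨[], by simp [Lift], h.symm⟩
    · exact ⟨[(o, a)], by simp [Lift, Occ], (Set.mem_singleton_iff.1 h).symm⟩
  | cat c d ihc ihd =>
    obtain ⟨s₁, h₁, s₂, h₂, rfl⟩ := Language.mem_mul.1 h
    obtain ⟨l₁, ⟨ho₁, hs₁⟩, rfl⟩ := ihc h₁ (o + 1)
    obtain ⟨l₂, ⟨ho₂, hs₂⟩, rfl⟩ := ihd h₂ (o + 1 + c.len)
    refine ⟨l₁ ++ l₂, ⟨fun p hp => ?_, ?_⟩, by simp⟩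
    · rcases List.mem_append.1 hp with hp | hp
      · exact .inl (ho₁ p hp)
      · exact .inr (ho₂ p hp)
    · refine List.pairwise_append.2 ⟨hs₁.imp fun h => .inl h, hs₂.imp fun h => .inr (.inl h),
        fun p hp p' hp' => .inr (.inr ⟨⟨_, ho₁ p hp⟩, ⟨_, ho₂ p' hp'⟩⟩)⟩
  | alt c d ihc ihd =>
    rcases h with h | h
    · obtain ⟨l₁, ⟨ho₁, hs₁⟩, rfl⟩ := ihc h (o + 1)
      exact ⟨l₁, ⟨fun p hp => .inl (ho₁ p hp), hs₁.imp fun h => .inl h⟩, rfl⟩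
    · obtain ⟨l₁, ⟨ho₁, hs₁⟩, rfl⟩ := ihd h (o + 1 + c.len)
      exact ⟨l₁, ⟨fun p hp => .inr (ho₁ p hp), hs₁.imp fun h => .inr h⟩, rfl⟩
  | opt c ih => exact ih h (o + 1)
  | star c ih =>
    have h₁ : ∀ a ∈ s, ∃ q, c.Occ (o + 1) q a := by
      obtain ⟨L, rfl, hL⟩ := Language.mem_kstar.1 h
      intro a ha
      obtain ⟨y, hy, hay⟩ := List.mem_flatten.1 ha
      obtain ⟨ls, ⟨ho, _⟩, rfl⟩ := ih (hL y hy) (o + 1)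
      obtain ⟨p, hp, rfl⟩ := List.mem_map.1 hay
      exact ⟨p.1, ho p hp⟩
    clear h
    induction s with
    | nil => exact ⟨[], by simp [Lift], rfl⟩
    | cons a s ih' =>
      obtain ⟨ls, ⟨ho, hs⟩, rfl⟩ := ih' fun a ha => h₁ a (by simp [ha])
      obtain ⟨q, hq⟩ := h₁ a (by simp)
      refine ⟨(q, a) :: ls, ⟨fun p hp => ?_, List.pairwise_cons.2 ⟨fun p hp =>
        ⟨⟨a, hq⟩, ⟨_, ho p hp⟩⟩, hs⟩⟩, rfl⟩
      rcases List.mem_cons.1 hp with rfl | hp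
      · exact hq
      · exact ho p hp

theorem Lift.split {c d : Core n} {o o' : ℕ} (hdisj : ∀ q a b, c.Occ o q a → ¬d.Occ o' q b)
    {ls : List (ℕ × Fin n)} (ho : ∀ p ∈ ls, c.Occ o p.1 p.2 ∨ d.Occ o' p.1 p.2)
    (hs : ls.Pairwise fun p p' => c.Seq o p.1 p'.1 ∨ d.Seq o' p.1 p'.1 ∨
      (∃ a, c.Occ o p.1 a) ∧ ∃ a, d.Occ o' p'.1 a) :
    ∃ l₁ l₂, ls = l₁ ++ l₂ ∧ c.Lift o l₁ ∧ d.Lift o' l₂ := by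
  have hc : ∀ q q' a b, c.Occ o q a → c.Occ o q' b → (c.Seq o q q' ∨ d.Seq o' q q' ∨
      (∃ a, c.Occ o q a) ∧ ∃ a, d.Occ o' q' a) → c.Seq o q q' := by
    rintro q q' a b ha hb (h | h | ⟨_, ⟨e, he⟩⟩)
    · exact h
    · obtain ⟨⟨e, he⟩, _⟩ := h.occ; exact absurd he (hdisj _ _ _ ha)
    · exact absurd he (hdisj _ _ _ hb)
  have hd : ∀ q q' a, d.Occ o' q a → (c.Seq o q q' ∨ d.Seq o' q q' ∨
      (∃ a, c.Occ o q a) ∧ ∃ a, d.Occ o' q' a) → d.Seq o' q q' := by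
    rintro q q' a ha (h | h | ⟨⟨e, he⟩, _⟩)
    · obtain ⟨⟨e, he⟩, _⟩ := h.occ; exact absurd ha (hdisj _ _ _ he)
    · exact h
    · exact absurd ha (hdisj _ _ _ he)
  induction ls with
  | nil => exact ⟨[], [], rfl, by simp [Lift], by simp [Lift]⟩
  | cons p ls ih =>
    rw [List.pairwise_cons] at hs
    obtain ⟨l₁, l₂, rfl, h₁, h₂⟩ := ih (fun p hp => ho p (by simp [hp])) hs.2
    rcases ho p (by simp) with hp | hp
    · refine ⟨p :: l₁, l₂, rfl, ⟨fun p' hp' => ?_, List.pairwise_cons.2 ⟨fun p' hp' => ?_, h₁.2⟩⟩, h₂⟩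
      · rcases List.mem_cons.1 hp' with rfl | hp'
        · exact hp
        · exact h₁.1 p' hp'
      · exact hc _ _ _ _ hp (h₁.1 p' hp') (hs.1 p' (by simp [hp']))
    · have hl₁ : l₁ = [] := by
        refine List.eq_nil_iff_forall_not_mem.2 fun p' hp' => ?_
        obtain ⟨_, ⟨e, he⟩⟩ := (hd _ _ _ hp (hs.1 p' (by simp [hp']))).occ
        exact hdisj _ _ _ (h₁.1 p' hp') he
      subst hl₁
      refine ⟨[], p :: l₂, rfl, by simp [Lift], ⟨fun p' hp' => ?_, List.pairwise_cons.2
        ⟨fun p' hp' => hd _ _ _ hp (hs.1 p' (by simpa using hp')), h₂.2⟩⟩⟩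
      rcases List.mem_cons.1 hp' with rfl | hp'
      · exact hp
      · exact h₂.1 p' hp'

theorem occ_disjoint {c d : Core n} {o q : ℕ} {a b : Fin n} (h : c.Occ o q a) :
    ¬d.Occ (o + c.len) q b := fun h' => by
  have := h.range; have := h'.range; omega

/-- Conversely, a list of occurrences is realized by a word as soon as every two of its members are
in an admissible order: no condition involves more than two occurrences. -/
theorem Lift.mem_sub {c : Core n} {o : ℕ} {ls : List (ℕ × Fin n)} (h : c.Lift o ls) :
    ls.map Prod.snd ∈ c.sub := by
  induction c generalizing o ls with
  | leaf =>
    obtain rfl : ls = [] := List.eq_nil_iff_forall_not_mem.2 fun p hp => h.1 p hp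
    rfl
  | sym a =>
    rcases ls with _ | ⟨p, _ | ⟨p', ls⟩⟩
    · exact .inl rfl
    · exact .inr (by simp only [List.map_cons, List.map_nil, (h.1 p (by simp)).2]; rfl)
    · exact ((List.pairwise_cons.1 h.2).1 p' (by simp)).elim
  | cat c d ihc ihd =>
    obtain ⟨l₁, l₂, rfl, h₁, h₂⟩ := Lift.split (fun q a b ha => occ_disjoint ha) h.1 h.2
    rw [List.map_append]
    exact Language.mem_mul.2 ⟨_, ihc h₁, _, ihd h₂, rfl⟩
  | alt c d ihc ihd =>
    obtain ⟨l₁, l₂, rfl, h₁, h₂⟩ := Lift.split (o := o + 1) (o' := o + 1 + c.len)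
      (fun q a b ha => occ_disjoint ha) h.1
      (h.2.imp fun h => h.elim .inl fun h => .inr (.inl h))
    -- Occurrences on the two sides of an alternative never follow each other.
    by_cases h₀ : l₁ = []
    · subst h₀; exact .inr (ihd h₂)
    · by_cases h₀' : l₂ = []
      · subst h₀'; rw [List.append_nil]; exact .inl (ihc h₁)
      · obtain ⟨p, hp⟩ := List.exists_mem_of_ne_nil _ h₀
        obtain ⟨p', hp'⟩ := List.exists_mem_of_ne_nil _ h₀'
        have ho := h₁.1 p hp
        have ho' := h₂.1 p' hp'
        rcases (List.pairwise_append.1 h.2).2.2 p hp p' hp' with hs | hs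
        · obtain ⟨_, ⟨e, he⟩⟩ := hs.occ; exact absurd ho' (occ_disjoint he)
        · obtain ⟨⟨e, he⟩, _⟩ := hs.occ; exact absurd he (occ_disjoint ho)
  | opt c ih => exact ih h
  | star c ih =>
    refine Language.mem_kstar.2 ⟨ls.map fun p => [p.2], ?_, fun y hy => ?_⟩
    · induction ls with
      | nil => rfl
      | cons p ls ih' =>
        have := ih' ⟨fun p hp => h.1 p (by simp [hp]), (List.pairwise_cons.1 h.2).2⟩
        simp [this]
    · obtain ⟨p, hp, rfl⟩ := List.mem_map.1 hy
      exact ih (o := o + 1) (ls := [p]) ⟨fun p' hp' => by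
          rw [List.mem_singleton.1 hp']; exact h.1 p hp,
        by simp⟩

theorem nil_mem_sub (c : Core n) : [] ∈ c.sub :=
  Lift.mem_sub (o := 0) (ls := []) (by simp [Lift])

theorem Occ.mem_syms {c : Core n} {o q : ℕ} {a : Fin n} (h : c.Occ o q a) : a ∈ c.syms := by
  induction c generalizing o with
  | leaf => exact h.elim
  | sym b => simp [syms, h.2]
  | cat c d ihc ihd | alt c d ihc ihd =>
    exact List.mem_append.2 (h.elim (fun h => .inl (ihc h)) fun h => .inr (ihd h))
  | opt c ih | star c ih => exact ih (o := o + 1) h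

theorem two_le_count {c : Core n} {o q q' : ℕ} {a : Fin n} (h : c.Occ o q a) (h' : c.Occ o q' a)
    (hne : q ≠ q') : 2 ≤ c.syms.count a := by
  induction c generalizing o with
  | leaf => exact h.elim
  | sym b => exact absurd (h.1.trans h'.1.symm) hne
  | cat c d ihc ihd | alt c d ihc ihd =>
    simp only [syms, List.count_append]
    rcases h with h | h <;> rcases h' with h' | h'
    · have := ihc h h'; omega
    · have := List.count_pos_iff.2 h.mem_syms; have := List.count_pos_iff.2 h'.mem_syms; omega
    · have := List.count_pos_iff.2 h.mem_syms; have := List.count_pos_iff.2 h'.mem_syms; omega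
    · have := ihd h h'; omega
  | opt c ih | star c ih => exact ih (o := o + 1) h h'

theorem Occ.mem_outer {c : Core n} {o q : ℕ} {a : Fin n} (h : c.Occ o q a) (h' : ¬c.Seq o q q) :
    a ∈ c.outer := by
  induction c generalizing o with
  | leaf => exact h.elim
  | sym b => simp [outer, h.2]
  | cat c d ihc ihd =>
    simp only [Seq, not_or] at h'
    exact List.mem_append.2 (h.elim (fun h => .inl (ihc h h'.1)) fun h => .inr (ihd h h'.2.1))
  | alt c d ihc ihd =>
    simp only [Seq, not_or] at h'
    exact List.mem_append.2 (h.elim (fun h => .inl (ihc h h'.1)) fun h => .inr (ihd h h'.2))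
  | opt c ih => exact ih (o := o + 1) h h'
  | star c ih => exact absurd ⟨⟨a, h⟩, ⟨a, h⟩⟩ h'

/-- Only an alternative outside all stars can keep two occurrences from being used together. -/
theorem NoAlt.seq_total {c : Core n} (hc : c.NoAlt) {o q q' : ℕ} {a b : Fin n} (h : c.Occ o q a)
    (h' : c.Occ o q' b) (hne : q ≠ q') : c.Seq o q q' ∨ c.Seq o q' q := by
  induction c generalizing o with
  | leaf => exact h.elim
  | sym b => exact absurd (h.1.trans h'.1.symm) hne
  | cat c d ihc ihd =>
    rcases h with h | h <;> rcases h' with h' | h'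
    · exact (ihc hc.1 h h').imp .inl .inl
    · exact .inl (.inr (.inr ⟨⟨_, h⟩, ⟨_, h'⟩⟩))
    · exact .inr (.inr (.inr ⟨⟨_, h'⟩, ⟨_, h⟩⟩))
    · exact (ihd hc.2 h h').imp (fun h => .inr (.inl h)) fun h => .inr (.inl h)
  | alt c d ihc ihd => exact hc.elim
  | opt c ih => exact ih (o := o + 1) hc h h'
  | star c ih => exact .inl ⟨⟨a, h⟩, ⟨b, h'⟩⟩

theorem Occ.root_range {c : Core n} {o q : ℕ} {a : Fin n} (h : c.Occ o q a) :
    o ≤ c.root o q ∧ c.root o q < o + c.len := by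
  induction c generalizing o with
  | leaf => exact h.elim
  | sym b => simp only [root, len]; omega
  | cat c d ihc ihd | alt c d ihc ihd =>
    simp only [root, len]
    rcases h with h | h
    · rw [if_pos (by have := h.range; omega)]
      have := ihc h; omega
    · rw [if_neg (by have := h.range; omega)]
      have := ihd h; omega
  | opt c ih => simp only [root, len]; have := ih (o := o + 1) h; omega
  | star c ih => simp only [root, len]; omega

theorem Seq.root_le {c : Core n} {o q q' : ℕ} (h : c.Seq o q q') : c.root o q ≤ c.root o q' := by
  induction c generalizing o with
  | leaf => exact h.elim
  | sym b => exact h.elim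
  | cat c d ihc ihd =>
    simp only [root]
    rcases h with h | h | ⟨⟨a, ha⟩, ⟨b, hb⟩⟩
    · obtain ⟨⟨a, ha⟩, ⟨b, hb⟩⟩ := h.occ
      rw [if_pos (by have := ha.range; omega), if_pos (by have := hb.range; omega)]
      exact ihc h
    · obtain ⟨⟨a, ha⟩, ⟨b, hb⟩⟩ := h.occ
      rw [if_neg (by have := ha.range; omega), if_neg (by have := hb.range; omega)]
      exact ihd h
    · rw [if_pos (by have := ha.range; omega), if_neg (by have := hb.range; omega)]
      have := ha.root_range; have := hb.root_range; omega
  | alt c d ihc ihd =>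
    simp only [root]
    rcases h with h | h
    · obtain ⟨⟨a, ha⟩, ⟨b, hb⟩⟩ := h.occ
      rw [if_pos (by have := ha.range; omega), if_pos (by have := hb.range; omega)]
      exact ihc h
    · obtain ⟨⟨a, ha⟩, ⟨b, hb⟩⟩ := h.occ
      rw [if_neg (by have := ha.range; omega), if_neg (by have := hb.range; omega)]
      exact ihd h
  | opt c ih => exact ih (o := o + 1) h
  | star c ih => exact le_rfl

/-- Inside one outermost star, occurrences can be used in any order. -/
theorem eq_or_seq_of_root_eq {c : Core n} {o q q' : ℕ} {a b : Fin n} (h : c.Occ o q a)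
    (h' : c.Occ o q' b) (he : c.root o q = c.root o q') : q = q' ∨ c.Seq o q q' := by
  induction c generalizing o with
  | leaf => exact h.elim
  | sym b => exact .inl (h.1.trans h'.1.symm)
  | cat c d ihc ihd =>
    simp only [root] at he
    rcases h with h | h <;> rcases h' with h' | h'
    · rw [if_pos (by have := h.range; omega), if_pos (by have := h'.range; omega)] at he
      exact (ihc h h' he).imp_right .inl
    · exact .inr (.inr (.inr ⟨⟨_, h⟩, ⟨_, h'⟩⟩))
    · rw [if_neg (by have := h.range; omega), if_pos (by have := h'.range; omega)] at he
      have := h.root_range; have := h'.root_range; omega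
    · rw [if_neg (by have := h.range; omega), if_neg (by have := h'.range; omega)] at he
      exact (ihd h h' he).imp_right fun h => .inr (.inl h)
  | alt c d ihc ihd =>
    simp only [root] at he
    rcases h with h | h <;> rcases h' with h' | h'
    · rw [if_pos (by have := h.range; omega), if_pos (by have := h'.range; omega)] at he
      exact (ihc h h' he).imp_right .inl
    · rw [if_pos (by have := h.range; omega), if_neg (by have := h'.range; omega)] at he
      have := h.root_range; have := h'.root_range; omega
    · rw [if_neg (by have := h.range; omega), if_pos (by have := h'.range; omega)] at he
      have := h.root_range; have := h'.root_range; omega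
    · rw [if_neg (by have := h.range; omega), if_neg (by have := h'.range; omega)] at he
      exact (ihd h h' he).imp_right .inr
  | opt c ih => exact ih (o := o + 1) h h' he
  | star c ih => exact .inr ⟨⟨a, h⟩, ⟨b, h'⟩⟩

theorem seq_self_of_root_eq {c : Core n} {o q q' : ℕ} {a b : Fin n} (h : c.Occ o q a)
    (h' : c.Occ o q' b) (he : c.root o q = c.root o q') : q = q' ∨ c.Seq o q q := by
  induction c generalizing o with
  | leaf => exact h.elim
  | sym b => exact .inl (h.1.trans h'.1.symm)
  | cat c d ihc ihd =>
    simp only [root] at he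
    rcases h with h | h <;> rcases h' with h' | h'
    · rw [if_pos (by have := h.range; omega), if_pos (by have := h'.range; omega)] at he
      exact (ihc h h' he).imp_right .inl
    · rw [if_pos (by have := h.range; omega), if_neg (by have := h'.range; omega)] at he
      have := h.root_range; have := h'.root_range; omega
    · rw [if_neg (by have := h.range; omega), if_pos (by have := h'.range; omega)] at he
      have := h.root_range; have := h'.root_range; omega
    · rw [if_neg (by have := h.range; omega), if_neg (by have := h'.range; omega)] at he
      exact (ihd h h' he).imp_right fun h => .inr (.inl h)
  | alt c d ihc ihd =>
    simp only [root] at he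
    rcases h with h | h <;> rcases h' with h' | h'
    · rw [if_pos (by have := h.range; omega), if_pos (by have := h'.range; omega)] at he
      exact (ihc h h' he).imp_right .inl
    · rw [if_pos (by have := h.range; omega), if_neg (by have := h'.range; omega)] at he
      have := h.root_range; have := h'.root_range; omega
    · rw [if_neg (by have := h.range; omega), if_pos (by have := h'.range; omega)] at he
      have := h.root_range; have := h'.root_range; omega
    · rw [if_neg (by have := h.range; omega), if_neg (by have := h'.range; omega)] at he
      exact (ihd h h' he).imp_right .inr
  | opt c ih => exact ih (o := o + 1) h h' he
  | star c ih => exact .inr ⟨⟨a, h⟩, ⟨a, h⟩⟩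

end Core

/-! ### Content models and their cores -/

namespace Regex

variable {n : ℕ}

mutual
theorem len_core : ∀ e : Regex (Fin n), e.core.len = e.encode.length
  | .eps => rfl
  | .sym a => by simp [core, Core.len, encode, length_encodeNat]
  | .cat e f => by simp [core, Core.len, encode, len_core e, len_core f]; omega
  | .alt e f => by simp [core, Core.len, encode, len_core e, len_core f]; omega
  | .star e => by simp [core, Core.len, encode, len_core e]; omega
  | .opt e => by simp [core, Core.len, encode, len_core e]; omega
  | .plus e => by simp [core, Core.len, encode, len_core e]; omega
  | .sharp es fs => by simp [core, Core.len, encode, len_coreList es, len_coreList fs]; omega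
theorem len_coreList : ∀ es : List (Regex (Fin n)), (coreList es).len = (encodeList es).length
  | [] => rfl
  | e :: es => by simp [coreList, Core.len, encodeList, len_core e, len_coreList es]; omega
end

mutual
theorem syms_core : ∀ e : Regex (Fin n), e.core.syms = e.syms
  | .eps => rfl
  | .sym a => rfl
  | .cat e f => by simp [core, Core.syms, syms, syms_core e, syms_core f]
  | .alt e f => by simp [core, Core.syms, syms, syms_core e, syms_core f]
  | .star e => by simp [core, Core.syms, syms, syms_core e]
  | .opt e => by simp [core, Core.syms, syms, syms_core e]
  | .plus e => by simp [core, Core.syms, syms, syms_core e]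
  | .sharp es fs => by simp [core, Core.syms, syms, syms_coreList es, syms_coreList fs]
theorem syms_coreList : ∀ es : List (Regex (Fin n)), (coreList es).syms = symsList es
  | [] => rfl
  | e :: es => by simp [coreList, Core.syms, symsList, syms_core e, syms_coreList es]
end

mutual
theorem outer_core : ∀ e : Regex (Fin n), e.core.outer = e.outerSyms
  | .eps => rfl
  | .sym a => rfl
  | .cat e f => by simp [core, Core.outer, outerSyms, outer_core e, outer_core f]
  | .alt e f => by simp [core, Core.outer, outerSyms, outer_core e, outer_core f]
  | .star e => by simp [core, Core.outer, outerSyms]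
  | .opt e => by simp [core, Core.outer, outerSyms, outer_core e]
  | .plus e => by simp [core, Core.outer, outerSyms]
  | .sharp es fs => by simp [core, Core.outer, outerSyms, outer_coreList es, outer_coreList fs]
theorem outer_coreList : ∀ es : List (Regex (Fin n)), (coreList es).outer = outerSymsList es
  | [] => rfl
  | e :: es => by simp [coreList, Core.outer, outerSymsList, outer_core e, outer_coreList es]
end

mutual
theorem noAlt_core : ∀ e : Regex (Fin n), e.IsDC → e.core.NoAlt
  | .eps, _ => trivial
  | .sym _, _ => trivial
  | .cat e f, h => by
    simp only [IsDC] at h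
    exact ⟨noAlt_core e h.1, noAlt_core f h.2⟩
  | .alt _ _, h => by simp [IsDC] at h
  | .star _, _ => trivial
  | .opt e, h => by
    simp only [IsDC] at h
    exact noAlt_core e h
  | .plus _, _ => trivial
  | .sharp es fs, h => by
    simp only [IsDC] at h
    exact ⟨noAlt_coreList es h.1, noAlt_coreList fs h.2⟩
theorem noAlt_coreList : ∀ es : List (Regex (Fin n)), IsDCList es → (coreList es).NoAlt
  | [], _ => trivial
  | e :: es, h => by
    simp only [IsDCList] at h
    exact ⟨noAlt_core e h.1, noAlt_coreList es h.2⟩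
end

mutual
theorem mem_sub_core : ∀ (e : Regex (Fin n)) {u : List (Fin n)}, u ∈ e.lang → u ∈ e.core.sub
  | .eps, u, h => by simpa [lang, core, Core.sub] using h
  | .sym a, u, h => .inr h
  | .cat e f, u, h => by
    simp only [lang] at h
    obtain ⟨u₁, h₁, u₂, h₂, rfl⟩ := Language.mem_mul.1 h
    exact Language.mem_mul.2 ⟨_, mem_sub_core e h₁, _, mem_sub_core f h₂, rfl⟩
  | .alt e f, u, h => by
    simp only [lang] at h
    exact h.imp (mem_sub_core e) (mem_sub_core f)
  | .star e, u, h => by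
    simp only [lang] at h
    obtain ⟨L, rfl, hL⟩ := Language.mem_kstar.1 h
    exact Language.mem_kstar.2 ⟨L, rfl, fun y hy => mem_sub_core e (hL y hy)⟩
  | .opt e, u, h => by
    simp only [lang] at h
    rcases h with h | h
    · exact mem_sub_core e h
    · obtain rfl : u = [] := h
      exact Core.nil_mem_sub e.core
  | .plus e, u, h => by
    simp only [lang] at h
    obtain ⟨u₁, h₁, u₂, h₂, rfl⟩ := Language.mem_mul.1 h
    obtain ⟨L, rfl, hL⟩ := Language.mem_kstar.1 h₂
    refine Language.mem_kstar.2 ⟨u₁ :: L, rfl, fun y hy => ?_⟩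
    rcases List.mem_cons.1 hy with rfl | hy
    · exact mem_sub_core e h₁
    · exact mem_sub_core e (hL y hy)
  | .sharp es fs, u, h => by
    simp only [lang] at h
    rcases h with h | h
    · obtain ⟨u₁, h₁, u₂, h₂, rfl⟩ := Language.mem_mul.1 h
      exact Language.mem_mul.2 ⟨_, mem_sub_coreCat es h₁, _, mem_sub_coreOptCat fs h₂, rfl⟩
    · obtain ⟨u₁, h₁, u₂, h₂, rfl⟩ := Language.mem_mul.1 h
      exact Language.mem_mul.2 ⟨_, mem_sub_coreOptCat es h₁, _, mem_sub_coreCat fs h₂, rfl⟩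
theorem mem_sub_coreCat : ∀ (es : List (Regex (Fin n))) {u : List (Fin n)},
    u ∈ langCat es → u ∈ (coreList es).sub
  | [], u, h => by simpa [langCat, coreList, Core.sub] using h
  | e :: es, u, h => by
    simp only [langCat] at h
    obtain ⟨u₁, h₁, u₂, h₂, rfl⟩ := Language.mem_mul.1 h
    exact Language.mem_mul.2 ⟨_, mem_sub_core e h₁, _, mem_sub_coreCat es h₂, rfl⟩
theorem mem_sub_coreOptCat : ∀ (es : List (Regex (Fin n))) {u : List (Fin n)},
    u ∈ langOptCat es → u ∈ (coreList es).sub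
  | [], u, h => by simpa [langOptCat, coreList, Core.sub] using h
  | e :: es, u, h => by
    simp only [langOptCat] at h
    obtain ⟨u₁, h₁, u₂, h₂, rfl⟩ := Language.mem_mul.1 h
    refine Language.mem_mul.2 ⟨_, ?_, _, mem_sub_coreOptCat es h₂, rfl⟩
    rcases h₁ with h₁ | h₁
    · exact mem_sub_core e h₁
    · obtain rfl : u₁ = [] := h₁
      exact Core.nil_mem_sub e.core
end

mutual
theorem exists_lang_of_sub : ∀ (e : Regex (Fin n)) {s : List (Fin n)}, s ∈ e.core.sub →
    ∃ u ∈ e.lang, s.Sublist u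
  | .eps, s, h => ⟨s, by simpa [lang, core, Core.sub] using h, .refl s⟩
  | .sym a, s, h => by
    refine ⟨[a], by simp only [lang]; rfl, ?_⟩
    rcases h with rfl | h
    · simp
    · rw [Set.mem_singleton_iff.1 h]
  | .cat e f, s, h => by
    obtain ⟨s₁, h₁, s₂, h₂, rfl⟩ := Language.mem_mul.1 h
    obtain ⟨u₁, hu₁, hs₁⟩ := exists_lang_of_sub e h₁
    obtain ⟨u₂, hu₂, hs₂⟩ := exists_lang_of_sub f h₂
    exact ⟨u₁ ++ u₂, by simp only [lang]; exact Language.mem_mul.2 ⟨_, hu₁, _, hu₂, rfl⟩,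
      hs₁.append hs₂⟩
  | .alt e f, s, h => by
    simp only [lang]
    rcases h with h | h
    · obtain ⟨u, hu, hs⟩ := exists_lang_of_sub e h
      exact ⟨u, .inl hu, hs⟩
    · obtain ⟨u, hu, hs⟩ := exists_lang_of_sub f h
      exact ⟨u, .inr hu, hs⟩
  | .star e, s, h => by
    obtain ⟨L, rfl, hL⟩ := Language.mem_kstar.1 h
    simp only [lang]
    have h' : ∀ y ∈ e.core.sub, ∃ u ∈ e.lang, y.Sublist u := fun y hy => exists_lang_of_sub e hy
    obtain ⟨M, hM, hs⟩ := exists_flatten_of_sub h' L hL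
    exact ⟨M.flatten, Language.mem_kstar.2 ⟨M, rfl, hM⟩, hs⟩
  | .opt e, s, h => by
    obtain ⟨u, hu, hs⟩ := exists_lang_of_sub e h
    exact ⟨u, by simp only [lang]; exact .inl hu, hs⟩
  | .plus e, s, h => by
    obtain ⟨L, rfl, hL⟩ := Language.mem_kstar.1 h
    simp only [lang]
    have h' : ∀ y ∈ e.core.sub, ∃ u ∈ e.lang, y.Sublist u := fun y hy => exists_lang_of_sub e hy
    obtain ⟨M, hM, hs⟩ := exists_flatten_of_sub h' L hL
    obtain ⟨u, hu, -⟩ := h' [] (Core.nil_mem_sub _)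
    exact ⟨u ++ M.flatten, Language.mem_mul.2 ⟨u, hu, _, Language.mem_kstar.2 ⟨M, rfl, hM⟩, rfl⟩,
      hs.trans (List.sublist_append_right _ _)⟩
  | .sharp es fs, s, h => by
    obtain ⟨s₁, h₁, s₂, h₂, rfl⟩ := Language.mem_mul.1 h
    obtain ⟨u₁, hu₁, -, hs₁⟩ := exists_langCat_of_sub es h₁
    obtain ⟨u₂, -, hu₂, hs₂⟩ := exists_langCat_of_sub fs h₂
    exact ⟨u₁ ++ u₂, by simp only [lang]; exact .inl (Language.mem_mul.2 ⟨_, hu₁, _, hu₂, rfl⟩),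
      hs₁.append hs₂⟩
theorem exists_langCat_of_sub : ∀ (es : List (Regex (Fin n))) {s : List (Fin n)},
    s ∈ (coreList es).sub → ∃ u, u ∈ langCat es ∧ u ∈ langOptCat es ∧ s.Sublist u
  | [], s, h => ⟨s, by simpa [langCat, coreList, Core.sub] using h,
      by simpa [langOptCat, coreList, Core.sub] using h, .refl s⟩
  | e :: es, s, h => by
    obtain ⟨s₁, h₁, s₂, h₂, rfl⟩ := Language.mem_mul.1 h
    obtain ⟨u₁, hu₁, hs₁⟩ := exists_lang_of_sub e h₁
    obtain ⟨u₂, hu₂, hu₂', hs₂⟩ := exists_langCat_of_sub es h₂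
    exact ⟨u₁ ++ u₂, by simp only [langCat]; exact Language.mem_mul.2 ⟨_, hu₁, _, hu₂, rfl⟩,
      by simp only [langOptCat]; exact Language.mem_mul.2 ⟨_, .inl hu₁, _, hu₂', rfl⟩,
      hs₁.append hs₂⟩
theorem exists_flatten_of_sub {A B : Language (Fin n)} (h : ∀ y ∈ A, ∃ u ∈ B, y.Sublist u) :
    ∀ L : List (List (Fin n)), (∀ y ∈ L, y ∈ A) →
      ∃ M : List (List (Fin n)), (∀ y ∈ M, y ∈ B) ∧ L.flatten.Sublist M.flatten
  | [], _ => ⟨[], by simp, by simp⟩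
  | y :: L, hL => by
    obtain ⟨M, hM, hs⟩ := exists_flatten_of_sub h L fun y hy => hL y (by simp [hy])
    obtain ⟨u, hu, hs'⟩ := h y (hL y (by simp))
    refine ⟨u :: M, fun z hz => ?_, by simpa using hs'.append hs⟩
    rcases List.mem_cons.1 hz with rfl | hz
    · exact hu
    · exact hM z hz
end

/-- A symbol that occurs outside the scope of any star in an MRW expression occurs only once. -/
theorem IsMRW.occ_unique {e : Regex (Fin n)} (he : e.IsMRW) {o q q' : ℕ} {a : Fin n}
    (h : e.core.Occ o q a) (hq : ¬e.core.Seq o q q) (h' : e.core.Occ o q' a) : q = q' := by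
  by_contra hne
  have h₁ := Core.two_le_count h h' hne
  have h₂ := h.mem_outer hq
  rw [outer_core] at h₂
  rw [syms_core, he.2 a h₂] at h₁
  omega

theorem seq_total_of_factors (cnt : Fin n → ℕ) : ∀ (e : Regex (Fin n)),
    (∀ f ∈ e.factors, f.IsDC ∨ ∀ a ∈ f.syms, cnt a = 1) → ∀ {o q q' : ℕ} {a b : Fin n},
    e.core.Occ o q a → e.core.Occ o q' b → cnt a ≠ 1 → q ≠ q' →
    e.core.Seq o q q' ∨ e.core.Seq o q' q := by
  intro e he o q q' a b h h' ha hne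
  have hbase : e.factors = [e] → e.core.Seq o q q' ∨ e.core.Seq o q' q := fun hf => by
    rw [hf] at he
    rcases he e (by simp) with hd | hs
    · exact (noAlt_core e hd).seq_total h h' hne
    · exact absurd (hs a (by rw [← syms_core]; exact h.mem_syms)) ha
  match e, he, h, h', hbase with
  | .cat e f, he, h, h', _ =>
    simp only [factors, List.mem_append] at he
    rcases h with h | h <;> rcases h' with h' | h'
    · exact (seq_total_of_factors cnt e (fun f hf => he f (.inl hf)) h h' ha hne).imp .inl .inl
    · exact .inl (.inr (.inr ⟨⟨_, h⟩, ⟨_, h'⟩⟩))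
    · exact .inr (.inr (.inr ⟨⟨_, h'⟩, ⟨_, h⟩⟩))
    · exact (seq_total_of_factors cnt f (fun f hf => he f (.inr hf)) h h' ha hne).imp
        (fun h => .inr (.inl h)) fun h => .inr (.inl h)
  | .eps, _, _, _, hb | .sym _, _, _, _, hb | .alt _ _, _, _, _, hb | .star _, _, _, _, hb
  | .opt _, _, _, _, hb | .plus _, _, _, _, hb | .sharp _ _, _, _, _, hb =>
    exact hb (by simp only [factors])

/-- In an RW expression, whether two occurrences can be used together depends only on their
symbols. -/
theorem IsRW.seq_total {e : Regex (Fin n)} (he : e.IsRW) {o p p' q q' : ℕ} {a b : Fin n}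
    (hab : a ≠ b) (hp : e.core.Occ o p a) (hp' : e.core.Occ o p' b)
    (hs : e.core.Seq o p p' ∨ e.core.Seq o p' p) (hq : e.core.Occ o q a)
    (hq' : e.core.Occ o q' b) : e.core.Seq o q q' ∨ e.core.Seq o q' q := by
  have hne : q ≠ q' := fun h => hab (hq.unique (h ▸ hq'))
  by_cases h₁ : p = q
  · by_cases h₂ : p' = q'
    · rw [← h₁, ← h₂]; exact hs
    · have := Core.two_le_count hp' hq' h₂
      rw [syms_core] at this
      exact (seq_total_of_factors _ e he hq' hq (by omega) hne.symm).symm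
  · have := Core.two_le_count hp hq h₁
    rw [syms_core] at this
    exact seq_total_of_factors _ e he hq hq' (by omega) hne

end Regex

end XPathSat

namespace XPathSat

/-! ### Walks of an XPath expression and their node histories -/

/-- A DTD with content models placed at positions of a string, and a sequence of steps indexed by
the positive times; `none` is a step that stays at the current node. -/
structure Problem (n : ℕ) where
  dtd : DTD n
  off : Fin n → ℕ
  step : ℕ → Option (Axis × Fin n)

namespace Problem

variable {n : ℕ} (P : Problem n)

/-- The path from the current node at time `t` up to the root. A node is called by the time at which
it was entered by a child or sibling step. -/
def stack : ℕ → List ℕ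
  | 0 => [0]
  | t + 1 =>
    match P.step (t + 1) with
    | none => stack t
    | some (.child, _) => (t + 1) :: stack t
    | some (.parent, _) => (stack t).tail
    | some (.following, _) => (t + 1) :: (stack t).tail
    | some (.preceding, _) => (t + 1) :: (stack t).tail

/-- The label that the node entered at a given time has to have. -/
def lab (t : ℕ) : Fin n :=
  match t, P.step t with
  | 0, _ => P.dtd.root
  | _ + 1, none => P.dtd.root
  | _ + 1, some (_, l) => l

/-- A node other than the root is entered at time `t`. -/
def Entry (t : ℕ) : Prop :=
  t ≠ 0 ∧ ∃ χ l, P.step t = some (χ, l) ∧ χ ≠ .parent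

/-- `q` is the position of an occurrence of `b` in the content model of `a`. -/
def Occ (a : Fin n) (q : ℕ) (b : Fin n) : Prop :=
  (P.dtd.content a).core.Occ (P.off a) q b

/-- In the content model of `a`, the occurrence `q` can be used before `q'`. -/
def Seq (a : Fin n) (q q' : ℕ) : Prop :=
  (P.dtd.content a).core.Seq (P.off a) q q'

/-- `q` is an occurrence of the label of `c` in the content model of the parent of `c`. -/
def Cand (c q : ℕ) : Prop :=
  ∃ d, (P.stack c)[1]? = some d ∧ P.Occ (P.lab d) q (P.lab c)

/-- `q` can be used before `q'` in the content model of the parent of `c`. -/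
def Link (c q q' : ℕ) : Prop :=
  ∃ d, (P.stack c)[1]? = some d ∧ P.Seq (P.lab d) q q'

/-- The label of `c` cannot be repeated among the siblings of `c`: it has an occurrence outside all
stars, which is its only one in an MRW expression. -/
def Outer (c : ℕ) : Prop :=
  ∃ q, P.Cand c q ∧ ¬P.Link c q q

/-- `q` is a possible occurrence for the node `c` in the content model of its parent, as far as the
siblings visited on the way to `c` are concerned. -/
inductive Pos : ℕ → ℕ → Prop
  | child {t q l} : P.step (t + 1) = some (.child, l) → P.Cand (t + 1) q → Pos (t + 1) q
  | following {t q l d p} : P.step (t + 1) = some (.following, l) → P.Cand (t + 1) q →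
      (P.stack t)[0]? = some d → Pos d p → P.Link (t + 1) p q → Pos (t + 1) q
  | preceding {t q l d p} : P.step (t + 1) = some (.preceding, l) → P.Cand (t + 1) q →
      (P.stack t)[0]? = some d → Pos d p → P.Link (t + 1) q p → Pos (t + 1) q

/-- `c` and `d` are forced to be the same node, because their labels cannot be repeated. -/
inductive Same : ℕ → ℕ → Prop
  | root : Same 0 0
  | step {c d c' d'} : P.Entry c → P.Entry d → (P.stack c)[1]? = some c' →
      (P.stack d)[1]? = some d' → Same c' d' → P.lab c = P.lab d → (c = d ∨ P.Outer c) → Same c d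

/-- The criterion for satisfiability. -/
structure Good : Prop where
  /-- Parent steps stay inside the tree and find the requested label. -/
  up : ∀ t l, P.step (t + 1) = some (.parent, l) → ∃ d, (P.stack t)[1]? = some d ∧ P.lab d = l
  /-- Every chain of sibling steps can be placed in the content model of the parent. -/
  pos : ∀ c, P.Entry c → ∃ q, P.Pos c q
  /-- Any two labels required at children of the same node occur together in some word. -/
  compat : ∀ c d c' d', P.Entry c → P.Entry d → (P.stack c)[1]? = some c' →
    (P.stack d)[1]? = some d' → P.Same c' d' → P.lab c = P.lab d ∨
      ∃ p q, P.Cand c p ∧ P.Cand d q ∧ (P.Link c p q ∨ P.Link c q p)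

/-- One step of a walk in a tree. -/
def Step (T : Tree (Fin n)) : Option (Axis × Fin n) → List ℕ → List ℕ → Prop
  | none, w, w' => w' = w
  | some (χ, l), w, w' => (XPath.atom χ l).Holds T w w'

/-- The whole sequence of steps can be carried out in `T`. -/
def Walks (T : Tree (Fin n)) (W : ℕ → List ℕ) : Prop :=
  W 0 = [] ∧ ∀ t, Step T (P.step (t + 1)) (W t) (W (t + 1))

variable {P}

theorem lab_succ {t : ℕ} {χ : Axis} {l : Fin n} (h : P.step (t + 1) = some (χ, l)) :
    P.lab (t + 1) = l := by
  simp [lab, h]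

theorem stack_none {t : ℕ} (h : P.step (t + 1) = none) : P.stack (t + 1) = P.stack t := by
  simp [stack, h]

theorem stack_child {t : ℕ} {l : Fin n} (h : P.step (t + 1) = some (.child, l)) :
    P.stack (t + 1) = (t + 1) :: P.stack t := by
  simp [stack, h]

theorem stack_parent {t : ℕ} {l : Fin n} (h : P.step (t + 1) = some (.parent, l)) :
    P.stack (t + 1) = (P.stack t).tail := by
  simp [stack, h]

theorem stack_sibling {t : ℕ} {χ : Axis} {l : Fin n} (h : P.step (t + 1) = some (χ, l))
    (hχ : χ = .following ∨ χ = .preceding) : P.stack (t + 1) = (t + 1) :: (P.stack t).tail := by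
  rcases hχ with rfl | rfl <;> simp [stack, h]

/-- The four ways in which the stack evolves. -/
theorem stack_cases (P : Problem n) (t : ℕ) :
    P.stack (t + 1) = P.stack t ∨ P.stack (t + 1) = (P.stack t).tail ∨
      P.Entry (t + 1) ∧ (P.stack (t + 1) = (t + 1) :: P.stack t ∨
        P.stack (t + 1) = (t + 1) :: (P.stack t).tail) := by
  rcases h : P.step (t + 1) with _ | ⟨_ | _ | _ | _, l⟩
  · exact .inl (stack_none h)
  · exact .inr (.inr ⟨⟨by omega, _, _, h, by simp⟩, .inl (stack_child h)⟩)
  · exact .inr (.inl (stack_parent h))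
  · exact .inr (.inr ⟨⟨by omega, _, _, h, by simp⟩, .inr (stack_sibling h (.inl rfl))⟩)
  · exact .inr (.inr ⟨⟨by omega, _, _, h, by simp⟩, .inr (stack_sibling h (.inr rfl))⟩)

theorem mem_stack_succ {t c : ℕ} (h : c ∈ P.stack (t + 1)) : c = t + 1 ∨ c ∈ P.stack t := by
  rcases P.stack_cases t with h' | h' | ⟨-, h' | h'⟩ <;> rw [h'] at h
  · exact .inr h
  · exact .inr (List.mem_of_mem_tail h)
  · exact List.mem_cons.1 h
  · exact (List.mem_cons.1 h).imp_right List.mem_of_mem_tail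

theorem le_of_mem_stack {t c : ℕ} (h : c ∈ P.stack t) : c ≤ t := by
  induction t with
  | zero => simp [stack] at h; omega
  | succ t ih =>
    rcases mem_stack_succ h with rfl | h
    · exact le_rfl
    · exact (ih h).trans (by omega)

theorem mem_stack_of_le {t t' c : ℕ} (h : c ∈ P.stack t) (hc : c ≤ t') (ht : t' ≤ t) :
    c ∈ P.stack t' := by
  induction t with
  | zero => obtain rfl : t' = 0 := by omega
            exact h
  | succ t ih =>
    rcases Nat.lt_or_ge t t' with h' | h'
    · obtain rfl : t' = t + 1 := by omega
      exact h
    · rcases mem_stack_succ h with rfl | h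
      · omega
      · exact ih h h'

theorem stack_pairwise (P : Problem n) (t : ℕ) : (P.stack t).Pairwise (· > ·) := by
  induction t with
  | zero => simp [stack]
  | succ t ih =>
    rcases P.stack_cases t with h | h | ⟨-, h | h⟩ <;> rw [h]
    · exact ih
    · exact ih.tail
    · exact List.pairwise_cons.2 ⟨fun c hc => Nat.lt_succ_of_le (le_of_mem_stack hc), ih⟩
    · exact List.pairwise_cons.2 ⟨fun c hc =>
        Nat.lt_succ_of_le (le_of_mem_stack (List.mem_of_mem_tail hc)), ih.tail⟩

theorem entry_of_mem_stack {t c : ℕ} (h : c ∈ P.stack t) : c = 0 ∨ P.Entry c := by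
  induction t with
  | zero => simp [stack] at h; exact .inl h
  | succ t ih =>
    rcases P.stack_cases t with h' | h' | ⟨he, -⟩
    · rw [h'] at h; exact ih h
    · rw [h'] at h; exact ih (List.mem_of_mem_tail h)
    · rcases mem_stack_succ h with rfl | h
      · exact .inr he
      · exact ih h

/-- The ancestors of a node are the same whenever it is visited. -/
theorem stack_eq_of_suffix {t c : ℕ} {l : List ℕ} (h : c :: l <:+ P.stack t) :
    P.stack c = c :: l := by
  induction t with
  | zero =>
    obtain ⟨s, hs⟩ := h
    rcases s with _ | ⟨x, s⟩
    · simp [stack] at hs; obtain ⟨rfl, rfl⟩ := hs; rfl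
    · simp [stack] at hs
  | succ t ih =>
    rcases P.stack_cases t with h' | h' | ⟨-, h' | h'⟩
    · exact ih (h' ▸ h)
    · rw [h'] at h; exact ih (h.trans (List.tail_suffix _))
    · rw [h'] at h
      rcases List.suffix_cons_iff.1 h with e | h
      · rw [List.cons.inj e |>.1, h', List.cons.inj e |>.2]
      · exact ih h
    · rw [h'] at h
      rcases List.suffix_cons_iff.1 h with e | h
      · rw [List.cons.inj e |>.1, h', List.cons.inj e |>.2]
      · exact ih (h.trans (List.tail_suffix _))

theorem stack_of_head {t c : ℕ} (h : (P.stack t)[0]? = some c) : P.stack c = P.stack t := by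
  rcases hs : P.stack t with _ | ⟨d, l⟩
  · simp [hs] at h
  · simp only [hs, List.getElem?_cons_zero, Option.some.injEq] at h
    subst h
    exact stack_eq_of_suffix (t := t) (by rw [hs])

theorem stack_head_of_entry {c : ℕ} (h : P.Entry c) : ∃ l, P.stack c = c :: l := by
  obtain ⟨h0, χ, l, hs, hχ⟩ := h
  obtain ⟨t, rfl⟩ := Nat.exists_eq_succ_of_ne_zero h0
  rcases χ with _ | _ | _ | _
  · exact ⟨_, stack_child hs⟩
  · exact absurd rfl hχ
  · exact ⟨_, stack_sibling hs (.inl rfl)⟩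
  · exact ⟨_, stack_sibling hs (.inr rfl)⟩

theorem lt_of_parent {c d : ℕ} (h : (P.stack c)[1]? = some d) : d < c := by
  rcases hs : P.stack c with _ | ⟨x, _ | ⟨y, l⟩⟩ <;> simp [hs] at h
  subst h
  have h1 := le_of_mem_stack (P := P) (t := c) (c := x) (by simp [hs])
  have h2 := P.stack_pairwise c
  rw [hs] at h2
  have := (List.pairwise_cons.1 h2).1 y (by simp)
  omega

theorem parent_mem {c d : ℕ} (h : (P.stack c)[1]? = some d) : d ∈ P.stack c :=
  List.mem_of_getElem? h

/-- A node is left by a sibling step at most once: afterwards it is never entered again under the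
same name. -/
theorem sibling_unique {c t t' : ℕ} {χ χ' : Axis} {l l' : Fin n}
    (h : P.step (t + 1) = some (χ, l)) (hχ : χ = .following ∨ χ = .preceding)
    (hc : (P.stack t)[0]? = some c) (h' : P.step (t' + 1) = some (χ', l'))
    (hχ' : χ' = .following ∨ χ' = .preceding) (hc' : (P.stack t')[0]? = some c) : t = t' := by
  have key : ∀ {s s' : ℕ} {χ l}, P.step (s + 1) = some (χ, l) →
      (χ = .following ∨ χ = .preceding) → (P.stack s)[0]? = some c → (P.stack s')[0]? = some c →
      s' ≤ s := by
    intro s s' χ l h hχ hc hc'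
    by_contra hlt
    have hm := List.mem_of_getElem? hc'
    have hle := le_of_mem_stack (List.mem_of_getElem? hc)
    have := mem_stack_of_le (t' := s + 1) hm (by omega) (by omega)
    rw [stack_sibling h hχ] at this
    have hp := P.stack_pairwise s
    rcases hs : P.stack s with _ | ⟨x, r⟩ <;> simp [hs] at hc
    subst hc
    rw [hs] at this hp
    rcases List.mem_cons.1 this with rfl | hr
    · omega
    · exact lt_irrefl _ ((List.pairwise_cons.1 hp).1 x hr)
  exact le_antisymm (key h' hχ' hc' hc) (key h hχ hc hc')

theorem Same.lab_eq {c d : ℕ} (h : P.Same c d) : P.lab c = P.lab d := by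
  cases h with
  | root => rfl
  | step _ _ _ _ _ h _ => exact h

theorem cand_iff {c c' q : ℕ} (hc : (P.stack c)[1]? = some c') :
    P.Cand c q ↔ P.Occ (P.lab c') q (P.lab c) := by
  simp [Cand, hc]

theorem link_iff {c c' q q' : ℕ} (hc : (P.stack c)[1]? = some c') :
    P.Link c q q' ↔ P.Seq (P.lab c') q q' := by
  simp [Link, hc]

theorem outer_congr {c d c' d' : ℕ} (hc : (P.stack c)[1]? = some c')
    (hd : (P.stack d)[1]? = some d') (h : P.lab c' = P.lab d') (h' : P.lab c = P.lab d) :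
    P.Outer c ↔ P.Outer d := by
  simp only [Outer, cand_iff hc, cand_iff hd, link_iff hc, link_iff hd, h, h']

theorem Same.symm {c d : ℕ} (h : P.Same c d) : P.Same d c := by
  induction h with
  | root => exact .root
  | step hc hd hc' hd' h hl ho ih =>
    exact .step hd hc hd' hc' ih hl.symm
      (ho.imp Eq.symm fun h' => (outer_congr hc' hd' h.lab_eq hl).1 h')

theorem Same.trans {c d e : ℕ} (h : P.Same c d) (h' : P.Same d e) : P.Same c e := by
  induction h generalizing e with
  | root => exact h'
  | step hc hd hc' hd' h hl ho ih =>
    cases h' with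
    | root => exact absurd rfl hd.1
    | step hd₁ he hd₁' he' h₁ hl₁ ho₁ =>
      obtain rfl := Option.some.inj (hd'.symm.trans hd₁')
      refine .step hc he hc' he' (ih h₁) (hl.trans hl₁) ?_
      rcases ho with rfl | ho
      · exact ho₁
      · exact .inr ho

theorem Pos.cand {c q : ℕ} (h : P.Pos c q) : P.Cand c q := by
  cases h <;> assumption

theorem Good.parent (h : P.Good) {c : ℕ} (hc : P.Entry c) : ∃ d, (P.stack c)[1]? = some d := by
  obtain ⟨q, hq⟩ := h.pos c hc
  obtain ⟨d, hd, -⟩ := hq.cand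
  exact ⟨d, hd⟩

theorem Good.same_refl (h : P.Good) {c : ℕ} (hc : c = 0 ∨ P.Entry c) : P.Same c c := by
  induction c using Nat.strong_induction_on with
  | _ c ih =>
    rcases hc with rfl | hc
    · exact .root
    · obtain ⟨d, hd⟩ := h.parent hc
      exact .step hc hc hd hd (ih d (lt_of_parent hd) (entry_of_mem_stack (parent_mem hd))) rfl
        (.inl rfl)

theorem Good.stack_ne_nil (h : P.Good) (t : ℕ) : P.stack t ≠ [] := by
  induction t with
  | zero => simp [stack]
  | succ t ih =>
    rcases hs : P.step (t + 1) with _ | ⟨_ | _ | _ | _, l⟩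
    · rwa [stack_none hs]
    · simp [stack_child hs]
    · obtain ⟨d, hd, -⟩ := h.up t l hs
      rw [stack_parent hs]
      intro h'
      rcases hs : P.stack t with _ | ⟨x, _ | ⟨y, l⟩⟩ <;> simp [hs] at hd h'
    · simp [stack_sibling hs (.inl rfl)]
    · simp [stack_sibling hs (.inr rfl)]

theorem Good.eq_zero_of_stack (h : P.Good) {t c : ℕ} (hc : [c] <:+ P.stack t) : c = 0 := by
  refine (entry_of_mem_stack (hc.subset (by simp))).resolve_right fun he => ?_
  obtain ⟨d, hd⟩ := h.parent he
  simp [stack_eq_of_suffix hc] at hd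

end Problem

end XPathSat

namespace XPathSat

theorem Tree.subtree_append {α : Type} (T : Tree α) (w w' : List ℕ) :
    T.subtree (w ++ w') = (T.subtree w).bind fun s => s.subtree w' := by
  induction w generalizing T with
  | nil => rfl
  | cons i w ih =>
    simp only [List.cons_append, Tree.subtree]
    rcases T.children[i]? with _ | s
    · rfl
    · exact ih s

theorem Tree.subtree_concat {α : Type} (T : Tree α) (w : List ℕ) (i : ℕ) :
    T.subtree (w ++ [i]) = (T.subtree w).bind fun s => s.children[i]? := by
  rw [Tree.subtree_append]
  congr 1
  funext s
  rcases h : s.children[i]? with _ | s' <;> simp [Tree.subtree, h]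

theorem Tree.HasLabel.unique {α : Type} {T : Tree α} {w : List ℕ} {a b : α}
    (h : T.HasLabel w a) (h' : T.HasLabel w b) : a = b := by
  obtain ⟨s, hs, rfl⟩ := h
  obtain ⟨s', hs', rfl⟩ := h'
  rw [Option.some.inj (hs.symm.trans hs')]

namespace Problem

variable {n : ℕ} {P : Problem n}

/-! ### The criterion is necessary -/

/-- Every node of the stack is a child of the next one, and the last one is the root. -/
theorem Walks.stack {T : Tree (Fin n)} {W : ℕ → List ℕ} (h : P.Walks T W) (t : ℕ) :
    (∃ c l, P.stack t = c :: l ∧ W t = W c) ∧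
      ∀ c l, c :: l <:+ P.stack t → (c = 0 ∧ l = []) ∨ ∃ d l' i, l = d :: l' ∧ W c = W d ++ [i] := by
  induction t with
  | zero =>
    refine ⟨⟨0, [], rfl, rfl⟩, fun c l hl => .inl ?_⟩
    obtain ⟨s, hs⟩ := hl
    rcases s with _ | ⟨x, s⟩
    · simpa [Problem.stack] using hs
    · simp [Problem.stack] at hs
  | succ t ih =>
    obtain ⟨⟨c, l, hc, hW⟩, ih⟩ := ih
    have hst := h.2 t
    have hcl := ih c l (by rw [hc])
    have hsib : ∀ χ a, P.step (t + 1) = some (χ, a) → (χ = .following ∨ χ = .preceding) →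
        (∃ u i j, W t = u ++ [i] ∧ W (t + 1) = u ++ [j]) →
        (∃ c l, P.stack (t + 1) = c :: l ∧ W (t + 1) = W c) ∧
          ∀ c l, c :: l <:+ P.stack (t + 1) →
            (c = 0 ∧ l = []) ∨ ∃ d l' i, l = d :: l' ∧ W c = W d ++ [i] := by
      rintro χ a hs hχ ⟨u, i, j, hu, hj⟩
      rw [stack_sibling hs hχ]
      refine ⟨⟨_, _, rfl, rfl⟩, fun c' l' h' => ?_⟩
      rcases List.suffix_cons_iff.1 h' with e | h'
      · obtain ⟨rfl, rfl⟩ := List.cons.inj e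
        rcases hcl with ⟨rfl, rfl⟩ | ⟨d, l', i', rfl, hd⟩
        · rw [hW, h.1] at hu; simp at hu
        · rw [hW, hd] at hu
          obtain ⟨rfl, -⟩ := List.append_inj' hu rfl
          exact .inr ⟨d, l', j, by rw [hc]; rfl, hj⟩
      · exact ih _ _ (h'.trans (List.tail_suffix _))
    rcases hs : P.step (t + 1) with _ | ⟨_ | _ | _ | _, a⟩ <;> rw [hs] at hst
    · rw [stack_none hs, show W (t + 1) = W t from hst]
      exact ⟨⟨c, l, hc, hW⟩, ih⟩
    · rw [stack_child hs]
      refine ⟨⟨_, _, rfl, rfl⟩, fun c' l' h' => ?_⟩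
      rcases List.suffix_cons_iff.1 h' with e | h'
      · obtain ⟨rfl, rfl⟩ := List.cons.inj e
        obtain ⟨i, hi⟩ := hst.1
        exact .inr ⟨c, l, i, hc, by rw [hi, hW]⟩
      · exact ih _ _ h'
    · rw [stack_parent hs]
      obtain ⟨⟨i, hi⟩, -⟩ := hst
      rcases hcl with ⟨rfl, rfl⟩ | ⟨d, l', i', rfl, hd⟩
      · rw [hW, h.1] at hi; simp at hi
      · rw [hW, hd] at hi
        obtain ⟨hi, -⟩ := List.append_inj' hi rfl
        exact ⟨⟨d, l', by rw [hc]; rfl, hi.symm⟩,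
          fun c' l' h' => ih _ _ (h'.trans (List.tail_suffix _))⟩
    · obtain ⟨⟨u, i, j, hu, hj, -⟩, -⟩ := hst
      exact hsib _ _ hs (.inl rfl) ⟨u, i, j, hu, hj⟩
    · obtain ⟨⟨u, i, j, hu, hj, -⟩, -⟩ := hst
      exact hsib _ _ hs (.inr rfl) ⟨u, i, j, hu, hj⟩

theorem Walks.head {T : Tree (Fin n)} {W : ℕ → List ℕ} (h : P.Walks T W) (t : ℕ) :
    ∃ c, (P.stack t)[0]? = some c ∧ W t = W c := by
  obtain ⟨⟨c, l, hc, hW⟩, -⟩ := h.stack t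
  exact ⟨c, by simp [hc], hW⟩

theorem Walks.parent {T : Tree (Fin n)} {W : ℕ → List ℕ} (h : P.Walks T W) {t d : ℕ}
    (hd : (P.stack t)[1]? = some d) : ∃ i, W t = W d ++ [i] := by
  obtain ⟨⟨c, l, hc, hW⟩, h'⟩ := h.stack t
  rcases h' c l (by rw [hc]) with ⟨rfl, rfl⟩ | ⟨d', l', i, rfl, hi⟩
  · simp [hc] at hd
  · simp only [hc, List.getElem?_cons_succ, List.getElem?_cons_zero, Option.some.injEq] at hd
    subst hd
    exact ⟨i, hW.trans hi⟩

theorem Walks.exists_parent {T : Tree (Fin n)} {W : ℕ → List ℕ} (h : P.Walks T W) {t : ℕ}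
    (hne : W t ≠ []) : ∃ d, (P.stack t)[1]? = some d := by
  obtain ⟨⟨c, l, hc, hW⟩, h'⟩ := h.stack t
  rcases h' c l (by rw [hc]) with ⟨rfl, rfl⟩ | ⟨d', l', i, rfl, hi⟩
  · exact absurd (hW.trans h.1) hne
  · exact ⟨d', by simp [hc]⟩

theorem Walks.hasLabel {T : Tree (Fin n)} {W : ℕ → List ℕ} (h : P.Walks T W)
    (hT : T.label = P.dtd.root) {c : ℕ} (hc : c = 0 ∨ P.Entry c) : T.HasLabel (W c) (P.lab c) := by
  rcases hc with rfl | ⟨h0, χ, l, hs, hχ⟩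
  · rw [h.1]
    exact ⟨T, rfl, by rw [hT]; simp [lab]⟩
  · obtain ⟨t, rfl⟩ := Nat.exists_eq_succ_of_ne_zero h0
    have := h.2 t
    rw [hs] at this
    rw [lab_succ hs]
    rcases χ with _ | _ | _ | _
    · exact this.2
    · exact absurd rfl hχ
    · exact this.2.2
    · exact this.2.2

/-- The words at the nodes of a conforming tree lift to occurrences simultaneously. -/
theorem exists_lifts {T : Tree (Fin n)} (hT : P.dtd.Conforms T) :
    ∃ L : List ℕ → List (ℕ × Fin n), ∀ y s, T.subtree y = some s →
      (P.dtd.content s.label).core.Lift (P.off s.label) (L y) ∧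
        (L y).map Prod.snd = s.children.map Tree.label := by
  have : ∀ y, ∃ ls, ∀ s, T.subtree y = some s →
      (P.dtd.content s.label).core.Lift (P.off s.label) ls ∧
        ls.map Prod.snd = s.children.map Tree.label := fun y => by
    rcases h : T.subtree y with _ | s
    · exact ⟨[], by simp⟩
    · obtain ⟨ls, h₁, h₂⟩ :=
        Core.exists_lift (Regex.mem_sub_core _ (hT.2 y s h)) (P.off s.label)
      refine ⟨ls, fun s' hs' => ?_⟩
      obtain rfl := Option.some.inj hs'
      exact ⟨h₁, h₂⟩
  choose L hL using this
  exact ⟨L, hL⟩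

/-- The criterion is necessary: lift the word at every node of the tree to a list of occurrences,
and let every entered node have the occurrence at its place in that list. -/
theorem good_of_walks (hM : P.dtd.IsMRW) {T : Tree (Fin n)} (hT : P.dtd.Conforms T)
    {W : ℕ → List ℕ} (h : P.Walks T W) : P.Good := by
  obtain ⟨L, hL⟩ := exists_lifts (P := P) hT
  have hlab := fun c hc => h.hasLabel hT.1 (c := c) hc
  -- The occurrence used by a node in the lifted word of its parent.
  have hocc : ∀ {c d i}, P.Entry c → (P.stack c)[1]? = some d → W c = W d ++ [i] →
      ∃ q, (L (W d))[i]? = some (q, P.lab c) ∧ P.Cand c q := by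
    intro c d i hc hd hi
    obtain ⟨s, hs, hsl⟩ := hlab d (entry_of_mem_stack (parent_mem hd))
    obtain ⟨s', hs', hsl'⟩ := hlab c (.inr hc)
    obtain ⟨h₁, h₂⟩ := hL _ _ hs
    rw [hi, Tree.subtree_concat, hs, Option.bind_some] at hs'
    have h₃ : ((L (W d)).map Prod.snd)[i]? = some (P.lab c) := by
      rw [h₂, List.getElem?_map, hs', Option.map_some, hsl']
    rw [List.getElem?_map] at h₃
    obtain ⟨⟨q, b⟩, hq, hb⟩ := Option.map_eq_some_iff.1 h₃
    simp only at hb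
    subst hb
    refine ⟨q, hq, (cand_iff hd).2 ?_⟩
    have := h₁.1 _ (List.mem_of_getElem? hq)
    rwa [hsl] at this
  have hseq : ∀ {c d i j p q : ℕ} {a b : Fin n}, (P.stack c)[1]? = some d →
      (L (W d))[i]? = some (p, a) → (L (W d))[j]? = some (q, b) → i < j → P.Link c p q := by
    intro c d i j p q a b hd hp hq hij
    obtain ⟨s, hs, hsl⟩ := hlab d (entry_of_mem_stack (parent_mem hd))
    obtain ⟨⟨-, h₁⟩, -⟩ := hL _ _ hs
    rw [hsl] at h₁
    rw [link_iff hd]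
    obtain ⟨hi, hi'⟩ := List.getElem?_eq_some_iff.1 hp
    obtain ⟨hj, hj'⟩ := List.getElem?_eq_some_iff.1 hq
    have := List.pairwise_iff_getElem.1 h₁ i j hi hj hij
    rwa [hi', hj'] at this
  have huniq : ∀ {c d p q}, (P.stack c)[1]? = some d → P.Cand c p → ¬P.Link c p p → P.Cand c q →
      p = q := fun {c d p q} hd hp hl hq => by
    rw [link_iff hd] at hl
    exact (hM _).occ_unique ((cand_iff hd).1 hp) hl ((cand_iff hd).1 hq)
  have hpar : ∀ {c}, P.Entry c → ∃ d i, (P.stack c)[1]? = some d ∧ W c = W d ++ [i] := by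
    intro c hc
    have hne : W c ≠ [] := by
      obtain ⟨h0, χ, l, hs, hχ⟩ := hc
      obtain ⟨t, rfl⟩ := Nat.exists_eq_succ_of_ne_zero h0
      have := h.2 t
      rw [hs] at this
      rcases χ with _ | _ | _ | _
      · obtain ⟨⟨i, hi⟩, -⟩ := this; simp [hi]
      · exact absurd rfl hχ
      · obtain ⟨⟨u, i, j, -, hj, -⟩, -⟩ := this; simp [hj]
      · obtain ⟨⟨u, i, j, -, hj, -⟩, -⟩ := this; simp [hj]
    obtain ⟨d, hd⟩ := h.exists_parent hne
    obtain ⟨i, hi⟩ := h.parent hd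
    exact ⟨d, i, hd, hi⟩
  -- Two children with the same occurrence outside all stars have the same index.
  have hsame : ∀ {c d}, P.Same c d → W c = W d := by
    intro c d hcd
    induction hcd with
    | root => rfl
    | @step c d c' d' hc hd hc' hd' hs hl ho ih =>
      rcases ho with rfl | ⟨q, hq, hqq⟩
      · rfl
      obtain ⟨i, hi⟩ := h.parent hc'
      obtain ⟨j, hj⟩ := h.parent hd'
      obtain ⟨p₁, hp₁, hp₁'⟩ := hocc hc hc' hi
      obtain ⟨p₂, hp₂, hp₂'⟩ := hocc hd hd' hj
      rw [cand_iff hd', ← hs.lab_eq, ← hl, ← cand_iff hc'] at hp₂'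
      obtain rfl := huniq hc' hq hqq hp₁'
      obtain rfl := huniq hc' hq hqq hp₂'
      rw [← ih] at hp₂
      rcases lt_trichotomy i j with h' | rfl | h'
      · exact absurd (hseq hc' hp₁ hp₂ h') hqq
      · rw [hi, hj, ih]
      · exact absurd (hseq hc' hp₂ hp₁ h') hqq
  -- A sibling step moves to the left or to the right in the lifted word of the parent.
  have hpos : ∀ c, P.Entry c → ∃ d i q, (P.stack c)[1]? = some d ∧ W c = W d ++ [i] ∧
      (L (W d))[i]? = some (q, P.lab c) ∧ P.Pos c q := by
    intro c
    induction c using Nat.strong_induction_on with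
    | _ c ih =>
      intro hc
      obtain ⟨d, i, hd, hi⟩ := hpar hc
      obtain ⟨q, hq, hq'⟩ := hocc hc hd hi
      refine ⟨d, i, q, hd, hi, hq, ?_⟩
      obtain ⟨h0, χ, l, hs, hχ⟩ := hc
      obtain ⟨t, rfl⟩ := Nat.exists_eq_succ_of_ne_zero h0
      have hst := h.2 t
      rw [hs] at hst
      have hsib : (χ = .following ∨ χ = .preceding) → ∀ u k j, W t = u ++ [k] →
          W (t + 1) = u ++ [j] → ∃ c p, (P.stack t)[0]? = some c ∧ P.Pos c p ∧ j = i ∧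
            (L (W d))[k]? = some (p, P.lab c) := by
        intro hχ' u k j hk hj
        obtain ⟨c, hc, hWc⟩ := h.head t
        have hd' : (P.stack c)[1]? = some d := by
          rw [stack_of_head hc]
          rw [Nat.succ_eq_add_one, stack_sibling hs hχ'] at hd
          rcases hst' : P.stack t with _ | ⟨x, r⟩
          · simp [hst'] at hd
          · simpa [hst'] using hd
        have hcm := List.mem_of_getElem? hc
        have hce : P.Entry c := (entry_of_mem_stack hcm).resolve_left fun h0 => by
          have := lt_of_parent hd'; omega
        obtain ⟨d₁, k', p, hd₁, hk', hp, hpp⟩ := ih c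
          (Nat.lt_succ_of_le (le_of_mem_stack hcm)) hce
        obtain rfl := Option.some.inj (hd'.symm.trans hd₁)
        rw [← hWc, hk] at hk'
        obtain ⟨rfl, hk'⟩ := List.append_inj' hk' rfl
        obtain rfl : k = k' := by simpa using hk'
        rw [Nat.succ_eq_add_one, hj] at hi
        refine ⟨c, p, hc, hpp, ?_, hp⟩
        simpa using hi
      rcases χ with _ | _ | _ | _
      · exact .child hs hq'
      · exact absurd rfl hχ
      · obtain ⟨⟨u, k, j, hk, hj, hkj⟩, -⟩ := hst
        obtain ⟨c, p, hc, hpp, rfl, hp⟩ := hsib (.inl rfl) u k j hk hj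
        exact .following hs hq' hc hpp (hseq hd hp hq hkj)
      · obtain ⟨⟨u, k, j, hk, hj, hkj⟩, -⟩ := hst
        obtain ⟨c, p, hc, hpp, rfl, hp⟩ := hsib (.inr rfl) u k j hk hj
        exact .preceding hs hq' hc hpp (hseq hd hq hp hkj)
  refine ⟨fun t l hs => ?_, fun c hc => ?_, fun c d c' d' hc hd hc' hd' hs => ?_⟩
  · have hst := h.2 t
    rw [hs] at hst
    obtain ⟨⟨i, hi⟩, -, hl⟩ := hst
    obtain ⟨d, hd⟩ := h.exists_parent (t := t) (by simp [hi])
    obtain ⟨j, hj⟩ := h.parent hd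
    rw [hi] at hj
    obtain ⟨hj, -⟩ := List.append_inj' hj rfl
    rw [hj] at hl
    exact ⟨d, hd, (hlab d (entry_of_mem_stack (parent_mem hd))).unique hl⟩
  · obtain ⟨_, _, q, _, _, _, hq⟩ := hpos c hc
    exact ⟨q, hq⟩
  · obtain ⟨i, hi⟩ := h.parent hc'
    obtain ⟨j, hj⟩ := h.parent hd'
    obtain ⟨p, hp, hp'⟩ := hocc hc hc' hi
    obtain ⟨q, hq, hq'⟩ := hocc hd hd' hj
    have hW := hsame hs
    rw [← hW] at hq hj
    rcases lt_trichotomy i j with h' | rfl | h'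
    · exact .inr ⟨p, q, hp', hq', .inl (hseq hc' hp hq h')⟩
    · exact .inl ((hlab c (.inr hc)).unique (by rw [hi, ← hj]; exact hlab d (.inr hd)))
    · exact .inr ⟨p, q, hp', hq', .inr (hseq hc' hq hp h')⟩

end Problem

end XPathSat

namespace XPathSat

namespace Problem

variable {n : ℕ} {P : Problem n}

/-! ### The criterion is sufficient -/

/-- The condition that a sibling step at time `t` imposes on the occurrences before and after. -/
def Linked (P : Problem n) (t p q : ℕ) : Prop :=
  (∀ l, P.step t = some (.following, l) → P.Link t p q) ∧
    ∀ l, P.step t = some (.preceding, l) → P.Link t q p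

/-- Occurrences can be chosen for all nodes consistently: every node is left by at most one sibling
step, so the choices can be made from the last node to the first. -/
theorem Good.exists_pos (h : P.Good) {N : ℕ} (hN : ∀ t, N ≤ t → P.step t = none) :
    ∃ pos : ℕ → ℕ, ∀ c, P.Entry c → P.Pos c (pos c) ∧ ∀ t χ l, P.step (t + 1) = some (χ, l) →
      (χ = .following ∨ χ = .preceding) → (P.stack t)[0]? = some c →
        P.Linked (t + 1) (pos c) (pos (t + 1)) := by
  have hE : ∀ {c}, P.Entry c → c < N := fun {c} ⟨_, χ, l, hs, _⟩ => by
    by_contra hc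
    rw [hN c (by omega)] at hs
    exact absurd hs (by simp)
  suffices hs : ∀ k, ∃ pos : ℕ → ℕ, ∀ c, N - k ≤ c → P.Entry c → P.Pos c (pos c) ∧
      ∀ t χ l, P.step (t + 1) = some (χ, l) → (χ = .following ∨ χ = .preceding) →
        (P.stack t)[0]? = some c → P.Linked (t + 1) (pos c) (pos (t + 1)) by
    obtain ⟨pos, hpos⟩ := hs N
    exact ⟨pos, fun c => hpos c (by omega)⟩
  intro k
  induction k with
  | zero => exact ⟨id, fun c hc he => absurd (hE he) (by omega)⟩
  | succ k ih =>
    obtain ⟨pos, hpos⟩ := ih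
    set m := N - (k + 1) with hm
    by_cases hk : N - k = m
    · exact ⟨pos, fun c hc => hpos c (by omega)⟩
    have hkm : N - k = m + 1 := by omega
    by_cases hme : P.Entry m
    swap
    · refine ⟨pos, fun c hc he => hpos c ?_ he⟩
      have : c ≠ m := fun h => hme (h ▸ he)
      omega
    have hnew : ∀ {t c χ l}, P.step (t + 1) = some (χ, l) → (χ = .following ∨ χ = .preceding) →
        (P.stack t)[0]? = some c → c ≤ t ∧ P.Entry (t + 1) := fun {t c χ l} hs hχ hc =>
      ⟨le_of_mem_stack (List.mem_of_getElem? hc), by omega, χ, l, hs, by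
        rcases hχ with rfl | rfl <;> simp⟩
    have hq : ∃ q, P.Pos m q ∧ ∀ t χ l, P.step (t + 1) = some (χ, l) →
        (χ = .following ∨ χ = .preceding) → (P.stack t)[0]? = some m →
          P.Linked (t + 1) q (pos (t + 1)) := by
      -- If `m` is left by a sibling step, the choice for the next sibling determines a choice for
      -- `m`.
      by_cases hex : ∃ t χ l, P.step (t + 1) = some (χ, l) ∧ (χ = .following ∨ χ = .preceding) ∧
          (P.stack t)[0]? = some m
      · obtain ⟨t, χ, l, hs, hχ, hc⟩ := hex
        obtain ⟨hle, he⟩ := hnew hs hχ hc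
        have hp := (hpos (t + 1) (by omega) he).1
        have : ∃ q, P.Pos m q ∧ P.Linked (t + 1) q (pos (t + 1)) := by
          generalize pos (t + 1) = r at hp
          cases hp with
          | child hs' => rw [hs] at hs'; rcases hχ with rfl | rfl <;> simp at hs'
          | following hs' _ hd hp hl =>
            obtain rfl := Option.some.inj (hc.symm.trans hd)
            exact ⟨_, hp, fun l _ => hl, fun l' h' => by rw [hs'] at h'; simp at h'⟩
          | preceding hs' _ hd hp hl =>
            obtain rfl := Option.some.inj (hc.symm.trans hd)
            exact ⟨_, hp, fun l' h' => by rw [hs'] at h'; simp at h', fun l _ => hl⟩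
        obtain ⟨q, hq, hl⟩ := this
        refine ⟨q, hq, fun t' χ' l' hs' hχ' hc' => ?_⟩
        obtain rfl := sibling_unique hs hχ hc hs' hχ' hc'
        exact hl
      · obtain ⟨q, hq⟩ := h.pos m hme
        exact ⟨q, hq, fun t χ l hs hχ hc => absurd ⟨t, χ, l, hs, hχ, hc⟩ hex⟩
    obtain ⟨q, hq, hl⟩ := hq
    refine ⟨Function.update pos m q, fun c hc he => ?_⟩
    by_cases hcm : c = m
    · subst hcm
      rw [Function.update_self]
      refine ⟨hq, fun t χ l hs hχ hc => ?_⟩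
      rw [Function.update_of_ne (by have := (hnew hs hχ hc).1; omega)]
      exact hl t χ l hs hχ hc
    · rw [Function.update_of_ne hcm]
      obtain ⟨h₁, h₂⟩ := hpos c (by omega) he
      refine ⟨h₁, fun t χ l hs hχ hc => ?_⟩
      rw [Function.update_of_ne (by have := (hnew hs hχ hc).1; omega)]
      exact h₂ t χ l hs hχ hc

/-- The first name of a node: the time at which it was entered for the first time. -/
noncomputable def rep (P : Problem n) (c : ℕ) : ℕ := sInf {d | P.Same d c}

/-- The name of the parent of a node. -/
def par (P : Problem n) (c : ℕ) : ℕ := ((P.stack c)[1]?).getD 0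

/-- Nodes entered by a following-sibling step go to the right of all earlier nodes, those entered by
a preceding-sibling step to the left, unless occurrences force a different order. -/
def rank (P : Problem n) (c : ℕ) : ℤ :=
  match P.step c with
  | some (.preceding, _) => -c
  | _ => c

/-- The criterion by which siblings are sorted: by the outermost star that contains their
occurrence, and inside one star, where every order is possible, by rank. -/
def place (P : Problem n) (pos : ℕ → ℕ) (c : ℕ) : ℕ ×ₗ ℤ :=
  toLex ((P.dtd.content (P.lab (P.par c))).core.root (P.off (P.lab (P.par c))) (pos c), P.rank c)

/-- `c` is the first name of a child of the node with the first name `d`. -/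
def Kid (P : Problem n) (d c : ℕ) : Prop :=
  P.Entry c ∧ P.rep c = c ∧ P.rep (P.par c) = d

theorem Good.rep_same (h : P.Good) {c : ℕ} (hc : c = 0 ∨ P.Entry c) : P.Same (P.rep c) c :=
  Nat.sInf_mem (s := {d | P.Same d c}) ⟨c, h.same_refl hc⟩

theorem Good.rep_le (h : P.Good) {c : ℕ} (hc : c = 0 ∨ P.Entry c) : P.rep c ≤ c :=
  Nat.sInf_le (h.same_refl hc)

theorem Same.rep_eq {c d : ℕ} (h : P.Same c d) : P.rep c = P.rep d := by
  unfold rep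
  congr 1
  ext e
  exact ⟨fun h' => h'.trans h, fun h' => h'.trans h.symm⟩

theorem Good.rep_rep (h : P.Good) {c : ℕ} (hc : c = 0 ∨ P.Entry c) : P.rep (P.rep c) = P.rep c :=
  (h.rep_same hc).rep_eq

theorem Good.rep_zero (h : P.Good) : P.rep 0 = 0 :=
  Nat.le_zero.1 (h.rep_le (.inl rfl))

theorem par_eq {c d : ℕ} (h : (P.stack c)[1]? = some d) : P.par c = d := by
  simp [par, h]

theorem Good.stack_par (h : P.Good) {c : ℕ} (hc : P.Entry c) :
    (P.stack c)[1]? = some (P.par c) := by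
  obtain ⟨d, hd⟩ := h.parent hc
  rw [par_eq hd, hd]

theorem Good.par_mem (h : P.Good) {c : ℕ} (hc : P.Entry c) : P.par c = 0 ∨ P.Entry (P.par c) :=
  entry_of_mem_stack (parent_mem (h.stack_par hc))

theorem Good.rep_entry (h : P.Good) {c : ℕ} (hc : P.Entry c) :
    P.Entry (P.rep c) ∧ P.rep (P.par (P.rep c)) = P.rep (P.par c) ∧ (P.rep c = c ∨ P.Outer c) := by
  have hs := h.rep_same (.inr hc)
  generalize P.rep c = r at hs
  cases hs with
  | root => exact absurd rfl hc.1
  | step hr _ hr' hc' hs hl ho =>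
    rw [par_eq hr', par_eq hc']
    exact ⟨hr, hs.rep_eq, ho.imp_right fun ho => (outer_congr hr' hc' hs.lab_eq hl).1 ho⟩

theorem Good.kid_rep (h : P.Good) {c : ℕ} (hc : P.Entry c) : P.Kid (P.rep (P.par c)) (P.rep c) :=
  ⟨(h.rep_entry hc).1, h.rep_rep (.inr hc), (h.rep_entry hc).2.1⟩

theorem Good.kid_lt (h : P.Good) {c d : ℕ} (hk : P.Kid d c) : d < c := by
  obtain ⟨hc, -, rfl⟩ := hk
  exact (h.rep_le (h.par_mem hc)).trans_lt (lt_of_parent (h.stack_par hc))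

theorem Good.kid_lab (h : P.Good) {c d : ℕ} (hk : P.Kid d c) : P.lab (P.par c) = P.lab d := by
  obtain ⟨hc, -, rfl⟩ := hk
  exact (h.rep_same (h.par_mem hc)).lab_eq.symm

/-- Two occurrences of different children of one node are usable together in one order. -/
theorem Good.seq_total (h : P.Good) (hM : P.dtd.IsMRW) {c c' d p q : ℕ} (hk : P.Kid d c)
    (hk' : P.Kid d c') (hne : c ≠ c') (hp : P.Cand c p) (hq : P.Cand c' q) :
    P.Seq (P.lab d) p q ∨ P.Seq (P.lab d) q p := by
  have hc := h.stack_par hk.1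
  have hc' := h.stack_par hk'.1
  have hs : P.Same (P.par c) (P.par c') := by
    have h₁ := h.rep_same (h.par_mem hk.1)
    have h₂ := h.rep_same (h.par_mem hk'.1)
    rw [hk.2.2] at h₁
    rw [hk'.2.2] at h₂
    exact h₁.symm.trans h₂
  rw [cand_iff hc, h.kid_lab hk] at hp
  rw [cand_iff hc', h.kid_lab hk'] at hq
  by_cases hl : P.lab c = P.lab c'
  · have ho : ¬P.Outer c := fun ho => hne <| by
      rw [← hk.2.1, ← hk'.2.1]
      exact (Same.step hk.1 hk'.1 hc hc' hs hl (.inr ho)).rep_eq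
    by_cases hpq : p = q
    · subst hpq
      by_contra hn
      rw [or_self] at hn
      refine ho ⟨p, ?_, ?_⟩
      · rwa [cand_iff hc, h.kid_lab hk]
      · rwa [link_iff hc, h.kid_lab hk]
    · have := Core.two_le_count hp (hl ▸ hq) hpq
      rw [Regex.syms_core] at this
      exact Regex.seq_total_of_factors _ _ (hM _).1 hp hq (by omega) hpq
  · obtain ⟨p', q', hp', hq', hpq⟩ :=
      (h.compat c c' _ _ hk.1 hk'.1 hc hc' hs).resolve_left hl
    rw [cand_iff hc, h.kid_lab hk] at hp'
    rw [cand_iff hc', h.kid_lab hk'] at hq'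
    rw [link_iff hc, link_iff hc, h.kid_lab hk] at hpq
    exact (hM _).1.seq_total hl hp' hq' hpq hp hq

/-- The sorted children of a node form a subsequence of a word of the content model. -/
theorem Good.exists_word (h : P.Good) (hM : P.dtd.IsMRW) {N : ℕ}
    (hN : ∀ t, N ≤ t → P.step t = none) {pos : ℕ → ℕ} (hpos : ∀ c, P.Entry c → P.Pos c (pos c))
    (d : ℕ) : ∃ L : List ℕ, (∀ c, c ∈ L ↔ P.Kid d c) ∧
      L.Pairwise (fun c c' => P.place pos c ≤ P.place pos c') ∧
      ∃ u ∈ (P.dtd.content (P.lab d)).lang, (L.map P.lab).Sublist u := by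
  classical
  set L₀ := (List.range N).filter fun c => P.Kid d c
  set L := L₀.mergeSort fun c c' => decide (P.place pos c ≤ P.place pos c')
  have hperm : L.Perm L₀ := List.mergeSort_perm _ _
  have hmem : ∀ c, c ∈ L ↔ P.Kid d c := fun c => by
    rw [hperm.mem_iff, List.mem_filter, List.mem_range, decide_eq_true_iff, and_iff_right_iff_imp]
    rintro ⟨⟨_, χ, l, hs, _⟩, -⟩
    by_contra hc
    rw [hN c (by omega)] at hs
    exact absurd hs (by simp)
  have hnd : L.Nodup := hperm.nodup_iff.2 (List.nodup_range.filter _)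
  have hsort : L.Pairwise fun c c' => P.place pos c ≤ P.place pos c' := by
    have := List.pairwise_mergeSort (le := fun c c' => decide (P.place pos c ≤ P.place pos c'))
      (fun a b c hab hbc => by
        rw [decide_eq_true_iff] at *
        exact hab.trans hbc)
      (fun a b => by
        rw [Bool.or_eq_true, decide_eq_true_iff, decide_eq_true_iff]
        exact le_total _ _) L₀
    exact this.imp fun h => of_decide_eq_true h
  refine ⟨L, hmem, hsort, ?_⟩
  have hcand : ∀ {c}, P.Kid d c → P.Occ (P.lab d) (pos c) (P.lab c) := fun {c} hk => by
    have := (hpos c hk.1).cand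
    rwa [cand_iff (h.stack_par hk.1), h.kid_lab hk] at this
  have hlift : (P.dtd.content (P.lab d)).core.Lift (P.off (P.lab d))
      (L.map fun c => (pos c, P.lab c)) := by
    refine ⟨fun p hp => ?_, ?_⟩
    · obtain ⟨c, hc, rfl⟩ := List.mem_map.1 hp
      exact hcand ((hmem c).1 hc)
    · rw [List.pairwise_map]
      refine (hsort.and hnd).imp_of_mem fun {c c'} hc hc' hcc => ?_
      have hk := (hmem c).1 hc
      have hk' := (hmem c').1 hc'
      have hle := hcc.1
      rw [place, place, Prod.Lex.toLex_le_toLex, h.kid_lab hk, h.kid_lab hk'] at hle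
      rcases h.seq_total hM hk hk' hcc.2 (hpos c hk.1).cand (hpos c' hk'.1).cand with hs | hs
      · exact hs
      · have hr := Core.Seq.root_le hs
        rcases hle with hlt | ⟨he, -⟩
        · exact absurd hr (not_le.2 hlt)
        · rcases Core.eq_or_seq_of_root_eq (hcand hk) (hcand hk') he with e | hs'
          · rw [← e] at hs ⊢
            exact hs
          · exact hs'
  obtain ⟨u, hu, hs⟩ := Regex.exists_lang_of_sub _ hlift.mem_sub
  exact ⟨u, hu, by simpa [List.map_map, Function.comp_def] using hs⟩

/-- If the images of the members of `L` form a subsequence of `u`, then a copy of `u` can carry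
those members in place of their images. -/
theorem exists_markers {α β : Type} (f : α → β) : ∀ {L : List α} {u : List β},
    (L.map f).Sublist u → ∃ v : List (α ⊕ β), v.map (Sum.elim f id) = u ∧
      v.filterMap Sum.getLeft? = L := by
  intro L u h
  induction u generalizing L with
  | nil =>
    rw [List.sublist_nil, List.map_eq_nil_iff] at h
    exact ⟨[], rfl, h.symm⟩
  | cons b u ih =>
    rcases L with _ | ⟨a, L⟩
    · obtain ⟨v, hv, hv'⟩ := ih (L := []) (by simp)
      exact ⟨.inr b :: v, by simp [hv], by simpa using hv'⟩
    · rw [List.map_cons] at h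
      rcases h with _ | h | h
      · rename_i h
        obtain ⟨v, hv, hv'⟩ := ih (L := a :: L) h
        exact ⟨.inr b :: v, by simp [hv], by rw [List.filterMap_cons_none rfl, hv']⟩
      · rename_i h
        obtain ⟨v, hv, hv'⟩ := ih h
        exact ⟨.inl a :: v, by simp [hv], by simp [hv']⟩

/-- The words of all nodes, with the visited children marked by their names. -/
theorem Good.exists_words (h : P.Good) (hM : P.dtd.IsMRW) {N : ℕ}
    (hN : ∀ t, N ≤ t → P.step t = none) {pos : ℕ → ℕ} (hpos : ∀ c, P.Entry c → P.Pos c (pos c)) :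
    ∃ V : ℕ → List (ℕ ⊕ Fin n), ∀ d, (V d).map (Sum.elim P.lab id) ∈
        (P.dtd.content (P.lab d)).lang ∧ (∀ c, .inl c ∈ V d ↔ P.Kid d c) ∧
      (V d).Pairwise fun x y => ∀ c c', x = .inl c → y = .inl c' →
        P.place pos c ≤ P.place pos c' := by
  have : ∀ d, ∃ v : List (ℕ ⊕ Fin n), v.map (Sum.elim P.lab id) ∈
        (P.dtd.content (P.lab d)).lang ∧ (∀ c, .inl c ∈ v ↔ P.Kid d c) ∧
      v.Pairwise fun x y => ∀ c c', x = .inl c → y = .inl c' →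
        P.place pos c ≤ P.place pos c' := fun d => by
    obtain ⟨L, hL, hs, u, hu, hLu⟩ := h.exists_word hM hN hpos d
    obtain ⟨v, rfl, rfl⟩ := exists_markers P.lab hLu
    refine ⟨v, hu, fun c => ?_, ?_⟩
    · rw [← hL, List.mem_filterMap]
      exact ⟨fun h => ⟨_, h, rfl⟩, fun ⟨x, hx, hxc⟩ => by
        rw [Sum.getLeft?_eq_some_iff] at hxc; rwa [← hxc]⟩
    · rw [List.pairwise_filterMap] at hs
      exact hs.imp fun {x y} hxy c c' hx hy => hxy c (by simp [hx]) c' (by simp [hy])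
  choose V hV using this
  exact ⟨V, hV⟩

instance : LawfulBEq (ℕ ⊕ Fin n) where
  eq_of_beq {a b} h := by
    rcases a with a | a <;> rcases b with b | b
    · exact congrArg _ (eq_of_beq (α := ℕ) h)
    · exact absurd h Bool.false_ne_true
    · exact absurd h Bool.false_ne_true
    · exact congrArg _ (eq_of_beq (α := Fin n) h)
  rfl {a} := by
    rcases a with a | a
    · exact beq_self_eq_true (α := ℕ) a
    · exact beq_self_eq_true (α := Fin n) a

/-- The tree with the given words; unvisited nodes get default subtrees. The first argument bounds
the depth. -/
def build (P : Problem n) (V : ℕ → List (ℕ ⊕ Fin n)) (dflt : Fin n → Tree (Fin n)) :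
    ℕ → ℕ → Tree (Fin n)
  | 0, d => dflt (P.lab d)
  | k + 1, d => .node (P.lab d) ((V d).map (Sum.elim (build P V dflt k) dflt))

/-- The address in the built tree of the node with a given path to the root. -/
noncomputable def addr (P : Problem n) (V : ℕ → List (ℕ ⊕ Fin n)) : List ℕ → List ℕ
  | c :: d :: l => addr P V (d :: l) ++ [(V (P.rep d)).idxOf (.inl (P.rep c))]
  | _ => []

/-- All content models are respected, regardless of the root label. -/
def Valid (D : DTD n) (T : Tree (Fin n)) : Prop :=
  ∀ w s, T.subtree w = some s → s.children.map Tree.label ∈ (D.content s.label).lang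

theorem exists_valid {D : DTD n} (h : D.NoUselessSymbols) (a : Fin n) :
    ∃ T : Tree (Fin n), T.label = a ∧ Valid D T := by
  obtain ⟨T, hT, w, s, hs, rfl⟩ := h a
  refine ⟨s, rfl, fun w' s' hs' => hT.2 (w ++ w') s' ?_⟩
  rw [Tree.subtree_append, hs]
  exact hs'

theorem label_build {V : ℕ → List (ℕ ⊕ Fin n)} {dflt : Fin n → Tree (Fin n)}
    (hd : ∀ a, (dflt a).label = a) (k d : ℕ) : (P.build V dflt k d).label = P.lab d := by
  cases k with
  | zero => exact hd _
  | succ k => rfl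

theorem valid_build {V : ℕ → List (ℕ ⊕ Fin n)} {dflt : Fin n → Tree (Fin n)}
    (hd : ∀ a, (dflt a).label = a) (hv : ∀ a, Valid P.dtd (dflt a))
    (hV : ∀ d, (V d).map (Sum.elim P.lab id) ∈ (P.dtd.content (P.lab d)).lang) (k d : ℕ) :
    Valid P.dtd (P.build V dflt k d) := by
  induction k generalizing d with
  | zero => exact hv _
  | succ k ih =>
    intro w s hs
    rcases w with _ | ⟨i, w⟩
    · obtain rfl := Option.some.inj hs
      have he : (Tree.label ∘ Sum.elim (P.build V dflt k) dflt) = Sum.elim P.lab id := by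
        funext x
        rcases x with c | a
        · exact label_build hd k c
        · exact hd a
      simp only [build, Tree.children, Tree.label, List.map_map, he]
      exact hV d
    · obtain ⟨t, ht, hs⟩ := Option.bind_eq_some_iff.1 hs
      simp only [build, Tree.children, List.getElem?_map] at ht
      obtain ⟨x, -, rfl⟩ := Option.map_eq_some_iff.1 ht
      rcases x with c | a
      · exact ih c w s hs
      · exact hv a w s hs

/-- The criterion is sufficient: the tree is built from the root downwards, every node with a word
that contains its required children in the order of `place`. -/
theorem exists_walks_of_good (hM : P.dtd.IsMRW) (hU : P.dtd.NoUselessSymbols) {N : ℕ}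
    (hN : ∀ t, N ≤ t → P.step t = none) (h : P.Good) :
    ∃ T, P.dtd.Conforms T ∧ ∃ W, P.Walks T W := by
  obtain ⟨pos, hpos⟩ := h.exists_pos hN
  obtain ⟨V, hV⟩ := h.exists_words hM hN fun c hc => (hpos c hc).1
  choose dflt hd hv using exists_valid hU
  set T := P.build V dflt N 0 with hT
  -- Names grow along every branch, so the bound `N` on the depth is never exhausted.
  have hnode : ∀ t (l : List ℕ), l <:+ P.stack t → ∀ c l', l = c :: l' →
      ∃ k, N ≤ P.rep c + k ∧ T.subtree (P.addr V l) = some (P.build V dflt k (P.rep c)) := by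
    intro t l hl
    induction l with
    | nil => rintro c l' ⟨⟩
    | cons c l ih =>
      rintro _ _ ⟨⟩
      rcases l with _ | ⟨d, l⟩
      · obtain rfl := h.eq_zero_of_stack hl
        refine ⟨N, by omega, ?_⟩
        rw [h.rep_zero]
        rfl
      · obtain ⟨k, hk, hs⟩ := ih ((List.suffix_cons _ _).trans hl) d l rfl
        have hst := stack_eq_of_suffix hl
        have hpc : (P.stack c)[1]? = some d := by simp [hst]
        have hce : P.Entry c := (entry_of_mem_stack (hl.subset (by simp))).resolve_left
          fun h0 => by have := lt_of_parent hpc; omega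
        have hkid := h.kid_rep hce
        rw [par_eq hpc] at hkid
        have hlt := h.kid_lt hkid
        have hcN : P.rep c < N := by
          obtain ⟨_, χ, a, hs, _⟩ := hkid.1
          by_contra hn
          rw [hN _ (by omega)] at hs
          exact absurd hs (by simp)
        rcases k with _ | k
        · omega
        refine ⟨k, by omega, ?_⟩
        have hm := (List.idxOf_lt_length_iff).2 (((hV (P.rep d)).2.1 (P.rep c)).2 hkid)
        rw [addr, Tree.subtree_concat, hs, Option.bind_some]
        simp only [build, Tree.children, List.getElem?_map, List.getElem?_eq_getElem hm,
          List.getElem_idxOf]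
        rfl
  have hnode' : ∀ {t c}, (P.stack t)[0]? = some c →
      T.HasLabel (P.addr V (P.stack t)) (P.lab c) := by
    intro t c hc
    rcases hs : P.stack t with _ | ⟨x, l⟩ <;> simp [hs] at hc
    subst hc
    obtain ⟨k, -, hk⟩ := hnode t _ (List.suffix_refl _) x l hs
    rw [hs] at hk
    exact ⟨_, hk, by rw [label_build hd, (h.rep_same (entry_of_mem_stack (t := t)
      (by simp [hs]))).lab_eq]⟩
  have hnode'' : ∀ t, T.IsNode (P.addr V (P.stack t)) := fun t => by
    rcases hs : P.stack t with _ | ⟨x, l⟩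
    · exact absurd hs (h.stack_ne_nil t)
    · obtain ⟨k, -, hk⟩ := hnode t _ (List.suffix_refl _) x l hs
      exact ⟨_, hs ▸ hk⟩
  -- The occurrence of a node is also the occurrence of its first name.
  have hprep : ∀ {c}, P.Entry c → pos (P.rep c) = pos c := by
    intro c hc
    obtain ⟨hr, hpar, he | ⟨q, hq, hqq⟩⟩ := h.rep_entry hc
    · rw [he]
    · have hl := (h.rep_same (.inr hc)).lab_eq
      have hl' : P.lab (P.par (P.rep c)) = P.lab (P.par c) := by
        rw [← (h.rep_same (h.par_mem hr)).lab_eq, hpar, (h.rep_same (h.par_mem hc)).lab_eq]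
      have h₁ := (hpos _ hc).1.cand
      have h₂ := (hpos _ hr).1.cand
      rw [cand_iff (h.stack_par hc)] at hq h₁
      rw [cand_iff (h.stack_par hr), hl, hl'] at h₂
      rw [link_iff (h.stack_par hc)] at hqq
      rw [← (hM _).occ_unique hq hqq h₁, ← (hM _).occ_unique hq hqq h₂]
  have hplace : ∀ {c}, P.Entry c → P.place pos (P.rep c) = toLex
      ((P.dtd.content (P.lab (P.par c))).core.root (P.off (P.lab (P.par c))) (pos c),
        P.rank (P.rep c)) := by
    intro c hc
    obtain ⟨hr, hpar, -⟩ := h.rep_entry hc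
    rw [place, hprep hc, ← (h.rep_same (h.par_mem hr)).lab_eq, hpar,
      (h.rep_same (h.par_mem hc)).lab_eq]
  -- An occurrence that can be repeated is inside a star, so its node has only one name.
  have hrep : ∀ {c}, P.Entry c → P.Link c (pos c) (pos c) → P.rep c = c := by
    intro c hc hl
    refine (h.rep_entry hc).2.2.resolve_right fun ⟨q, hq, hqq⟩ => hqq ?_
    have h₁ := (hpos _ hc).1.cand
    rw [cand_iff (h.stack_par hc)] at hq h₁
    rw [link_iff (h.stack_par hc)] at hqq hl ⊢
    rwa [(hM _).occ_unique hq hqq h₁]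
  -- Siblings linked by a step are separated by their roots, or they share a star.
  have hroot : ∀ {c d}, P.Entry c → P.Entry d → P.par c = P.par d → P.Link c (pos c) (pos d) →
      (P.dtd.content (P.lab (P.par c))).core.root (P.off (P.lab (P.par c))) (pos c) <
        (P.dtd.content (P.lab (P.par c))).core.root (P.off (P.lab (P.par c))) (pos d) ∨
      (P.dtd.content (P.lab (P.par c))).core.root (P.off (P.lab (P.par c))) (pos c) =
        (P.dtd.content (P.lab (P.par c))).core.root (P.off (P.lab (P.par c))) (pos d) ∧
        P.rep c = c ∧ P.rep d = d := by
    intro c d hc hd' hcd hl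
    have hl' := (link_iff (h.stack_par hc)).1 hl
    rcases (Core.Seq.root_le hl').lt_or_eq with hlt | he
    · exact .inl hlt
    · have h₁ := (cand_iff (h.stack_par hc)).1 (hpos c hc).1.cand
      have h₂ := (cand_iff (h.stack_par hd')).1 (hpos d hd').1.cand
      rw [← hcd] at h₂
      refine .inr ⟨he, hrep hc ?_, hrep hd' ?_⟩
      · rw [link_iff (h.stack_par hc)]
        rcases Core.seq_self_of_root_eq h₁ h₂ he with e | hs
        · rw [← e] at hl'; exact hl'
        · exact hs
      · rw [link_iff (h.stack_par hd'), ← hcd]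
        rcases Core.seq_self_of_root_eq h₂ h₁ he.symm with e | hs
        · rw [← e] at hl'; exact hl'
        · exact hs
  have hidx : ∀ {e c c'}, P.Kid e c → P.Kid e c' → P.place pos c < P.place pos c' →
      (V e).idxOf (.inl c) < (V e).idxOf (.inl c') := by
    intro e c c' hk hk' hlt
    have hm := (List.idxOf_lt_length_iff).2 (((hV e).2.1 c).2 hk)
    have hm' := (List.idxOf_lt_length_iff).2 (((hV e).2.1 c').2 hk')
    rcases lt_trichotomy ((V e).idxOf (.inl c)) ((V e).idxOf (.inl c')) with hi | hi | hi
    · exact hi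
    · have h₁ := List.getElem_idxOf hm
      have h₂ := List.getElem_idxOf hm'
      simp only [hi] at h₁
      rw [h₁] at h₂
      cases h₂
      exact absurd hlt (lt_irrefl _)
    · have := List.pairwise_iff_getElem.1 (hV e).2.2 _ _ hm' hm hi c' c
        (List.getElem_idxOf hm') (List.getElem_idxOf hm)
      exact absurd this (not_le.2 hlt)
  refine ⟨T, ⟨?_, valid_build hd hv (fun d => (hV d).1) _ _⟩, fun t => P.addr V (P.stack t), rfl,
    fun t => ?_⟩
  · rw [hT, label_build hd]
    simp [lab]
  have hsib : ∀ χ l, P.step (t + 1) = some (χ, l) → (χ = .following ∨ χ = .preceding) →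
      ∃ u i j, P.addr V (P.stack t) = u ++ [i] ∧ P.addr V (P.stack (t + 1)) = u ++ [j] ∧
        (χ = .following → i < j) ∧ (χ = .preceding → j < i) := by
    intro χ l hs hχ
    have hte : P.Entry (t + 1) := ⟨by omega, χ, l, hs, by rcases hχ with rfl | rfl <;> simp⟩
    have htp := h.stack_par hte
    have hst := stack_sibling hs hχ
    rcases hst' : P.stack t with _ | ⟨c, _ | ⟨e, r⟩⟩
    · exact absurd hst' (h.stack_ne_nil t)
    · rw [hst, hst'] at htp
      simp at htp
    rw [hst, hst'] at htp
    simp only [List.tail_cons, List.getElem?_cons_succ, List.getElem?_cons_zero,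
      Option.some.injEq] at htp
    have hsc : P.stack c = c :: e :: r := stack_eq_of_suffix (t := t) (by rw [hst'])
    have hpc : (P.stack c)[1]? = some e := by simp [hsc]
    have hct : c ≤ t := le_of_mem_stack (P := P) (by simp [hst'])
    have hce : P.Entry c := (entry_of_mem_stack (t := t) (by simp [hst'])).resolve_left
      fun h0 => by have := lt_of_parent hpc; omega
    have hpar : P.par c = P.par (t + 1) := by rw [par_eq hpc, htp]
    have hk := h.kid_rep hce
    have hk' := h.kid_rep hte
    rw [par_eq hpc] at hk
    rw [← hpar, par_eq hpc] at hk'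
    have hlink : ∀ p q, P.Link (t + 1) p q ↔ P.Link c p q := fun p q => by
      rw [link_iff hpc, link_iff (h.stack_par hte), ← hpar, par_eq hpc]
    obtain ⟨h₁, h₂⟩ := (hpos c hce).2 t χ l hs hχ (by simp [hst'])
    have hrc : P.rank c ≤ c ∧ -c ≤ P.rank c := by
      unfold rank
      split <;> omega
    rw [hst, hst']
    refine ⟨_, _, _, rfl, rfl, ?_, ?_⟩
    · rintro rfl
      refine hidx hk hk' ?_
      rw [hplace hce, hplace hte, ← hpar, Prod.Lex.toLex_lt_toLex]
      rcases hroot hce hte hpar ((hlink _ _).1 (h₁ _ hs)) with hlt | ⟨he, hr, hr'⟩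
      · exact .inl hlt
      · refine .inr ⟨he, ?_⟩
        have : P.rank (t + 1) = (t + 1 : ℕ) := by simp [rank, hs]
        simp only [hr, hr', this]
        omega
    · rintro rfl
      refine hidx hk' hk ?_
      rw [hplace hce, hplace hte, ← hpar, Prod.Lex.toLex_lt_toLex]
      have hl := h₂ _ hs
      rcases hroot hte hce hpar.symm hl with hlt | ⟨he, hr, hr'⟩
      · rw [← hpar] at hlt; exact .inl hlt
      · rw [← hpar] at he
        refine .inr ⟨he, ?_⟩
        have : P.rank (t + 1) = -(t + 1 : ℕ) := by simp [rank, hs]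
        simp only [hr, hr', this]
        omega
  rcases hs : P.step (t + 1) with _ | ⟨_ | _ | _ | _, l⟩
  · change P.addr V (P.stack (t + 1)) = P.addr V (P.stack t)
    rw [stack_none hs]
  · have hst := stack_child hs
    refine ⟨?_, ?_⟩
    · beta_reduce
      rw [hst]
      rcases hst' : P.stack t with _ | ⟨c, r⟩
      · exact absurd hst' (h.stack_ne_nil t)
      · exact ⟨_, rfl⟩
    · rw [← lab_succ hs]
      exact hnode' (by simp [hst])
  · obtain ⟨d, hd', rfl⟩ := h.up t l hs
    have hst := stack_parent hs
    refine ⟨?_, hnode'' t, ?_⟩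
    · rcases hst' : P.stack t with _ | ⟨c, _ | ⟨e, r⟩⟩ <;> simp [hst'] at hd'
      beta_reduce
      rw [hst, hst']
      exact ⟨_, rfl⟩
    · exact hnode' (by rw [hst, List.getElem?_tail, hd'])
  · obtain ⟨u, i, j, hi, hj, hij, -⟩ := hsib _ _ hs (.inl rfl)
    refine ⟨⟨u, i, j, hi, hj, hij rfl⟩, hnode'' t, ?_⟩
    rw [← lab_succ hs]
    exact hnode' (by simp [stack_sibling hs (.inl rfl)])
  · obtain ⟨u, i, j, hi, hj, -, hij⟩ := hsib _ _ hs (.inr rfl)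
    refine ⟨⟨u, i, j, hi, hj, hij rfl⟩, hnode'' t, ?_⟩
    rw [← lab_succ hs]
    exact hnode' (by simp [stack_sibling hs (.inr rfl)])

/-- The criterion is necessary and sufficient. -/
theorem exists_walks_iff (hM : P.dtd.IsMRW) (hU : P.dtd.NoUselessSymbols) {N : ℕ}
    (hN : ∀ t, N ≤ t → P.step t = none) :
    (∃ T, P.dtd.Conforms T ∧ ∃ W, P.Walks T W) ↔ P.Good :=
  ⟨fun ⟨_, hT, _, hW⟩ => good_of_walks hM hT hW, exists_walks_of_good hM hU hN⟩

end Problem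

end XPathSat

namespace XPathSat

/-! ### Terms in prefix notation inside a string -/

/-- The string `x` occurs in `w` at position `i`. -/
def Begins (w : List Tok) (i : ℕ) (x : List Tok) : Prop := x <+: w.drop i

theorem begins_cons {w x : List Tok} {i : ℕ} {a : Tok} :
    Begins w i (a :: x) ↔ w[i]? = some a ∧ Begins w (i + 1) x := by
  unfold Begins
  rcases Nat.lt_or_ge i w.length with h | h
  · rw [List.drop_eq_getElem_cons h, List.cons_prefix_cons, List.getElem?_eq_getElem h,
      Option.some.injEq, eq_comm]
  · simp [List.drop_eq_nil_of_le h, List.getElem?_eq_none h]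

theorem begins_append {w x y : List Tok} {i : ℕ} :
    Begins w i (x ++ y) ↔ Begins w i x ∧ Begins w (i + x.length) y := by
  induction x generalizing i with
  | nil => simp [Begins]
  | cons a x ih =>
    rw [List.cons_append, begins_cons, begins_cons, ih, and_assoc, List.length_cons,
      show i + 1 + x.length = i + (x.length + 1) by omega]

theorem Begins.length_le {w x : List Tok} {i : ℕ} (h : Begins w i x) (hx : x ≠ []) :
    i + x.length ≤ w.length := by
  have h₁ := List.IsPrefix.length_le h
  have h₂ := List.length_pos_iff.2 hx
  rw [List.length_drop] at h₁
  omega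

theorem begins_nat_zero {w : List Tok} {i : ℕ} : Begins w i (encodeNat 0) ↔ w[i]? = some .done := by
  rw [encodeNat, List.replicate_zero, List.nil_append, begins_cons]
  simp [Begins]

theorem begins_nat_succ {w : List Tok} {i k : ℕ} :
    Begins w i (encodeNat (k + 1)) ↔ w[i]? = some .tick ∧ Begins w (i + 1) (encodeNat k) := by
  rw [encodeNat, List.replicate_succ, List.cons_append, begins_cons]
  rfl

theorem begins_nat_unique {w : List Tok} {i k l : ℕ} (h : Begins w i (encodeNat k))
    (h' : Begins w i (encodeNat l)) : k = l := by
  obtain ⟨r, hr⟩ := h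
  obtain ⟨s, hs⟩ := h'
  exact (encodeNat_inj (hr.trans hs.symm)).1

/-- The number of operands. A number in unary counts as a term, and so does `sym` or an axis
followed by a number. -/
def arity : Tok → ℕ
  | .done | .eps | .nil => 0
  | .tick | .sym | .star | .opt | .plus | .axis _ => 1
  | .cat | .alt | .sharp | .cons | .slash => 2

/-- A term in prefix notation begins at `i` and ends before `j`. -/
inductive Term (w : List Tok) : ℕ → ℕ → Prop
  | zero {i a} : w[i]? = some a → arity a = 0 → Term w i (i + 1)
  | one {i j a} : w[i]? = some a → arity a = 1 → Term w (i + 1) j → Term w i j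
  | two {i j k a} : w[i]? = some a → arity a = 2 → Term w (i + 1) j → Term w j k → Term w i k

theorem Term.lt {w : List Tok} {i j : ℕ} (h : Term w i j) : i < j := by
  induction h with
  | zero => omega
  | one _ _ _ ih => omega
  | two _ _ _ _ ih₁ ih₂ => omega

theorem Term.unique {w : List Tok} {i j k : ℕ} (h : Term w i j) (h' : Term w i k) : j = k := by
  induction h generalizing k with
  | zero h ha =>
    cases h' with
    | zero => rfl
    | one h₁ ha₁ => rw [Option.some.inj (h.symm.trans h₁)] at ha; omega
    | two h₁ ha₁ => rw [Option.some.inj (h.symm.trans h₁)] at ha; omega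
  | one h ha _ ih =>
    cases h' with
    | zero h₁ ha₁ => rw [Option.some.inj (h.symm.trans h₁)] at ha; omega
    | one h₁ ha₁ h₂ => exact ih h₂
    | two h₁ ha₁ => rw [Option.some.inj (h.symm.trans h₁)] at ha; omega
  | two h ha _ _ ih₁ ih₂ =>
    cases h' with
    | zero h₁ ha₁ => rw [Option.some.inj (h.symm.trans h₁)] at ha; omega
    | one h₁ ha₁ => rw [Option.some.inj (h.symm.trans h₁)] at ha; omega
    | two h₁ ha₁ h₂ h₃ =>
      obtain rfl := ih₁ h₂
      exact ih₂ h₃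

theorem term_nat {w : List Tok} {i k : ℕ} (h : Begins w i (encodeNat k)) :
    Term w i (i + k + 1) := by
  induction k generalizing i with
  | zero => exact .zero (begins_nat_zero.1 h) rfl
  | succ k ih =>
    obtain ⟨h₁, h₂⟩ := begins_nat_succ.1 h
    have := ih h₂
    exact .one h₁ rfl (by convert this using 1; omega)

/-- The tokens of a number in unary. -/
theorem nat_token {w : List Tok} {i k q : ℕ} (h : Begins w i (encodeNat k)) (hq : i ≤ q)
    (hq' : q ≤ i + k) : (w[q]? = some .tick ∨ w[q]? = some .done) ∧ Term w q (i + k + 1) := by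
  induction k generalizing i with
  | zero =>
    obtain rfl : q = i := by omega
    exact ⟨.inr (begins_nat_zero.1 h), term_nat h⟩
  | succ k ih =>
    obtain ⟨h₁, h₂⟩ := begins_nat_succ.1 h
    rcases hq.eq_or_lt with rfl | hlt
    · exact ⟨.inl h₁, term_nat h⟩
    · have := ih h₂ (by omega) (by omega)
      rwa [show i + 1 + k + 1 = i + (k + 1) + 1 by omega] at this

namespace Core

variable {n : ℕ} {w : List Tok}

/-- The content model is written at position `o` of the string `w`. -/
def At (w : List Tok) : Core n → ℕ → Prop
  | leaf, o => w[o]? = some .eps ∨ w[o]? = some .nil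
  | sym a, o => w[o]? = some .sym ∧ Begins w (o + 1) (encodeNat a)
  | cat c d, o => (w[o]? = some .cat ∨ w[o]? = some .sharp ∨ w[o]? = some .cons) ∧
      c.At w (o + 1) ∧ d.At w (o + 1 + c.len)
  | alt c d, o => w[o]? = some .alt ∧ c.At w (o + 1) ∧ d.At w (o + 1 + c.len)
  | opt c, o => w[o]? = some .opt ∧ c.At w (o + 1)
  | star c, o => (w[o]? = some .star ∨ w[o]? = some .plus) ∧ c.At w (o + 1)

theorem At.term {c : Core n} {o : ℕ} (h : c.At w o) : Term w o (o + c.len) := by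
  induction c generalizing o with
  | leaf => rcases h with h | h <;> exact .zero h rfl
  | sym a =>
    refine .one h.1 rfl ?_
    have := term_nat h.2
    simp only [len]
    convert this using 1
    omega
  | cat c d ihc ihd =>
    obtain ⟨h₀, hc, hd⟩ := h
    have h₂ := ihd hd
    rw [show o + 1 + c.len + d.len = o + (cat c d).len by simp only [len]; omega] at h₂
    rcases h₀ with h₀ | h₀ | h₀ <;> exact .two h₀ rfl (ihc hc) h₂
  | alt c d ihc ihd =>
    obtain ⟨h₀, hc, hd⟩ := h
    have h₂ := ihd hd
    rw [show o + 1 + c.len + d.len = o + (alt c d).len by simp only [len]; omega] at h₂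
    exact .two h₀ rfl (ihc hc) h₂
  | opt c ih =>
    have := ih h.2
    rw [show o + 1 + c.len = o + (opt c).len by simp only [len]; omega] at this
    exact .one h.1 rfl this
  | star c ih =>
    have := ih h.2
    rw [show o + 1 + c.len = o + (star c).len by simp only [len]; omega] at this
    rcases h.1 with h₀ | h₀ <;> exact .one h₀ rfl this

/-- Terms are nested. -/
theorem At.term_le {c : Core n} {o s e : ℕ} (h : c.At w o) (hs : o ≤ s) (hs' : s < o + c.len)
    (ht : Term w s e) : e ≤ o + c.len := by
  induction c generalizing o with
  | leaf =>
    obtain rfl : s = o := by simp only [len] at hs'; omega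
    exact (ht.unique h.term).le
  | sym a =>
    rcases hs.eq_or_lt with rfl | hlt
    · exact (ht.unique h.term).le
    · simp only [len] at hs' ⊢
      have := (nat_token h.2 (q := s) (by omega) (by omega)).2
      rw [ht.unique this]; omega
  | cat c d ihc ihd | alt c d ihc ihd =>
    rcases hs.eq_or_lt with rfl | hlt
    · exact (ht.unique h.term).le
    · obtain ⟨-, hc, hd⟩ := h
      simp only [len] at hs' ⊢
      rcases Nat.lt_or_ge s (o + 1 + c.len) with h' | h'
      · have := ihc hc (by omega) h'; omega
      · have := ihd hd h' (by omega); omega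
  | opt c ih | star c ih =>
    rcases hs.eq_or_lt with rfl | hlt
    · exact (ht.unique h.term).le
    · simp only [len] at hs' ⊢
      have := ih h.2 (by omega) (by omega); omega

theorem At.occ_token {c : Core n} {o q : ℕ} {a : Fin n} (h : c.At w o) (hq : c.Occ o q a) :
    w[q]? = some .sym ∧ Begins w (q + 1) (encodeNat a) := by
  induction c generalizing o with
  | leaf => exact hq.elim
  | sym b =>
    obtain ⟨rfl, rfl⟩ := hq
    exact h
  | cat c d ihc ihd | alt c d ihc ihd =>
    obtain ⟨-, hc, hd⟩ := h
    rcases hq with hq | hq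
    · exact ihc hc hq
    · exact ihd hd hq
  | opt c ih | star c ih => exact ih (o := o + 1) h.2 hq

theorem At.exists_occ {c : Core n} {o q : ℕ} (h : c.At w o) (hq : o ≤ q) (hq' : q < o + c.len)
    (ht : w[q]? = some .sym) : ∃ a, c.Occ o q a := by
  induction c generalizing o with
  | leaf =>
    obtain rfl : q = o := by simp only [len] at hq'; omega
    rcases h with h | h <;> simp [ht] at h
  | sym a =>
    rcases hq.eq_or_lt with rfl | hlt
    · exact ⟨a, rfl, rfl⟩
    · simp only [len] at hq'
      have := (nat_token h.2 (q := q) (by omega) (by omega)).1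
      simp [ht] at this
  | cat c d ihc ihd =>
    obtain ⟨h₀, hc, hd⟩ := h
    rcases hq.eq_or_lt with rfl | hlt
    · simp [ht] at h₀
    · simp only [len] at hq'
      rcases Nat.lt_or_ge q (o + 1 + c.len) with h' | h'
      · obtain ⟨a, ha⟩ := ihc hc (by omega) h'; exact ⟨a, .inl ha⟩
      · obtain ⟨a, ha⟩ := ihd hd h' (by omega); exact ⟨a, .inr ha⟩
  | alt c d ihc ihd =>
    obtain ⟨h₀, hc, hd⟩ := h
    rcases hq.eq_or_lt with rfl | hlt
    · simp [ht] at h₀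
    · simp only [len] at hq'
      rcases Nat.lt_or_ge q (o + 1 + c.len) with h' | h'
      · obtain ⟨a, ha⟩ := ihc hc (by omega) h'; exact ⟨a, .inl ha⟩
      · obtain ⟨a, ha⟩ := ihd hd h' (by omega); exact ⟨a, .inr ha⟩
  | opt c ih =>
    rcases hq.eq_or_lt with rfl | hlt
    · have := h.1; simp [ht] at this
    · simp only [len] at hq'
      exact ih (o := o + 1) h.2 (by omega) (by omega)
  | star c ih =>
    rcases hq.eq_or_lt with rfl | hlt
    · have := h.1; simp [ht] at this
    · simp only [len] at hq'
      exact ih (o := o + 1) h.2 (by omega) (by omega)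

/-- Both positions are in the scope of a common star. -/
def InStar (w : List Tok) (o q q' : ℕ) : Prop :=
  ∃ s e, (w[s]? = some .star ∨ w[s]? = some .plus) ∧ o ≤ s ∧ Term w s e ∧ s < q ∧ s < q' ∧
    q < e ∧ q' < e

/-- The two positions are on the left and on the right side of an alternative. -/
def Split (w : List Tok) (o q q' : ℕ) : Prop :=
  ∃ s m e, w[s]? = some .alt ∧ o ≤ s ∧ Term w (s + 1) m ∧ Term w m e ∧ s < q ∧ q < m ∧ m ≤ q' ∧
    q' < e

theorem inStar_congr {o o' q q' : ℕ} (ho : o ≤ o') (h : ∀ s e, o ≤ s → s < o' →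
    (w[s]? = some .star ∨ w[s]? = some .plus) → Term w s e → q < e → q' < e → False) :
    InStar w o q q' ↔ InStar w o' q q' :=
  ⟨fun ⟨s, e, hs, h₁, h₂, h₃, h₄, h₅, h₆⟩ => ⟨s, e, hs,
    not_lt.1 fun hlt => h s e h₁ hlt hs h₂ h₅ h₆, h₂, h₃, h₄, h₅, h₆⟩,
    fun ⟨s, e, hs, h₁, h'⟩ => ⟨s, e, hs, ho.trans h₁, h'⟩⟩

theorem split_congr {o o' q q' : ℕ} (ho : o ≤ o') (h : ∀ s m e, o ≤ s → s < o' →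
    w[s]? = some .alt → Term w (s + 1) m → Term w m e → q < m → m ≤ q' → q' < e → False) :
    Split w o q q' ↔ Split w o' q q' :=
  ⟨fun ⟨s, m, e, hs, h₁, h₂, h₃, h₄, h₅, h₆, h₇⟩ => ⟨s, m, e, hs,
    not_lt.1 fun hlt => h s m e h₁ hlt hs h₂ h₃ h₅ h₆ h₇, h₂, h₃, h₄, h₅, h₆, h₇⟩,
    fun ⟨s, m, e, hs, h₁, h'⟩ => ⟨s, m, e, hs, ho.trans h₁, h'⟩⟩

/-- The order in which occurrences can be used, in terms of the string. -/
theorem At.seq_iff {c : Core n} {o q q' : ℕ} {a b : Fin n} (h : c.At w o) (hq : c.Occ o q a)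
    (hq' : c.Occ o q' b) : c.Seq o q q' ↔ InStar w o q q' ∨ q < q' ∧ ¬Split w o q q' := by
  induction c generalizing o with
  | leaf => exact hq.elim
  | sym x =>
    obtain ⟨rfl, -⟩ := hq
    obtain ⟨rfl, -⟩ := hq'
    refine ⟨fun h => h.elim, fun h => ?_⟩
    rcases h with ⟨s, e, -, h₁, -, h₂, -⟩ | ⟨h, -⟩ <;> omega
  | cat c d ihc ihd =>
    obtain ⟨h₀, hc, hd⟩ := h
    have hL : ∀ s e, o ≤ s → s < o + 1 + c.len → (w[s]? = some .star ∨ w[s]? = some .plus) →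
        Term w s e → e ≤ o + 1 + c.len := fun s e h₁ h₂ h₃ h₄ => by
      rcases h₁.eq_or_lt with rfl | h₁
      · rcases h₃ with h₃ | h₃ <;> simp [h₃] at h₀
      · exact hc.term_le h₁ h₂ h₄
    have hL' : ∀ s m e, o ≤ s → s < o + 1 + c.len → w[s]? = some .alt →
        Term w (s + 1) m → Term w m e → e ≤ o + 1 + c.len := fun s m e h₁ h₂ h₃ h₄ h₅ => by
      rcases h₁.eq_or_lt with rfl | h₁
      · simp [h₃] at h₀
      · exact hc.term_le h₁ h₂ (.two h₃ rfl h₄ h₅)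
    rcases hq with hq | hq <;> rcases hq' with hq' | hq' <;> have hr := hq.range <;>
      have hr' := hq'.range
    · rw [inStar_congr (o' := o + 1) (by omega), split_congr (o' := o + 1) (by omega),
        ← ihc hc hq hq']
      · refine ⟨fun h => ?_, .inl⟩
        rcases h with h | h | ⟨-, x, h⟩
        · exact h
        · obtain ⟨⟨x, hx⟩, -⟩ := h.occ; have := hx.range; omega
        · have := h.range; omega
      · intro s m e h₁ h₂ h₃ _ _ _ _ _
        obtain rfl : s = o := by omega
        simp [h₃] at h₀
      · intro s e h₁ h₂ h₃ _ _ _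
        obtain rfl : s = o := by omega
        rcases h₃ with h₃ | h₃ <;> simp [h₃] at h₀
    · refine ⟨fun _ => .inr ⟨by omega, ?_⟩, fun _ => .inr (.inr ⟨⟨_, hq⟩, ⟨_, hq'⟩⟩)⟩
      rintro ⟨s, m, e, h₁, h₂, h₃, h₄, h₅, h₆, h₇, h₈⟩
      have := hL' s m e h₂ (by omega) h₁ h₃ h₄
      omega
    · refine ⟨fun h => ?_, fun h => ?_⟩
      · rcases h with h | h | ⟨⟨x, h⟩, -⟩
        · obtain ⟨⟨x, hx⟩, -⟩ := h.occ; have := hx.range; omega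
        · obtain ⟨-, ⟨x, hx⟩⟩ := h.occ; have := hx.range; omega
        · have := h.range; omega
      · rcases h with ⟨s, e, h₁, h₂, h₃, h₄, h₅, h₆, h₇⟩ | ⟨h, -⟩
        · have := hL s e h₂ (by omega) h₁ h₃; omega
        · omega
    · rw [inStar_congr (o' := o + 1 + c.len) (by omega), split_congr (o' := o + 1 + c.len)
        (by omega), ← ihd hd hq hq']
      · refine ⟨fun h => ?_, fun h => .inr (.inl h)⟩
        rcases h with h | h | ⟨⟨x, h⟩, -⟩
        · obtain ⟨⟨x, hx⟩, -⟩ := h.occ; have := hx.range; omega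
        · exact h
        · have := h.range; omega
      · intro s m e h₁ h₂ h₃ h₄ h₅ _ _ _
        have := hL' s m e h₁ h₂ h₃ h₄ h₅
        omega
      · intro s e h₁ h₂ h₃ h₄ _ _
        have := hL s e h₁ h₂ h₃ h₄
        omega
  | alt c d ihc ihd =>
    obtain ⟨h₀, hc, hd⟩ := h
    have hL : ∀ s e, o ≤ s → s < o + 1 + c.len → (w[s]? = some .star ∨ w[s]? = some .plus) →
        Term w s e → e ≤ o + 1 + c.len := fun s e h₁ h₂ h₃ h₄ => by
      rcases h₁.eq_or_lt with rfl | h₁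
      · rcases h₃ with h₃ | h₃ <;> simp [h₃] at h₀
      · exact hc.term_le h₁ h₂ h₄
    have hL' : ∀ s m e, o ≤ s → s < o + 1 + c.len → w[s]? = some .alt →
        Term w (s + 1) m → Term w m e → m ≤ o + 1 + c.len := fun s m e h₁ h₂ h₃ h₄ h₅ => by
      rcases h₁.eq_or_lt with rfl | h₁
      · exact (h₄.unique hc.term).le
      · exact h₅.lt.le.trans (hc.term_le h₁ h₂ (.two h₃ rfl h₄ h₅))
    rcases hq with hq | hq <;> rcases hq' with hq' | hq' <;> have hr := hq.range <;>
      have hr' := hq'.range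
    · rw [inStar_congr (o' := o + 1) (by omega), split_congr (o' := o + 1) (by omega),
        ← ihc hc hq hq']
      · refine ⟨fun h => ?_, .inl⟩
        rcases h with h | h
        · exact h
        · obtain ⟨⟨x, hx⟩, -⟩ := h.occ; have := hx.range; omega
      · intro s m e h₁ h₂ h₃ h₄ h₅ _ _ _
        obtain rfl : s = o := by omega
        have := h₄.unique hc.term
        omega
      · intro s e h₁ h₂ h₃ _ _ _
        obtain rfl : s = o := by omega
        rcases h₃ with h₃ | h₃ <;> simp [h₃] at h₀
    · refine ⟨fun h => ?_, fun h => ?_⟩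
      · rcases h with h | h
        · obtain ⟨-, ⟨x, hx⟩⟩ := h.occ; have := hx.range; omega
        · obtain ⟨⟨x, hx⟩, -⟩ := h.occ; have := hx.range; omega
      · rcases h with ⟨s, e, h₁, h₂, h₃, h₄, h₅, h₆, h₇⟩ | ⟨-, h⟩
        · have := hL s e h₂ (by omega) h₁ h₃; omega
        · exact absurd ⟨o, _, _, h₀, le_rfl, hc.term, hd.term, by omega, hr.2, hr'.1, hr'.2⟩ h
    · refine ⟨fun h => ?_, fun h => ?_⟩
      · rcases h with h | h
        · obtain ⟨⟨x, hx⟩, -⟩ := h.occ; have := hx.range; omega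
        · obtain ⟨-, ⟨x, hx⟩⟩ := h.occ; have := hx.range; omega
      · rcases h with ⟨s, e, h₁, h₂, h₃, h₄, h₅, h₆, h₇⟩ | ⟨h, -⟩
        · have := hL s e h₂ (by omega) h₁ h₃; omega
        · omega
    · rw [inStar_congr (o' := o + 1 + c.len) (by omega), split_congr (o' := o + 1 + c.len)
        (by omega), ← ihd hd hq hq']
      · refine ⟨fun h => ?_, .inr⟩
        rcases h with h | h
        · obtain ⟨⟨x, hx⟩, -⟩ := h.occ; have := hx.range; omega
        · exact h
      · intro s m e h₁ h₂ h₃ h₄ h₅ _ _ _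
        have := hL' s m e h₁ h₂ h₃ h₄ h₅
        omega
      · intro s e h₁ h₂ h₃ h₄ _ _
        have := hL s e h₁ h₂ h₃ h₄
        omega
  | opt c ih =>
    rw [inStar_congr (o' := o + 1) (by omega), split_congr (o' := o + 1) (by omega),
      ← ih (o := o + 1) h.2 hq hq']
    · exact Iff.rfl
    · intro s m e h₁ h₂ h₃ _ _ _ _ _
      obtain rfl : s = o := by omega
      have := h.1
      simp [h₃] at this
    · intro s e h₁ h₂ h₃ _ _ _
      obtain rfl : s = o := by omega
      have := h.1
      rcases h₃ with h₃ | h₃ <;> simp [h₃] at this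
  | star c ih =>
    have hr := Occ.range (c := c) (o := o + 1) hq
    have hr' := Occ.range (c := c) (o := o + 1) hq'
    refine ⟨fun _ => .inl ⟨o, _, h.1, le_rfl, h.term, by omega, by omega, ?_, ?_⟩,
      fun _ => ⟨⟨_, hq⟩, ⟨_, hq'⟩⟩⟩ <;> simp only [len] <;> omega

end Core

mutual
/-- The core of a content model is found where the content model is written. -/
theorem Regex.at_core {n : ℕ} {w : List Tok} : ∀ (e : Regex (Fin n)) {o : ℕ},
    Begins w o e.encode → e.core.At w o
  | .eps, o, h => .inl (begins_cons.1 h).1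
  | .sym a, o, h => begins_cons.1 h
  | .cat e f, o, h => by
    obtain ⟨h₀, h⟩ := begins_cons.1 h
    obtain ⟨h₁, h₂⟩ := begins_append.1 h
    rw [← len_core] at h₂
    exact ⟨.inl h₀, at_core e h₁, at_core f h₂⟩
  | .alt e f, o, h => by
    obtain ⟨h₀, h⟩ := begins_cons.1 h
    obtain ⟨h₁, h₂⟩ := begins_append.1 h
    rw [← len_core] at h₂
    exact ⟨h₀, at_core e h₁, at_core f h₂⟩
  | .star e, o, h => by
    obtain ⟨h₀, h⟩ := begins_cons.1 h
    exact ⟨.inl h₀, at_core e h⟩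
  | .opt e, o, h => by
    obtain ⟨h₀, h⟩ := begins_cons.1 h
    exact ⟨h₀, at_core e h⟩
  | .plus e, o, h => by
    obtain ⟨h₀, h⟩ := begins_cons.1 h
    exact ⟨.inr h₀, at_core e h⟩
  | .sharp es fs, o, h => by
    obtain ⟨h₀, h⟩ := begins_cons.1 h
    obtain ⟨h₁, h₂⟩ := begins_append.1 h
    rw [← len_coreList] at h₂
    exact ⟨.inr (.inl h₀), at_coreList es h₁, at_coreList fs h₂⟩
theorem Regex.at_coreList {n : ℕ} {w : List Tok} : ∀ (es : List (Regex (Fin n))) {o : ℕ},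
    Begins w o (encodeList es) → (coreList es).At w o
  | [], o, h => .inr (begins_cons.1 h).1
  | e :: es, o, h => by
    obtain ⟨h₀, h⟩ := begins_cons.1 h
    obtain ⟨h₁, h₂⟩ := begins_append.1 h
    rw [← len_core] at h₂
    exact ⟨.inr (.inr h₀), at_core e h₁, at_coreList es h₂⟩
end

end XPathSat

namespace XPathSat

/-! ### The steps of an XPath expression -/

namespace XPath

variable {n : ℕ}

/-- The steps of an expression, placed where their axes stand in the encoding; at all other
positions nothing happens. -/
def steps : XPath (Fin n) → List (Option (Axis × Fin n))
  | atom χ l => some (χ, l) :: List.replicate (l + 1) none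
  | comp p q => none :: (p.steps ++ q.steps)

/-- The node `w'` is reached from `w` by the given steps. -/
def Path (T : Tree (Fin n)) : List (Option (Axis × Fin n)) → List ℕ → List ℕ → Prop
  | [], w, w' => w' = w
  | s :: ss, w, w' => ∃ v, Problem.Step T s w v ∧ Path T ss v w'

theorem path_append {T : Tree (Fin n)} {s s' : List (Option (Axis × Fin n))} {w w' : List ℕ} :
    Path T (s ++ s') w w' ↔ ∃ v, Path T s w v ∧ Path T s' v w' := by
  induction s generalizing w with
  | nil => simp [Path]
  | cons a s ih =>
    simp only [List.cons_append, Path, ih]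
    exact ⟨fun ⟨v, h, u, h', h''⟩ => ⟨u, ⟨v, h, h'⟩, h''⟩,
      fun ⟨u, ⟨v, h, h'⟩, h''⟩ => ⟨v, h, u, h', h''⟩⟩

theorem path_none {T : Tree (Fin n)} (k : ℕ) {w w' : List ℕ} :
    Path T (List.replicate k none) w w' ↔ w' = w := by
  induction k generalizing w with
  | zero => rfl
  | succ k ih => simp [List.replicate_succ, Path, Problem.Step, ih]

theorem holds_iff_path {T : Tree (Fin n)} (p : XPath (Fin n)) {w w' : List ℕ} :
    p.Holds T w w' ↔ Path T p.steps w w' := by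
  induction p generalizing w w' with
  | atom χ l => simp [steps, Path, path_none, Problem.Step]
  | comp p q ihp ihq => simp [steps, Path, path_append, Problem.Step, Holds, ihp, ihq]

theorem exists_path_iff {T : Tree (Fin n)} (s : List (Option (Axis × Fin n))) (w : List ℕ) :
    (∃ w', Path T s w w') ↔ ∃ W : ℕ → List ℕ, W 0 = w ∧
      ∀ t, Problem.Step T s[t]?.join (W t) (W (t + 1)) := by
  induction s generalizing w with
  | nil => exact ⟨fun _ => ⟨fun _ => w, rfl, fun t => rfl⟩, fun _ => ⟨w, rfl⟩⟩
  | cons a s ih =>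
    constructor
    · rintro ⟨w', v, ha, h⟩
      obtain ⟨W, rfl, hW⟩ := (ih v).1 ⟨w', h⟩
      refine ⟨fun t => Nat.casesOn t w W, rfl, fun t => ?_⟩
      cases t with
      | zero => exact ha
      | succ t => simpa using hW t
    · rintro ⟨W, rfl, hW⟩
      obtain ⟨w', h⟩ := (ih (W 1)).2 ⟨fun t => W (t + 1), rfl, fun t => by simpa using hW (t + 1)⟩
      exact ⟨w', W 1, by simpa using hW 0, h⟩

end XPath

theorem begins_append_left {x y : List Tok} {k : ℕ} (h : Begins x k y) (x' : List Tok) :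
    Begins (x ++ x') k y := by
  unfold Begins at *
  rw [List.drop_append]
  exact h.trans (List.prefix_append _ _)

theorem begins_append_right {x y : List Tok} {k : ℕ} (h : Begins x k y) (x' : List Tok) :
    Begins (x' ++ x) (x'.length + k) y := by
  unfold Begins at *
  rwa [List.drop_append, List.drop_eq_nil_of_le (by omega), List.nil_append, Nat.add_sub_cancel_left]

theorem begins_self (x : List Tok) : Begins x 0 x := List.prefix_refl _

mutual
theorem Regex.axis_notMem {n : ℕ} (χ : Axis) : ∀ e : Regex (Fin n), Tok.axis χ ∉ e.encode
  | .eps => by simp [encode]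
  | .sym a => by simp [encode, encodeNat]
  | .cat e f => by simp [encode, axis_notMem χ e, axis_notMem χ f]
  | .alt e f => by simp [encode, axis_notMem χ e, axis_notMem χ f]
  | .star e => by simp [encode, axis_notMem χ e]
  | .opt e => by simp [encode, axis_notMem χ e]
  | .plus e => by simp [encode, axis_notMem χ e]
  | .sharp es fs => by simp [encode, axis_notMemList χ es, axis_notMemList χ fs]
theorem Regex.axis_notMemList {n : ℕ} (χ : Axis) :
    ∀ es : List (Regex (Fin n)), Tok.axis χ ∉ encodeList es
  | [] => by simp [encodeList]
  | e :: es => by simp [encodeList, axis_notMem χ e, axis_notMemList χ es]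
end

/-- The axes in the string `x` are exactly the steps in the list `s`. -/
def Marks {n : ℕ} (x : List Tok) (s : List (Option (Axis × Fin n))) : Prop :=
  x.length = s.length ∧ ∀ k,
    (∀ (χ : Axis) (l : Fin n), s[k]? = some (some (χ, l)) → Begins x k (.axis χ :: encodeNat l)) ∧
      (s[k]? = some none → ∀ χ, x[k]? ≠ some (.axis χ))

theorem Marks.append {n : ℕ} {x x' : List Tok} {s s' : List (Option (Axis × Fin n))}
    (h : Marks x s) (h' : Marks x' s') : Marks (x ++ x') (s ++ s') := by
  refine ⟨by simp [h.1, h'.1], fun k => ?_⟩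
  rcases Nat.lt_or_ge k x.length with hk | hk
  · rw [List.getElem?_append_left hk, List.getElem?_append_left (h.1 ▸ hk)]
    exact ⟨fun χ l hs => begins_append_left ((h.2 k).1 χ l hs) _, (h.2 k).2⟩
  · obtain ⟨k, rfl⟩ := Nat.exists_eq_add_of_le hk
    rw [List.getElem?_append_right hk, List.getElem?_append_right (h.1 ▸ hk), ← h.1,
      Nat.add_sub_cancel_left]
    exact ⟨fun χ l hs => begins_append_right ((h'.2 k).1 χ l hs) _, (h'.2 k).2⟩

theorem marks_none {n : ℕ} {x : List Tok} (h : ∀ χ, Tok.axis χ ∉ x) {k : ℕ} (hk : k = x.length) :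
    Marks x (List.replicate k (none : Option (Axis × Fin n))) := by
  subst hk
  refine ⟨by simp, fun k => ⟨fun χ l hs => ?_, fun _ χ hx => h χ (List.mem_of_getElem? hx)⟩⟩
  have := List.mem_of_getElem? hs
  simp at this

theorem axis_notMem_nat (χ : Axis) (k : ℕ) : Tok.axis χ ∉ encodeNat k := by simp [encodeNat]

theorem XPath.marks {n : ℕ} (p : XPath (Fin n)) : Marks p.encode p.steps := by
  induction p with
  | atom χ l =>
    have h : Marks (encodeNat l) (List.replicate (l + 1) (none : Option (Axis × Fin n))) :=
      marks_none (fun χ => axis_notMem_nat χ l) (length_encodeNat l).symm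
    refine ⟨by simp [encode, steps, length_encodeNat], fun k => ?_⟩
    cases k with
    | zero =>
      refine ⟨fun χ' l' hs => ?_, fun hs => by simp [steps] at hs⟩
      simp only [steps, List.getElem?_cons_zero, Option.some.injEq, Prod.mk.injEq] at hs
      obtain ⟨rfl, rfl⟩ := hs
      exact begins_self _
    | succ k =>
      simp only [steps, encode, List.getElem?_cons_succ]
      refine ⟨fun χ' l' hs => ?_, (h.2 k).2⟩
      have := List.mem_of_getElem? hs
      simp at this
  | comp p q ihp ihq =>
    have h := (marks_none (n := n) (x := [.slash]) (k := 1) (by simp) rfl).append (ihp.append ihq)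
    simpa [encode, steps] using h

/-! ### The layout of an input -/

namespace Input

variable (I : Input)

/-- The encodings of the content models. -/
def contents : List (List Tok) := List.ofFn fun a => (I.dtd.content a).encode

/-- The position where the content model of a label begins; the content models are followed by the
XPath expression. -/
def off (k : ℕ) : ℕ := I.n + 1 + (I.dtd.root + 1) + (I.contents.take k).flatten.length

/-- The steps of the expression, preceded by idle steps for the part of the string that encodes the
DTD. -/
def steps : List (Option (Axis × Fin I.n)) := List.replicate (I.off I.n) none ++ I.expr.steps

/-- The problem in which the position of an axis in the string serves as the time of the step. -/
def problem : Problem I.n where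
  dtd := I.dtd
  off a := I.off a
  step t := I.steps[t]?.join

theorem length_contents : I.contents.length = I.n := by simp [contents]

theorem encode_eq : I.encode =
    encodeNat I.n ++ (encodeNat I.dtd.root ++ (I.contents.flatten ++ I.expr.encode)) := by
  simp [encode, DTD.encode, contents]

theorem off_zero : I.off 0 = I.n + 1 + (I.dtd.root + 1) := by simp [off]

theorem off_succ (a : Fin I.n) : I.off (a + 1) = I.off a + (I.dtd.content a).core.len := by
  simp [off, List.take_add_one, contents, Regex.len_core]
  omega

theorem off_mono {k l : ℕ} (h : k ≤ l) : I.off k ≤ I.off l := by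
  obtain ⟨m, rfl⟩ := Nat.exists_eq_add_of_le h
  simp [off, List.take_add]

theorem off_n : I.off I.n = I.n + 1 + (I.dtd.root + 1) + I.contents.flatten.length := by
  rw [off, List.take_of_length_le (by rw [length_contents])]

theorem begins_size : Begins I.encode 0 (encodeNat I.n) := by
  rw [encode_eq]
  exact begins_append_left (begins_self _) _

theorem begins_root : Begins I.encode (I.n + 1) (encodeNat I.dtd.root) := by
  rw [encode_eq]
  have := begins_append_right (begins_append_left (begins_self (encodeNat I.dtd.root))
    (I.contents.flatten ++ I.expr.encode)) (encodeNat I.n)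
  rwa [length_encodeNat] at this

theorem at_content (a : Fin I.n) : (I.dtd.content a).core.At I.encode (I.off a) := by
  refine Regex.at_core _ ?_
  have h : I.contents = I.contents.take a ++ (I.dtd.content a).encode :: I.contents.drop (a + 1) := by
    have h₁ : (a : ℕ) < I.contents.length := by rw [length_contents]; exact a.2
    have h₂ : (I.dtd.content a).encode = I.contents[(a : ℕ)] := by simp [contents]
    rw [h₂, ← List.drop_eq_getElem_cons h₁, List.take_append_drop]
  have h₃ : I.encode = (encodeNat I.n ++ encodeNat I.dtd.root ++ (I.contents.take a).flatten) ++
      ((I.dtd.content a).encode ++ ((I.contents.drop (a + 1)).flatten ++ I.expr.encode)) := by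
    rw [encode_eq]
    nth_rw 1 [h]
    simp
  have := begins_append_right (begins_append_left (begins_self (I.dtd.content a).encode)
    ((I.contents.drop (a + 1)).flatten ++ I.expr.encode))
    (encodeNat I.n ++ encodeNat I.dtd.root ++ (I.contents.take a).flatten)
  rw [← h₃] at this
  simpa [length_encodeNat, off, add_assoc] using this

theorem term_expr {n : ℕ} {w : List Tok} : ∀ (p : XPath (Fin n)) {o : ℕ}, Begins w o p.encode →
    Term w o (o + p.encode.length)
  | .atom χ l, o, h => by
    obtain ⟨h₀, h⟩ := begins_cons.1 h
    refine .one h₀ rfl ?_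
    have := term_nat h
    simp only [XPath.encode, List.length_cons, length_encodeNat]
    convert this using 1
    omega
  | .comp p q, o, h => by
    obtain ⟨h₀, h⟩ := begins_cons.1 h
    obtain ⟨h₁, h₂⟩ := begins_append.1 h
    refine .two h₀ rfl (term_expr p h₁) ?_
    have := term_expr q h₂
    simp only [XPath.encode, List.length_cons, List.length_append]
    convert this using 1
    omega

theorem length_encode : I.encode.length = I.off I.n + I.expr.encode.length := by
  rw [encode_eq, off_n]
  simp only [List.length_append, length_encodeNat]
  omega

theorem term_expr_off : Term I.encode (I.off I.n) I.encode.length := by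
  rw [length_encode]
  refine term_expr _ ?_
  have h : I.encode = (encodeNat I.n ++ encodeNat I.dtd.root ++ I.contents.flatten) ++
      I.expr.encode := by
    rw [encode_eq]; simp
  have := begins_append_right (begins_self I.expr.encode)
    (encodeNat I.n ++ encodeNat I.dtd.root ++ I.contents.flatten)
  rw [← h] at this
  simpa [length_encodeNat, off_n, add_assoc] using this

theorem off_lt {k : ℕ} (hk : k ≤ I.n) : I.off k < I.encode.length :=
  (I.off_mono hk).trans_lt I.term_expr_off.lt

theorem marks : Marks I.encode I.steps := by
  have h : I.encode = (encodeNat I.n ++ encodeNat I.dtd.root ++ I.contents.flatten) ++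
      I.expr.encode := by
    rw [encode_eq]; simp
  rw [h]
  refine Marks.append (marks_none (fun χ => ?_) ?_) I.expr.marks
  · simp only [List.mem_append, List.mem_flatten, not_or, not_exists, not_and]
    refine ⟨⟨axis_notMem_nat _ _, axis_notMem_nat _ _⟩, fun x hx => ?_⟩
    obtain ⟨a, rfl⟩ := (List.mem_ofFn' _ _).1 hx
    exact Regex.axis_notMem χ _
  · simp only [off_n, List.length_append, length_encodeNat]

theorem step_eq {t : ℕ} {χ : Axis} {l : Fin I.n} (h : I.problem.step t = some (χ, l)) :
    I.encode[t]? = some (.axis χ) ∧ Begins I.encode (t + 1) (encodeNat l) :=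
  begins_cons.1 ((I.marks.2 t).1 χ l (Option.join_eq_some_iff.1 h))

theorem step_of_axis {t : ℕ} {χ : Axis} (h : I.encode[t]? = some (.axis χ)) :
    ∃ l, I.problem.step t = some (χ, l) := by
  have ht : t < I.steps.length := by
    rw [← I.marks.1]
    exact (List.getElem?_eq_some_iff.1 h).1
  rcases hs : I.steps[t] with _ | ⟨χ', l⟩
  · exact absurd h ((I.marks.2 t).2 (by rw [List.getElem?_eq_getElem ht, hs]) χ)
  · have hst : I.problem.step t = some (χ', l) := by
      simp [problem, List.getElem?_eq_getElem ht, hs]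
    obtain ⟨h', -⟩ := I.step_eq hst
    rw [h] at h'
    cases h'
    exact ⟨l, hst⟩

theorem step_eq_none {t : ℕ} (ht : I.encode.length ≤ t) : I.problem.step t = none := by
  rw [I.marks.1] at ht
  simp [problem, List.getElem?_eq_none ht]

theorem occ_label_unique {a a' b b' : Fin I.n} {q : ℕ} (h : I.problem.Occ a q b)
    (h' : I.problem.Occ a' q b') : a = a' := by
  have h₁ := Core.Occ.range h
  have h₂ := Core.Occ.range h'
  simp only [problem] at h₁ h₂
  rw [← off_succ] at h₁ h₂
  by_contra hne
  rcases Nat.lt_or_gt_of_ne (Fin.val_ne_of_ne hne) with hlt | hlt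
  · have := I.off_mono (show (a : ℕ) + 1 ≤ a' from hlt); omega
  · have := I.off_mono (show (a' : ℕ) + 1 ≤ a from hlt); omega

/-- Satisfiability is expressed by the criterion for walks. -/
theorem satisfiable_iff : I.expr.Satisfiable I.dtd ↔ I.problem.Good := by
  rw [← Problem.exists_walks_iff I.mrw I.noUseless fun t => I.step_eq_none (t := t)]
  refine exists_congr fun T => and_congr_right fun _ => ?_
  obtain ⟨m, hm⟩ : ∃ m, I.off I.n = m + 1 := ⟨I.n + 1 + I.dtd.root +
    (I.contents.take I.n).flatten.length, by unfold off; omega⟩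
  have h : ∀ t, I.problem.step (t + 1) =
      (List.replicate m none ++ I.expr.steps)[t]?.join := fun t => by
    simp [problem, steps, hm, List.replicate_succ]
  have h' := XPath.exists_path_iff (T := T) (List.replicate m none ++ I.expr.steps) []
  simp only [← h] at h'
  refine Iff.trans ?_ h'
  simp only [XPath.path_append, XPath.path_none, exists_eq_left, XPath.Satisfies,
    XPath.holds_iff_path]

end Input

end XPathSat

namespace XPathSat

open Cmd

namespace Problem

variable {n : ℕ} {P : Problem n}

/-- At time `s` the current node is the parent of the current node at time `t`. -/
inductive Par (P : Problem n) : ℕ → ℕ → Prop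
  | child {t l} : P.step (t + 1) = some (.child, l) → Par P (t + 1) t
  | stay {t s} : P.step (t + 1) = none → Par P t s → Par P (t + 1) s
  | sibling {t s χ l} : P.step (t + 1) = some (χ, l) → (χ = .following ∨ χ = .preceding) →
      Par P t s → Par P (t + 1) s
  | parent {t m s l} : P.step (t + 1) = some (.parent, l) → Par P t m → Par P m s → Par P (t + 1) s

theorem Par.stack {t s : ℕ} (h : P.Par t s) : P.stack s = (P.stack t).tail ∧ s < t := by
  induction h with
  | child h => exact ⟨by rw [stack_child h]; rfl, by omega⟩
  | stay h _ ih => exact ⟨by rw [stack_none h, ih.1], by omega⟩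
  | sibling h hχ _ ih => exact ⟨by rw [stack_sibling h hχ, ih.1]; rfl, by omega⟩
  | parent h _ _ ih₁ ih₂ => exact ⟨by rw [stack_parent h, ih₂.1, ih₁.1], by omega⟩

theorem exists_par {t : ℕ} (h : (P.stack t).tail ≠ []) : ∃ s, P.Par t s := by
  induction t using Nat.strong_induction_on with
  | _ t ih =>
    cases t with
    | zero => simp [Problem.stack] at h
    | succ t =>
      rcases hs : P.step (t + 1) with _ | ⟨_ | _ | _ | _, l⟩
      · rw [stack_none hs] at h
        obtain ⟨s, hs'⟩ := ih t (by omega) h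
        exact ⟨s, .stay hs hs'⟩
      · exact ⟨t, .child hs⟩
      · rw [stack_parent hs] at h
        obtain ⟨m, hm⟩ := ih t (by omega) fun h' => h (by rw [h']; rfl)
        rw [← hm.stack.1] at h
        obtain ⟨s, hs'⟩ := ih m (by have := hm.stack.2; omega) h
        exact ⟨s, .parent hs hm hs'⟩
      · rw [stack_sibling hs (.inl rfl)] at h
        obtain ⟨s, hs'⟩ := ih t (by omega) h
        exact ⟨s, .sibling hs (.inl rfl) hs'⟩
      · rw [stack_sibling hs (.inr rfl)] at h
        obtain ⟨s, hs'⟩ := ih t (by omega) h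
        exact ⟨s, .sibling hs (.inr rfl) hs'⟩

theorem exists_par_of_getElem? {t k d : ℕ} (h : (P.stack t)[k + 1]? = some d) :
    ∃ s, P.Par t s ∧ (P.stack s)[k]? = some d := by
  obtain ⟨s, hs⟩ := exists_par (P := P) (t := t) fun h' => by
    rw [← List.getElem?_tail, h'] at h
    simp at h
  exact ⟨s, hs, by rw [hs.stack.1, List.getElem?_tail, h]⟩

theorem Par.getElem? {t s k d : ℕ} (h : P.Par t s) (hd : (P.stack s)[k]? = some d) :
    (P.stack t)[k + 1]? = some d := by
  rwa [h.stack.1, List.getElem?_tail] at hd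

end Problem

/-! ### The relations computed by the decision procedure -/

/-- The tables of the decision procedure. -/
inductive Rel : Type where
  | le | suc | term | nat | content | label | occ | seq | par | cur | up | cand | pos | same
  deriving DecidableEq

/-- The order in which the tables are filled: the definition of each one uses only itself and tables
of lower level. -/
def Rel.level : Rel → ℕ
  | le => 0
  | suc => 1
  | term => 2
  | nat => 3
  | content => 4
  | label => 5
  | occ => 6
  | seq => 7
  | par => 8
  | cur => 9
  | up => 10
  | cand => 11
  | pos => 12
  | same => 13

theorem Rel.level_injective : Function.Injective Rel.level := by
  intro r r' h
  cases r <;> cases r' <;> first | rfl | exact absurd h (by decide)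

instance : Finite Rel :=
  Finite.of_injective (β := Fin 14) (fun r => ⟨r.level, by cases r <;> decide⟩) fun r r' h =>
    Rel.level_injective (Fin.mk.inj h)

/-- The meaning of the tables: order, successor, extent of a term, value of a number in unary,
beginning of a content model, label of a step or an occurrence, occurrences in a content model,
order of occurrences, and the notions of `Problem`; `cur` and `up` are the current node and its
parent. -/
def Input.rel (I : Input) : Rel → ℕ → ℕ → Prop
  | .le, x, y => x ≤ y
  | .suc, x, y => y = x + 1
  | .term, x, y => Term I.encode x y
  | .nat, x, v => Begins I.encode x (encodeNat v)
  | .content, v, x => v ≤ I.n ∧ x = I.off v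
  | .label, t, v => t = 0 ∧ v = I.dtd.root ∨
      (I.encode[t]? = some .sym ∨ ∃ χ, I.encode[t]? = some (.axis χ)) ∧
        Begins I.encode (t + 1) (encodeNat v)
  | .occ, v, q => ∃ a : Fin I.n, v = a ∧ ∃ b, I.problem.Occ a q b
  | .seq, q, q' => ∃ a, I.problem.Seq a q q'
  | .par, t, s => I.problem.Par t s
  | .cur, t, c => (I.problem.stack t)[0]? = some c
  | .up, t, c => (I.problem.stack t)[1]? = some c
  | .cand, c, q => I.problem.Entry c ∧ I.problem.Cand c q
  | .pos, c, q => I.problem.Pos c q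
  | .same, c, d => I.problem.Same c d

/-- The tables below a given level have been filled, and the others are empty. -/
def Input.Filled (I : Input) (m : ℕ) (τ : Tabs Rel) : Prop :=
  ∀ r x y, τ r x y = true ↔ r.level < m ∧ x < I.encode.length ∧ y < I.encode.length ∧ I.rel r x y

/-- The tables below a given level have been filled. -/
def Input.Known (I : Input) (m : ℕ) (τ : Tabs Rel) : Prop :=
  ∀ r, r.level < m → ∀ x y, τ r x y = true ↔
    x < I.encode.length ∧ y < I.encode.length ∧ I.rel r x y

/-- The assignment of `x` and `y` to the variables `1` and `2`, which are the arguments in a query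
that defines a table. -/
def env (x y : ℕ) : Fin 12 → ℕ := Function.update (Function.update (fun _ => 0) 1 x) 2 y

/-- The formula `φ`, which depends only on the variables `1` and `2`, defines the table `r` as a
least fixed point over the tables of lower level. -/
structure Input.Defines (I : Input) (r : Rel) (φ : Cmd (Fin 12) Rel) : Prop where
  pure : φ.Pure
  env : ∀ ρ τ x y, Sat I.encode φ (Function.update (Function.update ρ 1 x) 2 y) τ ↔
    Sat I.encode φ (env x y) τ
  sound : ∀ τ, I.Known r.level τ →
    (∀ x y, τ r x y = true → x < I.encode.length ∧ y < I.encode.length ∧ I.rel r x y) →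
    ∀ x < I.encode.length, ∀ y < I.encode.length, Sat I.encode φ (XPathSat.env x y) τ → I.rel r x y
  complete : ∀ τ, I.Known r.level τ →
    (∀ x < I.encode.length, ∀ y < I.encode.length, Sat I.encode φ (XPathSat.env x y) τ →
      τ r x y = true) →
    ∀ x < I.encode.length, ∀ y < I.encode.length, I.rel r x y → τ r x y = true

namespace Input

variable {I : Input}

theorem Defines.of_iff {r : Rel} {φ : Cmd (Fin 12) Rel} (hp : φ.Pure)
    (he : ∀ ρ τ x y, Sat I.encode φ (Function.update (Function.update ρ 1 x) 2 y) τ ↔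
      Sat I.encode φ (XPathSat.env x y) τ)
    (h : ∀ τ, I.Known r.level τ → ∀ x < I.encode.length, ∀ y < I.encode.length,
      (Sat I.encode φ (XPathSat.env x y) τ ↔ I.rel r x y)) : I.Defines r φ :=
  ⟨hp, he, fun τ hk _ x hx y hy => (h τ hk x hx y hy).1,
    fun τ hk hc x hx y hy hr => hc x hx y hy ((h τ hk x hx y hy).2 hr)⟩

/-- One stage of the decision procedure. -/
theorem Defines.fill {r : Rel} {φ : Cmd (Fin 12) Rel} (h : I.Defines r φ) {ρ : Fin 12 → ℕ}
    (hρ : ρ 0 = 0) {τ : Tabs Rel} (hτ : I.Filled r.level τ) :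
    ∃ τ', run I.encode (fix r 10 11 1 2 φ) ρ τ = (false, τ') ∧ I.Filled (r.level + 1) τ' := by
  have hk : ∀ τ' : Tabs Rel, (∀ r' ≠ r, τ' r' = τ r') → I.Known r.level τ' :=
    fun τ' h' r' hr x y => by
      rw [h' r' (by rintro rfl; exact lt_irrefl _ hr), hτ r' x y, and_iff_right hr]
  obtain ⟨τ', h₁, h₂, h₃⟩ := run_fix_spec (w := I.encode) (r := r) (z := 0) (a := 10) (b := 11)
    (i := 1) (j := 2) h.pure (P := fun τ x y => Sat I.encode φ (XPathSat.env x y) τ)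
    (by decide) (by decide) (by decide) (fun ρ τ x y _ _ _ => h.env ρ τ x y) hρ τ
    (fun x y => by rw [Bool.eq_false_iff, ne_eq, hτ]; omega) (I.rel r)
    (fun τ' h' => h.sound τ' (hk τ' h')) fun τ' h' => h.complete τ' (hk τ' h')
  refine ⟨τ', h₁, fun r' x y => ?_⟩
  by_cases hr : r' = r
  · subst hr
    rw [h₃]
    simp
  · rw [h₂ r' hr, hτ]
    have : r'.level ≠ r.level := fun h => hr (Rel.level_injective h)
    rw [show r'.level < r.level + 1 ↔ r'.level < r.level by omega]

/-! ### Facts about positions and labels -/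

theorem lt_length_of_step {t : ℕ} {s : Axis × Fin I.n} (h : I.problem.step t = some s) :
    t < I.encode.length := by
  by_contra ht
  rw [I.step_eq_none (by omega)] at h
  simp at h

variable (I) in
theorem token_zero : I.encode[0]? = some .tick ∨ I.encode[0]? = some .done :=
  (nat_token I.begins_size le_rfl (by omega)).1

theorem step_zero : I.problem.step 0 = none := by
  rcases h : I.problem.step 0 with _ | ⟨χ, l⟩
  · rfl
  · have h₁ := (I.step_eq h).1
    rcases I.token_zero with h₂ | h₂ <;> simp [h₂] at h₁

/-- Test whether a symbol is an axis with a given property. -/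
def isStep (f : Axis → Bool) : Tok → Bool
  | .axis χ => f χ
  | _ => false

theorem isStep_iff {f : Axis → Bool} {t : ℕ} :
    (∃ a, I.encode[t]? = some a ∧ isStep f a = true) ↔
      ∃ χ l, I.problem.step t = some (χ, l) ∧ f χ = true := by
  constructor
  · rintro ⟨a, h, hf⟩
    cases a <;> simp [isStep] at hf
    obtain ⟨l, hl⟩ := I.step_of_axis h
    exact ⟨_, l, hl, hf⟩
  · rintro ⟨χ, l, h, hf⟩
    exact ⟨_, (I.step_eq h).1, hf⟩

/-- Test for the child axis. -/
def isChild : Axis → Bool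
  | .child => true
  | _ => false

/-- Test for the parent axis. -/
def isParent : Axis → Bool
  | .parent => true
  | _ => false

/-- Test for the following-sibling axis. -/
def isFollowing : Axis → Bool
  | .following => true
  | _ => false

/-- Test for the preceding-sibling axis. -/
def isPreceding : Axis → Bool
  | .preceding => true
  | _ => false

theorem isChild_iff {t : ℕ} : (∃ a, I.encode[t]? = some a ∧ isStep isChild a = true) ↔
    ∃ l, I.problem.step t = some (.child, l) := by
  rw [isStep_iff]
  exact ⟨fun ⟨χ, l, h, hf⟩ => by cases χ <;> simp [isChild] at hf; exact ⟨l, h⟩,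
    fun ⟨l, h⟩ => ⟨_, l, h, rfl⟩⟩

theorem isParent_iff {t : ℕ} : (∃ a, I.encode[t]? = some a ∧ isStep isParent a = true) ↔
    ∃ l, I.problem.step t = some (.parent, l) := by
  rw [isStep_iff]
  exact ⟨fun ⟨χ, l, h, hf⟩ => by cases χ <;> simp [isParent] at hf; exact ⟨l, h⟩,
    fun ⟨l, h⟩ => ⟨_, l, h, rfl⟩⟩

theorem isFollowing_iff {t : ℕ} : (∃ a, I.encode[t]? = some a ∧ isStep isFollowing a = true) ↔
    ∃ l, I.problem.step t = some (.following, l) := by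
  rw [isStep_iff]
  exact ⟨fun ⟨χ, l, h, hf⟩ => by cases χ <;> simp [isFollowing] at hf; exact ⟨l, h⟩,
    fun ⟨l, h⟩ => ⟨_, l, h, rfl⟩⟩

theorem isPreceding_iff {t : ℕ} : (∃ a, I.encode[t]? = some a ∧ isStep isPreceding a = true) ↔
    ∃ l, I.problem.step t = some (.preceding, l) := by
  rw [isStep_iff]
  exact ⟨fun ⟨χ, l, h, hf⟩ => by cases χ <;> simp [isPreceding] at hf; exact ⟨l, h⟩,
    fun ⟨l, h⟩ => ⟨_, l, h, rfl⟩⟩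

theorem isEntry_iff {t : ℕ} :
    (∃ a, I.encode[t]? = some a ∧ isStep (fun χ => !isParent χ) a = true) ↔
      I.problem.Entry t := by
  rw [isStep_iff]
  constructor
  · rintro ⟨χ, l, h, hf⟩
    refine ⟨fun h0 => ?_, χ, l, h, by rintro rfl; simp [isParent] at hf⟩
    rw [h0, step_zero] at h
    simp at h
  · rintro ⟨-, χ, l, h, hf⟩
    refine ⟨χ, l, h, ?_⟩
    cases χ <;> simp [isParent] at hf ⊢

theorem isSome_iff {t : ℕ} :
    (∃ a, I.encode[t]? = some a ∧ isStep (fun _ => true) a = true) ↔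
      I.problem.step t ≠ none := by
  rw [isStep_iff, Option.ne_none_iff_exists']
  exact ⟨fun ⟨χ, l, h, _⟩ => ⟨(χ, l), h⟩, fun ⟨x, h⟩ => ⟨x.1, x.2, h, rfl⟩⟩

theorem n_lt_off : I.n + 1 < I.off 0 := by rw [off_zero]; omega

theorem label_lt (a : Fin I.n) : (a : ℕ) < I.encode.length := by
  have := a.2
  have := I.n_lt_off
  have := I.off_lt (Nat.zero_le I.n)
  omega

theorem occ_lt {a b : Fin I.n} {q : ℕ} (h : I.problem.Occ a q b) :
    I.off a ≤ q ∧ q < I.off (a + 1) ∧ q < I.encode.length := by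
  have h₁ := Core.Occ.range h
  have h₂ := I.off_lt (k := a + 1) a.2
  rw [off_succ] at *
  exact ⟨h₁.1, h₁.2, h₁.2.trans h₂⟩

theorem occ_token {a b : Fin I.n} {q : ℕ} (h : I.problem.Occ a q b) :
    I.encode[q]? = some .sym ∧ Begins I.encode (q + 1) (encodeNat b) :=
  (I.at_content a).occ_token h

theorem label_of_occ {a b : Fin I.n} {q v : ℕ} (h : I.problem.Occ a q b) :
    I.rel .label q v ↔ v = b := by
  obtain ⟨h₁, h₂⟩ := occ_token h
  have h₃ := (occ_lt h).1
  have h₄ := I.n_lt_off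
  have h₅ := I.off_mono (Nat.zero_le a)
  constructor
  · rintro (⟨rfl, -⟩ | ⟨-, h'⟩)
    · omega
    · exact begins_nat_unique h' h₂
  · rintro rfl
    exact .inr ⟨.inl h₁, h₂⟩

theorem label_of_entry {c v : ℕ} (h : c = 0 ∨ ∃ χ l, I.problem.step c = some (χ, l)) :
    I.rel .label c v ↔ v = I.problem.lab c := by
  by_cases hc : c = 0
  · subst hc
    constructor
    · rintro (⟨-, rfl⟩ | ⟨h', -⟩)
      · simp [Problem.lab, problem]
      · rcases I.token_zero with h₂ | h₂ <;> simp [h₂] at h'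
    · rintro rfl
      exact .inl ⟨rfl, by simp [Problem.lab, problem]⟩
  · obtain ⟨χ, l, hs⟩ := h.resolve_left hc
    obtain ⟨h₁, h₂⟩ := I.step_eq hs
    obtain ⟨t, rfl⟩ := Nat.exists_eq_succ_of_ne_zero hc
    rw [Problem.lab_succ hs]
    constructor
    · rintro (⟨h', -⟩ | ⟨-, h'⟩)
      · omega
      · exact begins_nat_unique h' h₂
    · rintro rfl
      exact .inr ⟨.inr ⟨_, h₁⟩, h₂⟩

theorem entry_step {c : ℕ} (h : I.problem.Entry c) :
    ∃ χ l, I.problem.step c = some (χ, l) := by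
  obtain ⟨-, χ, l, h, -⟩ := h
  exact ⟨χ, l, h⟩

theorem entry_lt {c : ℕ} (h : I.problem.Entry c) : c < I.encode.length := by
  obtain ⟨χ, l, h⟩ := entry_step h
  exact lt_length_of_step h

theorem label_of_parent {c d v : ℕ} (h : (I.problem.stack c)[1]? = some d) :
    I.rel .label d v ↔ v = I.problem.lab d :=
  label_of_entry ((Problem.entry_of_mem_stack (Problem.parent_mem h)).imp_right entry_step)

theorem cand_lt {c q : ℕ} (h : I.problem.Cand c q) : q < I.encode.length := by
  obtain ⟨d, -, h⟩ := h
  exact (occ_lt h).2.2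

theorem link_iff_left {c p q : ℕ} (h : I.problem.Cand c p) :
    I.problem.Link c p q ↔ I.rel .seq p q := by
  obtain ⟨d, hd, h⟩ := h
  rw [Problem.link_iff hd]
  constructor
  · exact fun h' => ⟨_, h'⟩
  · rintro ⟨a, ha⟩
    obtain ⟨⟨x, hx⟩, -⟩ := Core.Seq.occ ha
    obtain rfl := occ_label_unique I hx h
    exact ha

theorem link_iff_right {c p q : ℕ} (h : I.problem.Cand c q) :
    I.problem.Link c p q ↔ I.rel .seq p q := by
  obtain ⟨d, hd, h⟩ := h
  rw [Problem.link_iff hd]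
  constructor
  · exact fun h' => ⟨_, h'⟩
  · rintro ⟨a, ha⟩
    obtain ⟨-, ⟨x, hx⟩⟩ := Core.Seq.occ ha
    obtain rfl := occ_label_unique I hx h
    exact ha

end Input

end XPathSat

namespace XPathSat

open Cmd

namespace Input

variable {I : Input}

/-! ### Queries for the structure of the string -/

/-- The position is the first one. -/
def zeroQ (i : Fin 12) : Cmd (Fin 12) Rel := not (ex 9 (get .suc 9 i))

/-- One position is before another. -/
def ltQ (i j : Fin 12) : Cmd (Fin 12) Rel := not (get .le j i)

/-- Position `2` is the successor of position `1`. -/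
def sucQ : Cmd (Fin 12) Rel := and (ltQ 1 2) (not (ex 3 (and (ltQ 1 3) (ltQ 3 2))))

theorem defines_suc : I.Defines .suc sucQ := by
  refine .of_iff (by simp [sucQ, ltQ, Cmd.Pure]) (fun _ _ _ _ => Iff.rfl) fun τ hk x hx y hy => ?_
  have h : Sat I.encode sucQ (env x y) τ ↔ ¬τ .le y x = true ∧
    ¬∃ k < I.encode.length, ¬τ .le k x = true ∧ ¬τ .le y k = true := Iff.rfl
  simp only [h, hk .le (by decide), rel]
  constructor
  · rintro ⟨h₁, h₂⟩
    by_contra hne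
    exact h₂ ⟨x + 1, by omega, by omega, by omega⟩
  · rintro rfl
    exact ⟨by omega, fun ⟨k, hk, h₁, h₂⟩ => by omega⟩

theorem sat_zero {m : ℕ} {τ : Tabs Rel} (hk : I.Known m τ) (hm : 1 < m) {x : ℕ}
    (hx : x < I.encode.length) : (¬∃ k < I.encode.length, τ .suc k x = true) ↔ x = 0 := by
  simp only [hk .suc hm, rel]
  constructor
  · intro h
    by_contra hne
    exact h ⟨x - 1, by omega, by omega, hx, by omega⟩
  · rintro rfl ⟨k, -, -, -, h⟩
    omega

/-- A term begins at position `1` and ends before position `2`. -/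
def termQ : Cmd (Fin 12) Rel :=
  or (and (tok 1 fun a => arity a == 0) (get .suc 1 2)) (ex 3 (and (get .suc 1 3) (or
    (and (tok 1 fun a => arity a == 1) (get .term 3 2))
    (and (tok 1 fun a => arity a == 2) (ex 4 (and (get .term 3 4) (get .term 4 2)))))))

theorem defines_term : I.Defines .term termQ := by
  have h : ∀ x y τ, Sat I.encode termQ (env x y) τ ↔
      ((∃ a, I.encode[x]? = some a ∧ (arity a == 0) = true) ∧ τ .suc x y = true) ∨
      ∃ k < I.encode.length, τ .suc x k = true ∧
        ((∃ a, I.encode[x]? = some a ∧ (arity a == 1) = true) ∧ τ .term k y = true ∨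
        (∃ a, I.encode[x]? = some a ∧ (arity a == 2) = true) ∧
          ∃ l < I.encode.length, τ .term k l = true ∧ τ .term l y = true) :=
    fun _ _ _ => Iff.rfl
  refine ⟨by simp [termQ, Cmd.Pure], fun _ _ _ _ => Iff.rfl, fun τ hk hr x hx y hy hs => ?_,
    fun τ hk hc x hx y hy ht => ?_⟩
  · simp only [h, hk .suc (by decide), rel, beq_iff_eq] at hs
    rcases hs with ⟨⟨a, ha, h0⟩, -, -, rfl⟩ | ⟨k, -, ⟨-, -, rfl⟩, ⟨⟨a, ha, h1⟩, ht⟩ |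
      ⟨⟨a, ha, h2⟩, l, -, ht, ht'⟩⟩
    · exact .zero ha h0
    · exact .one ha h1 (hr _ _ ht).2.2
    · exact .two ha h2 (hr _ _ ht).2.2 (hr _ _ ht').2.2
  · simp only [h, hk .suc (by decide), rel, beq_iff_eq] at hc
    simp only [rel] at ht
    induction ht with
    | zero ha h0 => exact hc _ hx _ hy (.inl ⟨⟨_, ha, h0⟩, hx, hy, rfl⟩)
    | one ha h1 ht ih =>
      have := ht.lt
      exact hc _ hx _ hy (.inr ⟨_, by omega, ⟨hx, by omega, rfl⟩,
        .inl ⟨⟨_, ha, h1⟩, ih (by omega) hy⟩⟩)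
    | two ha h2 ht ht' ih ih' =>
      have := ht.lt
      have := ht'.lt
      exact hc _ hx _ hy (.inr ⟨_, by omega, ⟨hx, by omega, rfl⟩,
        .inr ⟨⟨_, ha, h2⟩, _, by omega, ih (by omega) (by omega), ih' (by omega) hy⟩⟩)

/-- Test for the end marker of numbers. -/
def isDone : Tok → Bool
  | .done => true
  | _ => false

/-- Test for the unary digit. -/
def isTickTok : Tok → Bool
  | .tick => true
  | _ => false

/-- Test for a symbol of a content model. -/
def isSym : Tok → Bool
  | .sym => true
  | _ => false

/-- Test for an alternative. -/
def isAlt : Tok → Bool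
  | .alt => true
  | _ => false

/-- Test for `*` or `+`. -/
def isStar : Tok → Bool
  | .star | .plus => true
  | _ => false

/-- Test for the tokens that are followed by a label. -/
def isLabelled : Tok → Bool
  | .sym | .axis _ => true
  | _ => false

theorem isDone_iff {w : List Tok} {x : ℕ} :
    (∃ a, w[x]? = some a ∧ isDone a = true) ↔ w[x]? = some .done :=
  ⟨fun ⟨a, h, ha⟩ => by cases a <;> simp [isDone] at ha; exact h, fun h => ⟨_, h, rfl⟩⟩

theorem isTickTok_iff {w : List Tok} {x : ℕ} :
    (∃ a, w[x]? = some a ∧ isTickTok a = true) ↔ w[x]? = some .tick :=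
  ⟨fun ⟨a, h, ha⟩ => by cases a <;> simp [isTickTok] at ha; exact h, fun h => ⟨_, h, rfl⟩⟩

theorem isSym_iff {w : List Tok} {x : ℕ} :
    (∃ a, w[x]? = some a ∧ isSym a = true) ↔ w[x]? = some .sym :=
  ⟨fun ⟨a, h, ha⟩ => by cases a <;> simp [isSym] at ha; exact h, fun h => ⟨_, h, rfl⟩⟩

theorem isAlt_iff {w : List Tok} {x : ℕ} :
    (∃ a, w[x]? = some a ∧ isAlt a = true) ↔ w[x]? = some .alt :=
  ⟨fun ⟨a, h, ha⟩ => by cases a <;> simp [isAlt] at ha; exact h, fun h => ⟨_, h, rfl⟩⟩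

theorem isStar_iff {w : List Tok} {x : ℕ} :
    (∃ a, w[x]? = some a ∧ isStar a = true) ↔ w[x]? = some .star ∨ w[x]? = some .plus :=
  ⟨fun ⟨a, h, ha⟩ => by cases a <;> simp [isStar] at ha <;> simp [h],
    fun h => by rcases h with h | h <;> exact ⟨_, h, rfl⟩⟩

theorem isLabelled_iff {w : List Tok} {x : ℕ} :
    (∃ a, w[x]? = some a ∧ isLabelled a = true) ↔
      w[x]? = some .sym ∨ ∃ χ, w[x]? = some (.axis χ) :=
  ⟨fun ⟨a, h, ha⟩ => by cases a <;> simp [isLabelled] at ha <;> simp [h],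
    fun h => by rcases h with h | ⟨χ, h⟩ <;> exact ⟨_, h, rfl⟩⟩

/-- The number `2` is written in unary at position `1`; numbers are represented by positions. -/
def natQ : Cmd (Fin 12) Rel :=
  or (and (tok 1 isDone) (zeroQ 2))
    (and (tok 1 isTickTok) (ex 3 (and (get .suc 1 3) (ex 4 (and (get .suc 4 2) (get .nat 3 4))))))

theorem defines_nat : I.Defines .nat natQ := by
  have h : ∀ x y τ, Sat I.encode natQ (env x y) τ ↔
      (∃ a, I.encode[x]? = some a ∧ isDone a = true) ∧
        (¬∃ k < I.encode.length, τ .suc k y = true) ∨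
      (∃ a, I.encode[x]? = some a ∧ isTickTok a = true) ∧
        ∃ k < I.encode.length, τ .suc x k = true ∧
          ∃ u < I.encode.length, τ .suc u y = true ∧ τ .nat k u = true :=
    fun _ _ _ => Iff.rfl
  refine ⟨by simp [natQ, zeroQ, Cmd.Pure], fun _ _ _ _ => Iff.rfl, fun τ hk hr x hx y hy hs => ?_,
    fun τ hk hc x hx y hy ht => ?_⟩
  · rw [h, sat_zero hk (by decide) hy, isDone_iff, isTickTok_iff] at hs
    simp only [hk .suc (by decide), rel] at hs
    rcases hs with ⟨hd, rfl⟩ | ⟨ht, k, -, ⟨-, -, rfl⟩, u, -, ⟨-, -, rfl⟩, hn⟩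
    · exact begins_nat_zero.2 hd
    · exact begins_nat_succ.2 ⟨ht, (hr _ _ hn).2.2⟩
  · simp only [rel] at ht
    induction y generalizing x with
    | zero =>
      refine hc x hx 0 hy ((h _ _ _).2 (.inl ⟨isDone_iff.2 (begins_nat_zero.1 ht),
        (sat_zero hk (by decide) hy).2 rfl⟩))
    | succ y ih =>
      obtain ⟨h₁, h₂⟩ := begins_nat_succ.1 ht
      have := h₂.length_le (by simp [encodeNat])
      rw [length_encodeNat] at this
      refine hc x hx _ hy ((h _ _ _).2 (.inr ⟨isTickTok_iff.2 h₁, x + 1, by omega,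
        (hk .suc (by decide) _ _).2 ⟨hx, by omega, rfl⟩, y, by omega,
        (hk .suc (by decide) _ _).2 ⟨by omega, hy, rfl⟩, ih _ (by omega) (by omega) h₂⟩))

/-- The content model of the label `1` begins at position `2`. The two numbers at the beginning of
the string are skipped first, then one content model after the other. -/
def contentQ : Cmd (Fin 12) Rel :=
  or (and (zeroQ 1) (ex 3 (and (zeroQ 3) (ex 4 (and (get .term 3 4) (get .term 4 2))))))
    (ex 3 (and (get .suc 3 1) (ex 4 (and (get .content 3 4) (get .term 4 2)))))

theorem term_size : Term I.encode 0 (I.n + 1) := by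
  have := term_nat I.begins_size
  rwa [Nat.zero_add] at this

theorem term_root : Term I.encode (I.n + 1) (I.off 0) := by
  have := term_nat I.begins_root
  rwa [off_zero]

theorem term_content (a : Fin I.n) : Term I.encode (I.off a) (I.off (a + 1)) := by
  rw [off_succ]
  exact (I.at_content a).term

theorem defines_content : I.Defines .content contentQ := by
  have h : ∀ x y τ, Sat I.encode contentQ (env x y) τ ↔
      (¬∃ k < I.encode.length, τ .suc k x = true) ∧
        (∃ z < I.encode.length, (¬∃ k < I.encode.length, τ .suc k z = true) ∧
          ∃ k < I.encode.length, τ .term z k = true ∧ τ .term k y = true) ∨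
      ∃ u < I.encode.length, τ .suc u x = true ∧
        ∃ k < I.encode.length, τ .content u k = true ∧ τ .term k y = true :=
    fun _ _ _ => Iff.rfl
  refine ⟨by simp [contentQ, zeroQ, Cmd.Pure], fun _ _ _ _ => Iff.rfl, fun τ hk hr x hx y hy hs => ?_,
    fun τ hk hc x hx y hy ht => ?_⟩
  · rw [h, sat_zero hk (by decide) hx] at hs
    rcases hs with ⟨rfl, z, hz, hz', k, -, h₁, h₂⟩ | ⟨u, -, h₁, k, -, h₂, h₃⟩
    · obtain rfl := (sat_zero hk (by decide) hz).1 hz'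
      obtain rfl := ((hk .term (by decide) _ _).1 h₁).2.2.unique term_size
      exact ⟨Nat.zero_le _, ((hk .term (by decide) _ _).1 h₂).2.2.unique term_root⟩
    · obtain rfl := ((hk .suc (by decide) _ _).1 h₁).2.2
      obtain ⟨hu, rfl⟩ := (hr _ _ h₂).2.2
      have ht := ((hk .term (by decide) _ _).1 h₃).2.2
      rcases hu.eq_or_lt with rfl | hlt
      · have := ht.unique I.term_expr_off
        omega
      · exact ⟨hlt, ht.unique (term_content ⟨u, hlt⟩)⟩
  · obtain ⟨hn, rfl⟩ := ht
    induction x with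
    | zero =>
      have := (term_root (I := I)).lt
      refine hc 0 hx _ hy ((h _ _ _).2 (.inl ⟨(sat_zero hk (by decide) hx).2 rfl, 0, hx,
        (sat_zero hk (by decide) hx).2 rfl, I.n + 1, by omega,
        (hk .term (by decide) _ _).2 ⟨hx, by omega, term_size⟩,
        (hk .term (by decide) _ _).2 ⟨by omega, hy, term_root⟩⟩))
    | succ v ih =>
      have h₁ := term_content (I := I) ⟨v, hn⟩
      have h₂ := h₁.lt
      simp only at h₁ h₂
      exact hc _ hx _ hy ((h _ _ _).2 (.inr ⟨v, by omega,
        (hk .suc (by decide) _ _).2 ⟨by omega, hx, rfl⟩, I.off v, by omega,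
        ih (by omega) (by omega) (by omega),
        (hk .term (by decide) _ _).2 ⟨by omega, hy, h₁⟩⟩))

/-- The label that goes with position `1` is `2`; position `0` stands for the root. -/
def labelQ : Cmd (Fin 12) Rel :=
  or (and (zeroQ 1) (ex 3 (and (get .term 1 3) (get .nat 3 2))))
    (and (tok 1 isLabelled) (ex 3 (and (get .suc 1 3) (get .nat 3 2))))

theorem defines_label : I.Defines .label labelQ := by
  refine .of_iff (by simp [labelQ, zeroQ, Cmd.Pure]) (fun _ _ _ _ => Iff.rfl) fun τ hk x hx y hy => ?_
  have h : Sat I.encode labelQ (env x y) τ ↔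
      (¬∃ k < I.encode.length, τ .suc k x = true) ∧
        (∃ k < I.encode.length, τ .term x k = true ∧ τ .nat k y = true) ∨
      (∃ a, I.encode[x]? = some a ∧ isLabelled a = true) ∧
        ∃ k < I.encode.length, τ .suc x k = true ∧ τ .nat k y = true := Iff.rfl
  rw [h, sat_zero hk (by decide) hx, isLabelled_iff]
  simp only [hk .suc (by decide), hk .term (by decide), hk .nat (by decide), rel]
  refine or_congr ?_ (and_congr_right fun _ => ?_)
  · constructor
    · rintro ⟨rfl, k, -, ⟨-, -, ht⟩, -, -, hn⟩
      obtain rfl := ht.unique term_size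
      exact ⟨rfl, begins_nat_unique hn I.begins_root⟩
    · rintro ⟨rfl, rfl⟩
      have := (term_root (I := I)).lt
      have := I.off_lt (Nat.zero_le _)
      exact ⟨rfl, I.n + 1, by omega, ⟨hx, by omega, term_size⟩, by omega, hy, I.begins_root⟩
  · constructor
    · rintro ⟨k, -, ⟨-, -, rfl⟩, -, -, hn⟩
      exact hn
    · intro hn
      have := hn.length_le (by simp [encodeNat])
      rw [length_encodeNat] at this
      exact ⟨x + 1, by omega, ⟨hx, by omega, rfl⟩, by omega, hy, hn⟩

/-- Position `2` is an occurrence of a symbol in the content model of the label `1`. -/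
def occQ : Cmd (Fin 12) Rel :=
  and (tok 2 isSym) (ex 3 (and (get .content 1 3) (and (get .le 3 2)
    (ex 4 (and (get .term 3 4) (ltQ 2 4))))))

theorem defines_occ : I.Defines .occ occQ := by
  refine .of_iff (by simp [occQ, ltQ, Cmd.Pure]) (fun _ _ _ _ => Iff.rfl) fun τ hk x hx y hy => ?_
  have h : Sat I.encode occQ (env x y) τ ↔
      (∃ a, I.encode[y]? = some a ∧ isSym a = true) ∧
        ∃ i < I.encode.length, τ .content x i = true ∧ τ .le i y = true ∧
          ∃ j < I.encode.length, τ .term i j = true ∧ ¬τ .le j y = true := Iff.rfl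
  rw [h, isSym_iff]
  simp only [hk .le (by decide), hk .term (by decide), hk .content (by decide), rel]
  constructor
  · rintro ⟨hs, i, hi, ⟨-, -, hn, rfl⟩, ⟨-, -, hle⟩, j, hj, ⟨-, -, ht⟩, hlt⟩
    rcases hn.eq_or_lt with rfl | hn
    · have := ht.unique I.term_expr_off
      omega
    · have := ht.unique (term_content ⟨x, hn⟩)
      refine ⟨⟨x, hn⟩, rfl, (I.at_content ⟨x, hn⟩).exists_occ hle ?_ hs⟩
      rw [← off_succ]
      simp only at this ⊢
      omega
  · rintro ⟨a, rfl, b, hb⟩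
    have h₁ := occ_lt hb
    have h₂ := I.off_lt (k := a + 1) a.2
    exact ⟨(occ_token hb).1, I.off a, by omega, ⟨hx, by omega, a.2.le, rfl⟩, ⟨by omega, hy, h₁.1⟩,
      I.off (a + 1), h₂, ⟨by omega, h₂, term_content a⟩, by omega⟩

/-- The positions `1` and `2` are in the scope of a common star after the position `4`. -/
def inStarQ : Cmd (Fin 12) Rel :=
  ex 5 (ex 6 (and (tok 5 isStar) (and (get .le 4 5) (and (get .term 5 6)
    (and (ltQ 5 1) (and (ltQ 5 2) (and (ltQ 1 6) (ltQ 2 6))))))))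

/-- The positions `1` and `2` are on the left and on the right side of an alternative that begins
after the position `4`. -/
def splitQ : Cmd (Fin 12) Rel :=
  ex 5 (ex 6 (ex 7 (ex 8 (and (tok 5 isAlt) (and (get .le 4 5) (and (get .suc 5 6)
    (and (get .term 6 7) (and (get .term 7 8) (and (ltQ 5 1) (and (ltQ 1 7)
      (and (get .le 7 2) (ltQ 2 8))))))))))))

/-- The occurrence `1` can be used before the occurrence `2` of the same content model. -/
def seqQ : Cmd (Fin 12) Rel :=
  ex 3 (ex 4 (and (get .content 3 4) (and (get .occ 3 1) (and (get .occ 3 2)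
    (or inStarQ (and (ltQ 1 2) (not splitQ)))))))

theorem sat_inStarQ {w : List Tok} {ρ : Fin 12 → ℕ} {τ : Tabs Rel} : Sat w inStarQ ρ τ ↔
    ∃ s < w.length, ∃ e < w.length, (∃ a, w[s]? = some a ∧ isStar a = true) ∧
      τ .le (ρ 4) s = true ∧ τ .term s e = true ∧ ¬τ .le (ρ 1) s = true ∧ ¬τ .le (ρ 2) s = true ∧
      ¬τ .le e (ρ 1) = true ∧ ¬τ .le e (ρ 2) = true := by
  simp only [inStarQ, ltQ, Sat, Function.update_apply, Fin.isValue, Fin.reduceEq, ↓reduceIte]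

theorem sat_splitQ {w : List Tok} {ρ : Fin 12 → ℕ} {τ : Tabs Rel} : Sat w splitQ ρ τ ↔
    ∃ s < w.length, ∃ k < w.length, ∃ m < w.length, ∃ e < w.length,
      (∃ a, w[s]? = some a ∧ isAlt a = true) ∧ τ .le (ρ 4) s = true ∧ τ .suc s k = true ∧
      τ .term k m = true ∧ τ .term m e = true ∧ ¬τ .le (ρ 1) s = true ∧ ¬τ .le m (ρ 1) = true ∧
      τ .le m (ρ 2) = true ∧ ¬τ .le e (ρ 2) = true := by
  simp only [splitQ, ltQ, Sat, Function.update_apply, Fin.isValue, Fin.reduceEq, ↓reduceIte]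

theorem sat_seqQ {w : List Tok} {ρ : Fin 12 → ℕ} {τ : Tabs Rel} : Sat w seqQ ρ τ ↔
    ∃ v < w.length, ∃ i < w.length, τ .content v i = true ∧ τ .occ v (ρ 1) = true ∧
      τ .occ v (ρ 2) = true ∧
      ((∃ s < w.length, ∃ e < w.length, (∃ a, w[s]? = some a ∧ isStar a = true) ∧
        τ .le i s = true ∧ τ .term s e = true ∧ ¬τ .le (ρ 1) s = true ∧ ¬τ .le (ρ 2) s = true ∧
        ¬τ .le e (ρ 1) = true ∧ ¬τ .le e (ρ 2) = true) ∨
      ¬τ .le (ρ 2) (ρ 1) = true ∧ ¬∃ s < w.length, ∃ k < w.length, ∃ m < w.length,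
        ∃ e < w.length, (∃ a, w[s]? = some a ∧ isAlt a = true) ∧ τ .le i s = true ∧
          τ .suc s k = true ∧ τ .term k m = true ∧ τ .term m e = true ∧
          ¬τ .le (ρ 1) s = true ∧ ¬τ .le m (ρ 1) = true ∧ τ .le m (ρ 2) = true ∧
          ¬τ .le e (ρ 2) = true) := by
  simp only [seqQ, ltQ, Sat, sat_inStarQ, sat_splitQ, Function.update_apply, Fin.isValue,
    Fin.reduceEq, ↓reduceIte]

theorem defines_seq : I.Defines .seq seqQ := by
  refine .of_iff (by simp [seqQ, inStarQ, splitQ, ltQ, Cmd.Pure]) (fun _ _ _ _ => by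
    rw [sat_seqQ, sat_seqQ]; exact Iff.rfl) fun τ hk x hx y hy => ?_
  have h : Sat I.encode seqQ (env x y) τ ↔
      ∃ v < I.encode.length, ∃ i < I.encode.length, τ .content v i = true ∧ τ .occ v x = true ∧
        τ .occ v y = true ∧
        ((∃ s < I.encode.length, ∃ e < I.encode.length,
          (∃ a, I.encode[s]? = some a ∧ isStar a = true) ∧ τ .le i s = true ∧ τ .term s e = true ∧
          ¬τ .le x s = true ∧ ¬τ .le y s = true ∧ ¬τ .le e x = true ∧ ¬τ .le e y = true) ∨
        ¬τ .le y x = true ∧ ¬∃ s < I.encode.length, ∃ k < I.encode.length,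
          ∃ m < I.encode.length, ∃ e < I.encode.length,
            (∃ a, I.encode[s]? = some a ∧ isAlt a = true) ∧ τ .le i s = true ∧
            τ .suc s k = true ∧ τ .term k m = true ∧ τ .term m e = true ∧ ¬τ .le x s = true ∧
            ¬τ .le m x = true ∧ τ .le m y = true ∧ ¬τ .le e y = true) := sat_seqQ
  rw [h]
  simp only [isStar_iff, isAlt_iff, hk .le (by decide), hk .suc (by decide), hk .term (by decide),
    hk .content (by decide), hk .occ (by decide), rel]
  have key : ∀ (a b b' : Fin I.n), I.problem.Occ a x b → I.problem.Occ a y b' →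
      (I.problem.Seq a x y ↔ Core.InStar I.encode (I.off a) x y ∨
        x < y ∧ ¬Core.Split I.encode (I.off a) x y) := fun a b b' hb hb' =>
    (I.at_content a).seq_iff hb hb'
  have hterm : ∀ (a : Fin I.n) s e, I.off a ≤ s → s < I.off (a + 1) → Term I.encode s e →
      e < I.encode.length := fun a s e h₁ h₂ h₃ => by
    have h₄ := I.off_lt (k := a + 1) a.2
    rw [off_succ] at h₂ h₄
    exact ((I.at_content a).term_le h₁ h₂ h₃).trans_lt h₄
  constructor
  · rintro ⟨v, -, i, -, ⟨-, -, -, rfl⟩, ⟨-, -, a, rfl, b, hb⟩, ⟨-, -, a', ha', b', hb'⟩, hs⟩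
    obtain rfl := Fin.ext ha'
    refine ⟨a, (key a b b' hb hb').2 ?_⟩
    rcases hs with ⟨s, hs, e, he, h₁, h₂, h₃, h₄, h₅, h₆, h₇⟩ | ⟨h₁, h₂⟩
    · exact .inl ⟨s, e, h₁, h₂.2.2, h₃.2.2, by omega, by omega, by omega, by omega⟩
    · refine .inr ⟨by omega, fun ⟨s, m, e, h₃, h₄, h₅, h₆, h₇, h₈, h₉, h₀⟩ => h₂ ?_⟩
      have hxo := occ_lt hb
      have := hterm a s e h₄ (by omega) (.two h₃ rfl h₅ h₆)
      have := h₅.lt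
      have := h₆.lt
      exact ⟨s, by omega, s + 1, by omega, m, by omega, e, by omega, h₃, ⟨by omega, by omega, h₄⟩,
        ⟨by omega, by omega, rfl⟩, ⟨by omega, by omega, h₅⟩, ⟨by omega, by omega, h₆⟩,
        by omega, by omega, ⟨by omega, by omega, h₉⟩, by omega⟩
  · rintro ⟨a, hs⟩
    obtain ⟨⟨b, hb⟩, ⟨b', hb'⟩⟩ := Core.Seq.occ hs
    have hxo := occ_lt hb
    refine ⟨a, label_lt a, I.off a, by omega, ⟨label_lt a, by omega, a.2.le, rfl⟩,
      ⟨label_lt a, hx, a, rfl, b, hb⟩, ⟨label_lt a, hy, a, rfl, b', hb'⟩, ?_⟩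
    rcases (key a b b' hb hb').1 hs with ⟨s, e, h₁, h₂, h₃, h₄, h₅, h₆, h₇⟩ | ⟨h₁, h₂⟩
    · have := hterm a s e h₂ (by omega) h₃
      exact .inl ⟨s, by omega, e, by omega, h₁, ⟨by omega, by omega, h₂⟩, ⟨by omega, by omega, h₃⟩,
        by omega, by omega, by omega, by omega⟩
    · refine .inr ⟨by omega, ?_⟩
      rintro ⟨s, -, k, -, m, -, e, -, h₃, h₄, ⟨-, -, rfl⟩, h₅, h₆, h₇, h₈, h₉, h₀⟩
      exact h₂ ⟨s, m, e, h₃, h₄.2.2, h₅.2.2, h₆.2.2, by omega, by omega, h₉.2.2, by omega⟩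

end Input

end XPathSat

namespace XPathSat

open Cmd

namespace Input

variable {I : Input}

/-! ### Queries for the criterion -/

/-- A step along an axis that passes the test `f` is made at time `i`. -/
def stepQ (f : Axis → Bool) (i : Fin 12) : Cmd (Fin 12) Rel := tok i (isStep f)

/-- A node is entered at time `i`. -/
def entryQ (i : Fin 12) : Cmd (Fin 12) Rel := stepQ (fun χ => !isParent χ) i

/-- A sibling step is made at time `i`. -/
def siblingQ (i : Fin 12) : Cmd (Fin 12) Rel := stepQ (fun χ => isFollowing χ || isPreceding χ) i

theorem isSibling_iff {t : ℕ} :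
    (∃ a, I.encode[t]? = some a ∧ isStep (fun χ => isFollowing χ || isPreceding χ) a = true) ↔
      ∃ χ l, I.problem.step t = some (χ, l) ∧ (χ = .following ∨ χ = .preceding) := by
  rw [isStep_iff]
  refine exists_congr fun χ => exists_congr fun l => and_congr_right fun _ => ?_
  cases χ <;> simp [isFollowing, isPreceding]

/-- The current node at time `2` is the parent of the current node at time `1`. -/
def parQ : Cmd (Fin 12) Rel :=
  or (and (stepQ isChild 1) (get .suc 2 1)) (ex 3 (and (get .suc 3 1) (or
    (and (or (not (stepQ (fun _ => true) 1)) (siblingQ 1)) (get .par 3 2))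
    (and (stepQ isParent 1) (ex 4 (and (get .par 3 4) (get .par 4 2)))))))

theorem defines_par : I.Defines .par parQ := by
  have h : ∀ x y τ, Sat I.encode parQ (env x y) τ ↔
      (∃ a, I.encode[x]? = some a ∧ isStep isChild a = true) ∧ τ .suc y x = true ∨
      ∃ u < I.encode.length, τ .suc u x = true ∧
        (((¬∃ a, I.encode[x]? = some a ∧ isStep (fun _ => true) a = true) ∨
          ∃ a, I.encode[x]? = some a ∧
            isStep (fun χ => isFollowing χ || isPreceding χ) a = true) ∧ τ .par u y = true ∨
        (∃ a, I.encode[x]? = some a ∧ isStep isParent a = true) ∧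
          ∃ m < I.encode.length, τ .par u m = true ∧ τ .par m y = true) :=
    fun _ _ _ => Iff.rfl
  simp only [isChild_iff, isSome_iff, isSibling_iff, isParent_iff] at h
  refine ⟨by simp [parQ, stepQ, siblingQ, Cmd.Pure], fun _ _ _ _ => Iff.rfl,
    fun τ hk hr x hx y hy hs => ?_, fun τ hk hc x hx y hy ht => ?_⟩
  · simp only [h, hk .suc (by decide), rel, not_not] at hs
    rcases hs with ⟨⟨l, hl⟩, -, -, rfl⟩ | ⟨u, -, ⟨-, -, rfl⟩, ⟨h₁ | ⟨χ, l, h₁, h₂⟩, hp⟩ |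
      ⟨⟨l, h₁⟩, m, -, hp, hp'⟩⟩
    · exact .child hl
    · exact .stay h₁ (hr _ _ hp).2.2
    · exact .sibling h₁ h₂ (hr _ _ hp).2.2
    · exact .parent h₁ (hr _ _ hp).2.2 (hr _ _ hp').2.2
  · simp only [h, hk .suc (by decide), rel, not_not] at hc
    simp only [rel] at ht
    induction ht with
    | child hl => exact hc _ hx _ hy (.inl ⟨⟨_, hl⟩, hy, hx, rfl⟩)
    | stay hl hp ih =>
      exact hc _ hx _ hy (.inr ⟨_, by omega, ⟨by omega, hx, rfl⟩,
        .inl ⟨.inl hl, ih (by omega) hy⟩⟩)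
    | sibling hl hχ hp ih =>
      exact hc _ hx _ hy (.inr ⟨_, by omega, ⟨by omega, hx, rfl⟩,
        .inl ⟨.inr ⟨_, _, hl, hχ⟩, ih (by omega) hy⟩⟩)
    | parent hl hp hp' ih ih' =>
      have := hp.stack.2
      exact hc _ hx _ hy (.inr ⟨_, by omega, ⟨by omega, hx, rfl⟩,
        .inr ⟨⟨_, hl⟩, _, by omega, ih (by omega) (by omega), ih' (by omega) hy⟩⟩)

/-- `2` is the current node at time `1`. -/
def curQ : Cmd (Fin 12) Rel :=
  or (or (and (zeroQ 1) (zeroQ 2)) (and (entryQ 1) (and (get .le 1 2) (get .le 2 1))))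
    (ex 3 (and (get .suc 3 1) (or
      (and (not (stepQ (fun _ => true) 1)) (get .cur 3 2))
      (and (stepQ isParent 1) (ex 4 (and (get .par 3 4) (get .cur 4 2)))))))

theorem defines_cur : I.Defines .cur curQ := by
  have h : ∀ x y τ, Sat I.encode curQ (env x y) τ ↔
      ((¬∃ k < I.encode.length, τ .suc k x = true) ∧
        (¬∃ k < I.encode.length, τ .suc k y = true) ∨
        (∃ a, I.encode[x]? = some a ∧ isStep (fun χ => !isParent χ) a = true) ∧
          τ .le x y = true ∧ τ .le y x = true) ∨
      ∃ u < I.encode.length, τ .suc u x = true ∧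
        ((¬∃ a, I.encode[x]? = some a ∧ isStep (fun _ => true) a = true) ∧ τ .cur u y = true ∨
        (∃ a, I.encode[x]? = some a ∧ isStep isParent a = true) ∧
          ∃ m < I.encode.length, τ .par u m = true ∧ τ .cur m y = true) :=
    fun _ _ _ => Iff.rfl
  simp only [isSome_iff, isEntry_iff, isParent_iff] at h
  refine ⟨by simp [curQ, zeroQ, entryQ, stepQ, Cmd.Pure], fun _ _ _ _ => Iff.rfl,
    fun τ hk hr x hx y hy hs => ?_, fun τ hk hc x hx y hy ht => ?_⟩
  · rw [h, sat_zero hk (by decide) hx, sat_zero hk (by decide) hy] at hs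
    simp only [hk .suc (by decide), hk .le (by decide), hk .par (by decide), rel, not_not] at hs
    simp only [rel]
    rcases hs with (⟨rfl, rfl⟩ | ⟨he, ⟨-, -, h₁⟩, -, -, h₂⟩) | ⟨u, -, ⟨-, -, rfl⟩, ⟨h₁, hp⟩ |
      ⟨⟨l, h₁⟩, m, -, ⟨-, -, hp⟩, hp'⟩⟩
    · rfl
    · obtain rfl : x = y := by omega
      obtain ⟨l, hl⟩ := Problem.stack_head_of_entry he
      simp [hl]
    · rw [Problem.stack_none h₁]
      exact (hr _ _ hp).2.2
    · rw [Problem.stack_parent h₁, ← hp.stack.1]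
      exact (hr _ _ hp').2.2
  · simp only [rel] at ht
    induction x using Nat.strong_induction_on with
    | _ x ih =>
      refine hc x hx y hy ((h _ _ _).2 ?_)
      rw [sat_zero hk (by decide) hx, sat_zero hk (by decide) hy]
      simp only [hk .suc (by decide), hk .le (by decide), hk .par (by decide), rel, not_not]
      cases x with
      | zero =>
        simp only [Problem.stack, List.getElem?_cons_zero, Option.some.injEq] at ht
        exact .inl (.inl ⟨rfl, ht.symm⟩)
      | succ t =>
        have hentry : I.problem.Entry (t + 1) → t + 1 = y := fun he => by
          obtain ⟨l, hl⟩ := Problem.stack_head_of_entry he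
          simpa [hl] using ht
        by_cases he : I.problem.Entry (t + 1)
        · have := hentry he
          exact .inl (.inr ⟨he, by omega, by omega⟩)
        · rcases hs : I.problem.step (t + 1) with _ | ⟨χ, l⟩
          · rw [Problem.stack_none hs] at ht
            exact .inr ⟨t, by omega, ⟨by omega, hx, rfl⟩,
              .inl ⟨rfl, ih t (by omega) (by omega) ht⟩⟩
          · obtain rfl : χ = .parent := by
              by_contra hχ
              exact he ⟨by omega, χ, l, hs, hχ⟩
            rw [Problem.stack_parent hs, List.getElem?_tail] at ht
            obtain ⟨m, hm, hm'⟩ := Problem.exists_par_of_getElem? ht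
            have := hm.stack.2
            exact .inr ⟨t, by omega, ⟨by omega, hx, rfl⟩, .inr ⟨⟨l, rfl⟩, m, by omega,
              ⟨by omega, by omega, hm⟩, ih m (by omega) (by omega) hm'⟩⟩

/-- `2` is the parent of the current node at time `1`. -/
def upQ : Cmd (Fin 12) Rel := ex 3 (and (get .par 1 3) (get .cur 3 2))

theorem defines_up : I.Defines .up upQ := by
  refine .of_iff (by simp [upQ, Cmd.Pure]) (fun _ _ _ _ => Iff.rfl) fun τ hk x hx y hy => ?_
  have h : Sat I.encode upQ (env x y) τ ↔
      ∃ s < I.encode.length, τ .par x s = true ∧ τ .cur s y = true := Iff.rfl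
  simp only [h, hk .par (by decide), hk .cur (by decide), rel]
  constructor
  · rintro ⟨s, -, ⟨-, -, h₁⟩, -, -, h₂⟩
    exact h₁.getElem? h₂
  · intro h'
    obtain ⟨s, h₁, h₂⟩ := Problem.exists_par_of_getElem? h'
    have := h₁.stack.2
    exact ⟨s, by omega, ⟨hx, by omega, h₁⟩, by omega, hy, h₂⟩

theorem same_label_iff {m : ℕ} {τ : Tabs Rel} (hk : I.Known m τ) (hm : 5 < m) {c d : ℕ}
    (hc : c < I.encode.length) (hd : d < I.encode.length)
    (hc' : c = 0 ∨ ∃ χ l, I.problem.step c = some (χ, l))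
    (hd' : d = 0 ∨ ∃ χ l, I.problem.step d = some (χ, l)) :
    (∃ b < I.encode.length, τ .label c b = true ∧ τ .label d b = true) ↔
      I.problem.lab c = I.problem.lab d := by
  simp only [hk .label hm, label_of_entry hc', label_of_entry hd']
  constructor
  · rintro ⟨b, -, ⟨-, -, h₁⟩, -, -, h₂⟩
    exact Fin.ext (h₁.symm.trans h₂)
  · intro h
    exact ⟨_, label_lt (I.problem.lab c), ⟨hc, label_lt _, rfl⟩, hd, label_lt _, by rw [h]⟩

/-- The query for `Problem.Cand`. -/
def candQ : Cmd (Fin 12) Rel :=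
  and (entryQ 1) (ex 3 (and (get .up 1 3) (ex 4 (and (get .label 3 4) (and (get .occ 4 2)
    (ex 5 (and (get .label 1 5) (get .label 2 5))))))))

theorem defines_cand : I.Defines .cand candQ := by
  refine .of_iff (by simp [candQ, entryQ, stepQ, Cmd.Pure]) (fun _ _ _ _ => Iff.rfl)
    fun τ hk x hx y hy => ?_
  have h : Sat I.encode candQ (env x y) τ ↔
      (∃ a, I.encode[x]? = some a ∧ isStep (fun χ => !isParent χ) a = true) ∧
      ∃ d < I.encode.length, τ .up x d = true ∧ ∃ v < I.encode.length, τ .label d v = true ∧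
        τ .occ v y = true ∧ ∃ b < I.encode.length, τ .label x b = true ∧ τ .label y b = true :=
    Iff.rfl
  rw [h, isEntry_iff]
  simp only [hk .up (by decide), hk .label (by decide), hk .occ (by decide)]
  refine and_congr_right fun he => ?_
  constructor
  · rintro ⟨d, -, ⟨-, -, hd⟩, v, -, ⟨-, -, hv⟩, ⟨-, -, a, rfl, b, hb⟩, l, -, ⟨-, -, h₁⟩, -, -, h₂⟩
    rw [label_of_parent hd] at hv
    rw [label_of_entry (.inr (entry_step he))] at h₁
    rw [label_of_occ hb] at h₂
    obtain rfl := Fin.ext hv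
    obtain rfl := Fin.ext (h₁.symm.trans h₂)
    exact ⟨d, hd, hb⟩
  · rintro ⟨d, hd, hb⟩
    have hdl := Problem.lt_of_parent hd
    refine ⟨d, by omega, ⟨hx, by omega, hd⟩, _, label_lt (I.problem.lab d),
      ⟨by omega, label_lt _, (label_of_parent hd).2 rfl⟩, ⟨label_lt _, hy, _, rfl, _, hb⟩, _,
      label_lt (I.problem.lab x), ⟨hx, label_lt _,
        (label_of_entry (.inr (entry_step he))).2 rfl⟩, hy, label_lt _, (label_of_occ hb).2 rfl⟩

/-- The query for `Problem.Pos`. -/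
def posQ : Cmd (Fin 12) Rel :=
  and (get .cand 1 2) (or (stepQ isChild 1) (ex 3 (and (get .suc 3 1) (ex 4 (and (get .cur 3 4)
    (ex 5 (and (get .pos 4 5) (or (and (stepQ isFollowing 1) (get .seq 5 2))
      (and (stepQ isPreceding 1) (get .seq 2 5))))))))))

theorem defines_pos : I.Defines .pos posQ := by
  have h : ∀ x y τ, Sat I.encode posQ (env x y) τ ↔ τ .cand x y = true ∧
      ((∃ a, I.encode[x]? = some a ∧ isStep isChild a = true) ∨
      ∃ u < I.encode.length, τ .suc u x = true ∧ ∃ d < I.encode.length, τ .cur u d = true ∧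
        ∃ p < I.encode.length, τ .pos d p = true ∧
          ((∃ a, I.encode[x]? = some a ∧ isStep isFollowing a = true) ∧ τ .seq p y = true ∨
          (∃ a, I.encode[x]? = some a ∧ isStep isPreceding a = true) ∧ τ .seq y p = true)) :=
    fun _ _ _ => Iff.rfl
  simp only [isChild_iff, isFollowing_iff, isPreceding_iff] at h
  refine ⟨by simp [posQ, stepQ, Cmd.Pure], fun _ _ _ _ => Iff.rfl,
    fun τ hk hr x hx y hy hs => ?_, fun τ hk hc x hx y hy ht => ?_⟩
  · rw [h, hk .cand (by decide)] at hs
    obtain ⟨⟨-, -, he, hcand⟩, hs⟩ := hs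
    simp only [hk .suc (by decide), hk .cur (by decide), hk .seq (by decide)] at hs
    rcases hs with ⟨l, hl⟩ | ⟨u, -, ⟨-, -, rfl⟩, d, -, ⟨-, -, hd⟩, p, -, hp, ⟨⟨l, hl⟩, -, -, hs⟩ |
      ⟨⟨l, hl⟩, -, -, hs⟩⟩
    · obtain ⟨t, rfl⟩ := Nat.exists_eq_succ_of_ne_zero he.1
      exact .child hl hcand
    · exact .following hl hcand hd (hr _ _ hp).2.2 ((link_iff_right hcand).2 hs)
    · exact .preceding hl hcand hd (hr _ _ hp).2.2 ((link_iff_left hcand).2 hs)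
  · simp only [h, hk .cand (by decide), hk .suc (by decide), hk .cur (by decide),
      hk .seq (by decide)] at hc
    simp only [rel] at ht
    induction ht with
    | child hl hq =>
      exact hc _ hx _ hy ⟨⟨hx, hy, ⟨by omega, _, _, hl, by simp⟩, hq⟩, .inl ⟨_, hl⟩⟩
    | following hl hq hd hp hs ih =>
      have h₁ := Problem.le_of_mem_stack (List.mem_of_getElem? hd)
      have h₂ := cand_lt hp.cand
      exact hc _ hx _ hy ⟨⟨hx, hy, ⟨by omega, _, _, hl, by simp⟩, hq⟩, .inr ⟨_, by omega,
        ⟨by omega, hx, rfl⟩, _, by omega, ⟨by omega, by omega, hd⟩, _, h₂, ih (by omega) h₂,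
        .inl ⟨⟨_, hl⟩, h₂, hy, (link_iff_right hq).1 hs⟩⟩⟩
    | preceding hl hq hd hp hs ih =>
      have h₁ := Problem.le_of_mem_stack (List.mem_of_getElem? hd)
      have h₂ := cand_lt hp.cand
      exact hc _ hx _ hy ⟨⟨hx, hy, ⟨by omega, _, _, hl, by simp⟩, hq⟩, .inr ⟨_, by omega,
        ⟨by omega, hx, rfl⟩, _, by omega, ⟨by omega, by omega, hd⟩, _, h₂, ih (by omega) h₂,
        .inr ⟨⟨_, hl⟩, hy, h₂, (link_iff_left hq).1 hs⟩⟩⟩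

/-- The query for `Problem.Same`. -/
def sameQ : Cmd (Fin 12) Rel :=
  or (and (zeroQ 1) (zeroQ 2)) (and (entryQ 1) (and (entryQ 2) (ex 3 (ex 4 (and (get .up 1 3)
    (and (get .up 2 4) (and (get .same 3 4) (and (ex 5 (and (get .label 1 5) (get .label 2 5)))
      (or (and (get .le 1 2) (get .le 2 1))
        (ex 5 (and (get .cand 1 5) (not (get .seq 5 5)))))))))))))

theorem defines_same : I.Defines .same sameQ := by
  have h : ∀ x y τ, Sat I.encode sameQ (env x y) τ ↔
      (¬∃ k < I.encode.length, τ .suc k x = true) ∧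
        (¬∃ k < I.encode.length, τ .suc k y = true) ∨
      (∃ a, I.encode[x]? = some a ∧ isStep (fun χ => !isParent χ) a = true) ∧
        (∃ a, I.encode[y]? = some a ∧ isStep (fun χ => !isParent χ) a = true) ∧
        ∃ c < I.encode.length, ∃ d < I.encode.length, τ .up x c = true ∧ τ .up y d = true ∧
          τ .same c d = true ∧
          (∃ b < I.encode.length, τ .label x b = true ∧ τ .label y b = true) ∧
          (τ .le x y = true ∧ τ .le y x = true ∨
            ∃ q < I.encode.length, τ .cand x q = true ∧ ¬τ .seq q q = true) :=
    fun _ _ _ => Iff.rfl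
  have houter : ∀ τ, I.Known 13 τ → ∀ x < I.encode.length, I.problem.Entry x →
      ((∃ q < I.encode.length, τ .cand x q = true ∧ ¬τ .seq q q = true) ↔
        I.problem.Outer x) := by
    intro τ hk x hx he
    simp only [hk .cand (by decide), hk .seq (by decide)]
    constructor
    · rintro ⟨q, hq, ⟨-, -, -, hc⟩, hs⟩
      exact ⟨q, hc, fun hl => hs ⟨hq, hq, (link_iff_left hc).1 hl⟩⟩
    · rintro ⟨q, hc, hl⟩
      exact ⟨q, cand_lt hc, ⟨hx, cand_lt hc, he, hc⟩,
        fun hs => hl ((link_iff_left hc).2 hs.2.2)⟩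
  simp only [isEntry_iff] at h
  refine ⟨by simp [sameQ, zeroQ, entryQ, stepQ, Cmd.Pure], fun _ _ _ _ => Iff.rfl,
    fun τ hk hr x hx y hy hs => ?_, fun τ hk hc x hx y hy ht => ?_⟩
  · rw [h, sat_zero hk (by decide) hx, sat_zero hk (by decide) hy] at hs
    rcases hs with ⟨rfl, rfl⟩ | ⟨he, he', c, -, d, -, hc, hd, hs, hl, ho⟩
    · exact .root
    · rw [same_label_iff hk (by decide) hx hy (.inr (entry_step he)) (.inr (entry_step he'))] at hl
      rw [houter τ hk x hx he, hk .le (by decide), hk .le (by decide)] at ho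
      refine .step he he' ((hk .up (by decide) _ _).1 hc).2.2 ((hk .up (by decide) _ _).1 hd).2.2
        (hr _ _ hs).2.2 hl (ho.imp_left fun ho => ?_)
      exact le_antisymm ho.1.2.2 ho.2.2.2
  · simp only [rel] at ht
    induction ht with
    | root =>
      exact hc _ hx _ hy ((h _ _ _).2 (.inl ⟨(sat_zero hk (by decide) hx).2 rfl,
        (sat_zero hk (by decide) hx).2 rfl⟩))
    | step he he' hc' hd' hs hl ho ih =>
      have h₁ := Problem.lt_of_parent hc'
      have h₂ := Problem.lt_of_parent hd'
      refine hc _ hx _ hy ((h _ _ _).2 (.inr ⟨he, he', _, by omega, _, by omega,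
        (hk .up (by decide) _ _).2 ⟨hx, by omega, hc'⟩,
        (hk .up (by decide) _ _).2 ⟨hy, by omega, hd'⟩, ih (by omega) (by omega),
        (same_label_iff hk (by decide) hx hy (.inr (entry_step he)) (.inr (entry_step he'))).2 hl,
        ?_⟩))
      rw [houter τ hk _ hx he, hk .le (by decide), hk .le (by decide)]
      refine ho.imp_left fun ho => ?_
      subst ho
      exact ⟨⟨hx, hx, le_rfl⟩, hx, hx, le_rfl⟩

/-- The query for `Problem.Good.up`. -/
def upGoodQ : Cmd (Fin 12) Rel :=
  not (ex 3 (and (stepQ isParent 3) (ex 4 (and (get .suc 4 3) (not (ex 5 (and (get .up 4 5)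
    (ex 6 (and (get .label 5 6) (get .label 3 6))))))))))

/-- The query for `Problem.Good.pos`. -/
def posGoodQ : Cmd (Fin 12) Rel := not (ex 3 (and (entryQ 3) (not (ex 4 (get .pos 3 4)))))

/-- The query for `Problem.Good.compat`. -/
def compatQ : Cmd (Fin 12) Rel :=
  not (ex 3 (ex 4 (ex 5 (ex 6 (and (entryQ 3) (and (entryQ 4) (and (get .up 3 5) (and (get .up 4 6)
    (and (get .same 5 6) (and (not (ex 7 (and (get .label 3 7) (get .label 4 7))))
      (not (ex 7 (ex 8 (and (get .cand 3 7) (and (get .cand 4 8)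
        (or (get .seq 7 8) (get .seq 8 7)))))))))))))))))

theorem sat_upGoodQ {ρ : Fin 12 → ℕ} {τ : Tabs Rel} (hk : I.Known 14 τ) :
    Sat I.encode upGoodQ ρ τ ↔ ∀ t l, I.problem.step (t + 1) = some (.parent, l) →
      ∃ d, (I.problem.stack t)[1]? = some d ∧ I.problem.lab d = l := by
  have h : Sat I.encode upGoodQ ρ τ ↔ ¬∃ t < I.encode.length,
      (∃ a, I.encode[t]? = some a ∧ isStep isParent a = true) ∧ ∃ u < I.encode.length,
        τ .suc u t = true ∧ ¬∃ d < I.encode.length, τ .up u d = true ∧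
          ∃ b < I.encode.length, τ .label d b = true ∧ τ .label t b = true := by
    simp only [upGoodQ, stepQ, Sat, Function.update_apply, Fin.isValue, Fin.reduceEq, ↓reduceIte]
  rw [h]
  simp only [isParent_iff, hk .suc (by decide), hk .up (by decide), rel]
  constructor
  · intro h t l hl
    have ht := lt_length_of_step hl
    by_contra hn
    refine h ⟨t + 1, ht, ⟨l, hl⟩, t, by omega, ⟨by omega, ht, rfl⟩, ?_⟩
    rintro ⟨d, hd, ⟨-, -, hd'⟩, hb⟩
    rw [same_label_iff hk (by decide) hd ht
      ((Problem.entry_of_mem_stack (Problem.parent_mem hd')).imp_right entry_step)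
      (.inr ⟨_, l, hl⟩), Problem.lab_succ hl] at hb
    exact hn ⟨d, hd', hb⟩
  · rintro h ⟨_, ht, ⟨l, hl⟩, t, -, ⟨-, -, rfl⟩, hn⟩
    obtain ⟨d, hd, hdl⟩ := h t l hl
    have := Problem.lt_of_parent hd
    refine hn ⟨d, by omega, ⟨by omega, by omega, hd⟩, ?_⟩
    rw [same_label_iff hk (by decide) (by omega) ht
      ((Problem.entry_of_mem_stack (Problem.parent_mem hd)).imp_right entry_step)
      (.inr ⟨_, l, hl⟩), Problem.lab_succ hl]
    exact hdl

theorem sat_posGoodQ {ρ : Fin 12 → ℕ} {τ : Tabs Rel} (hk : I.Known 14 τ) :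
    Sat I.encode posGoodQ ρ τ ↔ ∀ c, I.problem.Entry c → ∃ q, I.problem.Pos c q := by
  have h : Sat I.encode posGoodQ ρ τ ↔ ¬∃ c < I.encode.length,
      (∃ a, I.encode[c]? = some a ∧ isStep (fun χ => !isParent χ) a = true) ∧
        ¬∃ q < I.encode.length, τ .pos c q = true := by
    simp only [posGoodQ, entryQ, stepQ, Sat, Function.update_apply, Fin.isValue, Fin.reduceEq,
      ↓reduceIte]
  rw [h]
  simp only [isEntry_iff, hk .pos (by decide), rel]
  constructor
  · intro h c hc
    by_contra hn
    exact h ⟨c, entry_lt hc, hc, fun ⟨q, _, _, _, hq⟩ => hn ⟨q, hq⟩⟩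
  · rintro h ⟨c, hc, he, hn⟩
    obtain ⟨q, hq⟩ := h c he
    exact hn ⟨q, cand_lt hq.cand, hc, cand_lt hq.cand, hq⟩

theorem sat_compatQ {ρ : Fin 12 → ℕ} {τ : Tabs Rel} (hk : I.Known 14 τ) :
    Sat I.encode compatQ ρ τ ↔ ∀ c d c' d', I.problem.Entry c → I.problem.Entry d →
      (I.problem.stack c)[1]? = some c' → (I.problem.stack d)[1]? = some d' →
      I.problem.Same c' d' → I.problem.lab c = I.problem.lab d ∨
        ∃ p q, I.problem.Cand c p ∧ I.problem.Cand d q ∧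
          (I.problem.Link c p q ∨ I.problem.Link c q p) := by
  have h : Sat I.encode compatQ ρ τ ↔ ¬∃ c < I.encode.length, ∃ d < I.encode.length,
      ∃ c' < I.encode.length, ∃ d' < I.encode.length,
        (∃ a, I.encode[c]? = some a ∧ isStep (fun χ => !isParent χ) a = true) ∧
        (∃ a, I.encode[d]? = some a ∧ isStep (fun χ => !isParent χ) a = true) ∧
        τ .up c c' = true ∧ τ .up d d' = true ∧ τ .same c' d' = true ∧
        (¬∃ b < I.encode.length, τ .label c b = true ∧ τ .label d b = true) ∧
        ¬∃ p < I.encode.length, ∃ q < I.encode.length, τ .cand c p = true ∧ τ .cand d q = true ∧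
          (τ .seq p q = true ∨ τ .seq q p = true) := by
    simp only [compatQ, entryQ, stepQ, Sat, Function.update_apply, Fin.isValue, Fin.reduceEq,
      ↓reduceIte]
  rw [h]
  simp only [isEntry_iff, hk .up (by decide), hk .same (by decide), hk .cand (by decide),
    hk .seq (by decide)]
  constructor
  · intro h c d c' d' hc hd hc' hd' hs
    by_contra hn
    rw [not_or] at hn
    have h₁ := Problem.lt_of_parent hc'
    have h₂ := Problem.lt_of_parent hd'
    have h₃ := entry_lt hc
    have h₄ := entry_lt hd
    refine h ⟨c, h₃, d, h₄, c', by omega, d', by omega, hc, hd, ⟨h₃, by omega, hc'⟩,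
      ⟨h₄, by omega, hd'⟩, ⟨by omega, by omega, hs⟩, ?_, ?_⟩
    · rw [same_label_iff hk (by decide) h₃ h₄ (.inr (entry_step hc)) (.inr (entry_step hd))]
      exact hn.1
    · rintro ⟨p, -, q, -, ⟨-, -, -, hp⟩, ⟨-, -, -, hq⟩, hs⟩
      refine hn.2 ⟨p, q, hp, hq, hs.imp (fun hs => ?_) fun hs => ?_⟩
      · exact (link_iff_left hp).2 hs.2.2
      · exact (link_iff_right hp).2 hs.2.2
  · rintro h ⟨c, h₃, d, h₄, c', -, d', -, hc, hd, ⟨-, -, hc'⟩, ⟨-, -, hd'⟩, ⟨-, -, hs⟩, hl, hn⟩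
    rw [same_label_iff hk (by decide) h₃ h₄ (.inr (entry_step hc)) (.inr (entry_step hd))] at hl
    obtain ⟨p, q, hp, hq, hpq⟩ := (h c d c' d' hc hd hc' hd' hs).resolve_left hl
    have h₅ := cand_lt hp
    have h₆ := cand_lt hq
    refine hn ⟨p, h₅, q, h₆, ⟨h₃, h₅, hc, hp⟩, ⟨h₄, h₆, hd, hq⟩, hpq.imp (fun hs => ?_) fun hs => ?_⟩
    · exact ⟨h₅, h₆, (link_iff_left hp).1 hs⟩
    · exact ⟨h₆, h₅, (link_iff_right hp).1 hs⟩

/-! ### The decision procedure -/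

/-- The query for `Problem.Good`. -/
def goodQ : Cmd (Fin 12) Rel := and upGoodQ (and posGoodQ compatQ)

theorem sat_goodQ {ρ : Fin 12 → ℕ} {τ : Tabs Rel} (hk : I.Known 14 τ) :
    Sat I.encode goodQ ρ τ ↔ I.problem.Good := by
  simp only [goodQ, Sat, sat_upGoodQ hk, sat_posGoodQ hk, sat_compatQ hk]
  exact ⟨fun h => ⟨h.1, h.2.1, h.2.2⟩, fun h => ⟨h.up, h.pos, h.compat⟩⟩

/-- Fill the table `r` and continue. -/
def fillQ (r : Rel) (φ c : Cmd (Fin 12) Rel) : Cmd (Fin 12) Rel := seq (fix r 10 11 1 2 φ) c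

theorem Defines.run_fillQ {r : Rel} {φ c : Cmd (Fin 12) Rel} (h : I.Defines r φ)
    {ρ : Fin 12 → ℕ} (hρ : ρ 0 = 0) {Q : Prop} {m : ℕ} (hm : m = r.level + 1)
    (hc : ∀ τ, I.Filled m τ → ((run I.encode c ρ τ).1 = true ↔ Q)) :
    ∀ τ, I.Filled r.level τ → ((run I.encode (fillQ r φ c) ρ τ).1 = true ↔ Q) := by
  intro τ hτ
  subst hm
  obtain ⟨τ', h₁, h₂⟩ := h.fill hρ hτ
  simp only [fillQ, run, h₁]
  exact hc τ' h₂

/-- Fill all tables and check the criterion. -/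
def satQ : Cmd (Fin 12) Rel :=
  seq (order .le 1 2) (fillQ .suc sucQ (fillQ .term termQ (fillQ .nat natQ
    (fillQ .content contentQ (fillQ .label labelQ (fillQ .occ occQ (fillQ .seq seqQ
      (fillQ .par parQ (fillQ .cur curQ (fillQ .up upQ (fillQ .cand candQ (fillQ .pos posQ
        (fillQ .same sameQ goodQ)))))))))))))

theorem pure_goodQ : goodQ.Pure := by
  simp [goodQ, upGoodQ, posGoodQ, compatQ, entryQ, stepQ, Cmd.Pure]

theorem scoped_satQ : satQ.Scoped [0] := by decide

/-- The query decides satisfiability. -/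
theorem run_satQ (I : Input) :
    (run I.encode satQ (fun _ => 0) fun _ _ _ => false).1 = true ↔ I.expr.Satisfiable I.dtd := by
  rw [satisfiable_iff]
  have h₀ : I.Filled 1 (Function.update (fun _ _ _ => false) Rel.le
      fun x y => decide (x ≤ y ∧ y < I.encode.length)) := by
    intro r x y
    by_cases hr : r = .le
    · subst hr
      simp only [Function.update_self, decide_eq_true_iff, rel, Rel.level]
      omega
    · have : r.level ≠ Rel.le.level := fun h => hr (Rel.level_injective h)
      simp only [Function.update_of_ne hr, Bool.false_eq_true, false_iff]
      intro h
      exact this (show r.level = 0 by have := h.1; omega)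
  have hgood : ∀ τ, I.Filled 14 τ →
      ((run I.encode goodQ (fun _ => 0) τ).1 = true ↔ I.problem.Good) := fun τ hτ => by
    rw [(run_pure I.encode goodQ pure_goodQ _ τ).1]
    exact sat_goodQ fun r hr x y => by rw [hτ, and_iff_right hr]
  have hall := defines_suc.run_fillQ (I := I) (ρ := fun _ => 0) rfl rfl <|
    defines_term.run_fillQ rfl rfl <| defines_nat.run_fillQ rfl rfl <|
    defines_content.run_fillQ rfl rfl <| defines_label.run_fillQ rfl rfl <|
    defines_occ.run_fillQ rfl rfl <| defines_seq.run_fillQ rfl rfl <|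
    defines_par.run_fillQ rfl rfl <| defines_cur.run_fillQ rfl rfl <|
    defines_up.run_fillQ rfl rfl <| defines_cand.run_fillQ rfl rfl <|
    defines_pos.run_fillQ rfl rfl <| defines_same.run_fillQ rfl rfl hgood
  rw [satQ, run, run_order (by decide) _ _ fun _ _ => rfl]
  exact hall _ h₀

end Input

end XPathSat

theorem mainTheorem1 :
    Nonempty (Turing.TM2ComputableInPolyTime XPathSat.Input.encode Computability.encodeBool
      (fun I : XPathSat.Input =>
        @decide (I.expr.Satisfiable I.dtd) (Classical.propDecidable _))) := by
  have henc : ∀ I : XPathSat.Input, I.encode ≠ [] := fun I h => by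
    have := XPathSat.Input.label_lt (I := I) I.dtd.root
    simp [h] at this
  have h := XPathSat.Cmd.computableInPolyTime XPathSat.Input.encode henc
    (z := (0 : Fin 12)) (o := 1) (by decide) XPathSat.Input.scoped_satQ
  have hf : (fun I : XPathSat.Input => @decide (I.expr.Satisfiable I.dtd)
      (Classical.propDecidable _)) = fun I => (XPathSat.Cmd.run I.encode XPathSat.Input.satQ
        (fun _ => 0) fun _ _ _ => false).1 := by
    funext I
    rw [Bool.eq_iff_iff, XPathSat.Input.run_satQ,
      @decide_eq_true_iff _ (Classical.propDecidable _)]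
  rw [hf]
  exact h
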